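/- Let $k$ be an algebraically closed field of characteristic $p\ge 3$. Let $A(n)=k[X_1,\dots,X_n]/(X_1^p,\dots,X_n^p)$ with generators $x_i$ and partial derivatives $\partial_i$, and let $W(n)=\mathrm{Der}_k(A(n))$, a restricted Lie algebra whose $p$-map $D\mapsto D^{[p]}$ is the $p$-th power of derivations. Put $$S(n)=\{D\in W(n):\ \textstyle\sum_i\partial_i(D(x_i))=0\},$$ and, with $i'=i+m$, $\sigma(i)=1$ for $1\le i\le m$ and $i'=i-m$, $\sigma(i)=-1$ for $m+1\le i\le 2m$, $$H(2m)=\Big\{\textstyle\sum_i f_i\partial_i\in W(2m):\ \sigma(i)\partial_{j'}(f_i)=\sigma(j)\partial_{i'}(f_j)\ \text{for all } i,j\Big\}.$$ Let $\mathfrak g$ be one of the restricted Lie algebras $W(n)$ ($n\ge1$), $S(n)^{(1)}$ ($n\ge 3$), $H(2m)^{(2)}$ ($m\ge1$), where $L^{(j)}$ denotes the $j$-th derived algebra; if $\mathfrak g=W(1)$ or $\mathfrak g=H(2)^{(2)}$, assume $p\ge5$. Let $G=\mathrm{Aut}_p(\mathfrak g)$ be the group of automorphisms of the restricted Lie algebra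 $\mathfrak g$, and let $\mu(\mathfrak g)$ be the maximal dimension of a torus of $\mathfrak g$, a torus being an abelian restricted subalgebra all of whose elements are semisimple, and $s\in\mathfrak g$ being semisimple if $s$ lies in the span of $s^{[p]},s^{[p]^2},\dots$. For $0\le r\le\mu(\mathfrak g)$ put $z_i=1+x_i$ for $i\le r$ and $z_i=x_i$ for $i>r$, and let $\mathfrak t_r^{\mathfrak g}$ be the standard torus spanned by * $z_i\partial_i$, $1\le i\le n$, if $\mathfrak g=W(n)$; * $z_i\partial_i-x_n\partial_n$, $1\le i\le n-1$, if $\mathfrak g=S(n)^{(1)}$; * $z_i\partial_i-x_{i'}\partial_{i'}$, $1\le i\le m$, if $\mathfrak g=H(2m)^{(2)}$. For semisimple $s\in\mathfrak g$ put $\mathrm{Ind}(s)=\min\{r:\ 0\le r\le\mu(\mathfrak g),\ G\cdot s\cap\mathfrak t_r^{\mathfrak g}\ne\emptyset\}$, and let $\mathfrak t_r^{\mathfrak g,r}$ be the set of semisimple elements of $\mathfrak t_r^{\mathfrak g}$ of index $r$. Let $W(\mathfrak g,\mathfrak t)=N_G(\mathfrak t)/C_G(\mathfrak t)$ be the Weyl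 group of $\mathfrak g$ relative to $\mathfrak t$, where $N_G(\mathfrak t)$ is the stabilizer and $C_G(\mathfrak t)$ the pointwise stabilizer of $\mathfrak t$ in $G$; it acts on $\mathfrak t$. Then for every such $\mathfrak g$, every $0\le r\le\mu(\mathfrak g)$ and every $d\in\mathfrak t_r^{\mathfrak g,r}$, $$G\cdot d\,\cap\,\mathfrak t_r^{\mathfrak g,r}=\{\,w(d):\ w\in W(\mathfrak g,\mathfrak t_r^{\mathfrak g})\,\}.$$ -/

import Mathlib

open scoped Pointwise

noncomputable section

namespace CartanType

/-! Restricted Lie algebras of derivations.  Throughout, `g` is a Lie subalgebra of `Der_k(A)`, and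
its `p`-map is the `p`-th power of derivations, composed as linear endomorphisms of `A`. -/

section Restricted

variable {k : Type*} [Field k] (p : ℕ) {A : Type*} [CommRing A] [Algebra k A]

/-- A derivation, regarded as a linear endomorphism of `A`. -/
def toEnd (D : Derivation k A A) : Module.End k A := (D : A →ₗ[k] A)

/-- `E = D^[p]` in `g`. -/
def IsPPower (g : LieSubalgebra k (Derivation k A A)) (D E : g) : Prop :=
  toEnd (E : Derivation k A A) = toEnd (D : Derivation k A A) ^ p

/-- `D` is semisimple: it lies in the span of its iterated `p`-th powers
`D^[p], D^[p]^2, D^[p]^3, …`. -/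
def IsSemisimpleElt (g : LieSubalgebra k (Derivation k A A)) (D : g) : Prop :=
  toEnd (D : Derivation k A A) ∈
    Submodule.span k (Set.range fun j : ℕ => toEnd (D : Derivation k A A) ^ p ^ (j + 1))

/-- A torus of `g`: an abelian restricted subalgebra all of whose elements are semisimple. -/
def IsTorus (g : LieSubalgebra k (Derivation k A A)) (t : Submodule k g) : Prop :=
  (∀ x ∈ t, ∀ y ∈ t, ⁅x, y⁆ = 0) ∧ (∀ x ∈ t, ∃ y ∈ t, IsPPower p g x y) ∧
    ∀ x ∈ t, IsSemisimpleElt p g x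

/-- `μ(g)`, the maximal dimension of a torus of `g` (a maximum when `g` is finite-dimensional). -/
def mu (g : LieSubalgebra k (Derivation k A A)) : ℕ :=
  sSup {d | ∃ t : Submodule k g, IsTorus p g t ∧ Module.finrank k t = d}

/-- `G = Aut_p(g)`, the group of automorphisms of the restricted Lie algebra `g`. -/
def autP (g : LieSubalgebra k (Derivation k A A)) : Subgroup (g ≃ₗ[k] g) where
  carrier := {e | (∀ x y : g, e ⁅x, y⁆ = ⁅e x, e y⁆) ∧
    ∀ x y : g, IsPPower p g (e x) (e y) ↔ IsPPower p g x y}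
  one_mem' := ⟨fun _ _ => rfl, fun _ _ => Iff.rfl⟩
  mul_mem' := by
    rintro a b ⟨ha, ha'⟩ ⟨hb, hb'⟩
    refine ⟨fun x y => ?_, fun x y => ?_⟩
    · simp only [LinearEquiv.mul_apply, hb, ha]
    · simp only [LinearEquiv.mul_apply, ha', hb']
  inv_mem' := by
    rintro a ⟨ha, ha'⟩
    refine ⟨fun x y => a.injective ?_, fun x y => ?_⟩
    · rw [ha]
      change a (a.symm _) = ⁅a (a.symm x), a (a.symm y)⁆
      simp only [LinearEquiv.apply_symm_apply]
    · rw [← ha']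
      change IsPPower p g (a (a.symm x)) (a (a.symm y)) ↔ _
      simp only [LinearEquiv.apply_symm_apply]

/-- `N_G(t)`, the elements of `G` with `g(t) = t`. -/
abbrev normalizer (g : LieSubalgebra k (Derivation k A A)) (t : Submodule k g) :
    Subgroup (autP p g) :=
  MulAction.stabilizer (autP p g) (t : Set g)

/-- `C_G(t)`, the elements of `G` fixing `t` pointwise. -/
abbrev centralizer (g : LieSubalgebra k (Derivation k A A)) (t : Submodule k g) :
    Subgroup (autP p g) :=
  fixingSubgroup (autP p g) (t : Set g)

instance centralizer_normal (g : LieSubalgebra k (Derivation k A A)) (t : Submodule k g) :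
    ((centralizer p g t).subgroupOf (normalizer p g t)).Normal where
  conj_mem := by
    intro c hc n
    rw [Subgroup.mem_subgroupOf, mem_fixingSubgroup_iff] at hc ⊢
    intro y hy
    have h1 : (c : autP p g) • ((n⁻¹ : normalizer p g t) : autP p g) • y
        = ((n⁻¹ : normalizer p g t) : autP p g) • y :=
      hc _ (n⁻¹ • (⟨y, hy⟩ : (t : Set g))).2
    rw [Subgroup.coe_mul, Subgroup.coe_mul, mul_smul, mul_smul, h1, ← mul_smul,
      ← Subgroup.coe_mul, mul_inv_cancel, Subgroup.coe_one, one_smul]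

/-- The Weyl group `W(g, t) = N_G(t) / C_G(t)`. -/
abbrev weylGroup (g : LieSubalgebra k (Derivation k A A)) (t : Submodule k g) : Type _ :=
  normalizer p g t ⧸ (centralizer p g t).subgroupOf (normalizer p g t)

/-- The action of `W(g, t)` on `t` induced by the action of `N_G(t)` on `t`. -/
instance weylAction (g : LieSubalgebra k (Derivation k A A)) (t : Submodule k g) :
    MulAction (weylGroup p g t) (t : Set g) where
  smul w x := Quotient.liftOn' w (fun n => n • x) (by
    intro a b hab
    rw [QuotientGroup.leftRel_apply, Subgroup.mem_subgroupOf, mem_fixingSubgroup_iff] at hab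
    have h : (a⁻¹ * b) • x = x := Subtype.ext (hab _ x.2)
    rw [mul_smul, inv_smul_eq_iff] at h
    exact h.symm)
  one_smul x := one_smul (normalizer p g t) x
  mul_smul a b x := by
    induction a using QuotientGroup.induction_on with
    | H a =>
      induction b using QuotientGroup.induction_on with
      | H b => exact mul_smul a b x

variable (g : LieSubalgebra k (Derivation k A A)) (t : ℕ → Submodule k g)

/-- `Ind(s) = min {r ; 0 ≤ r ≤ μ(g), G.s ∩ t_r ≠ ∅}`, for a family of tori `t_r`. -/
def index (s : g) : ℕ :=
  sInf {r | r ≤ mu p g ∧ (MulAction.orbit (autP p g) s ∩ (t r : Set g)).Nonempty}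

/-- `t_r^{g,r}`: the semisimple elements of `g` that lie in `t_r` and have index `r`. -/
def indexPart (r : ℕ) : Set g :=
  {s | s ∈ t r ∧ IsSemisimpleElt p g s ∧ index p g t s = r}

end Restricted

/-! The truncated polynomial ring and the three families of Lie algebras. -/

section Families

variable (k : Type*) [Field k] (p : ℕ)

/-- `A = k[X_i : i ∈ ι] / (X_i^p : i ∈ ι)`. -/
def A (ι : Type*) : Type _ :=
  MvPolynomial ι k ⧸ Ideal.span (Set.range fun i : ι => (MvPolynomial.X i : MvPolynomial ι k) ^ p)

instance (ι : Type*) : CommRing (A k p ι) :=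
  inferInstanceAs (CommRing (MvPolynomial ι k ⧸
    Ideal.span (Set.range fun i : ι => (MvPolynomial.X i : MvPolynomial ι k) ^ p)))

instance (ι : Type*) : Algebra k (A k p ι) :=
  inferInstanceAs (Algebra k (MvPolynomial ι k ⧸
    Ideal.span (Set.range fun i : ι => (MvPolynomial.X i : MvPolynomial ι k) ^ p)))

/-- The quotient map `k[X_i : i ∈ ι] → A`. -/
def mkA (ι : Type*) : MvPolynomial ι k →ₐ[k] A k p ι :=
  Ideal.Quotient.mkₐ k
    (Ideal.span (Set.range fun i : ι => (MvPolynomial.X i : MvPolynomial ι k) ^ p))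

theorem mkA_surjective (ι : Type*) : Function.Surjective (mkA k p ι) :=
  Ideal.Quotient.mkₐ_surjective k _

theorem mkA_eq_zero_iff (ι : Type*) (f : MvPolynomial ι k) : mkA k p ι f = 0 ↔
    f ∈ Ideal.span (Set.range fun i : ι => (MvPolynomial.X i : MvPolynomial ι k) ^ p) :=
  Ideal.Quotient.eq_zero_iff_mem

variable {ι : Type*}

/-- The generator `x_i` of `A`. -/
def x (i : ι) : A k p ι := mkA k p ι (MvPolynomial.X i)

theorem der_ext {D E : Derivation k (A k p ι) (A k p ι)} (h : ∀ i, D (x k p i) = E (x k p i)) :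
    D = E := by
  refine Derivation.ext_of_adjoin_eq_top (Set.range (x k p)) ?_ ?_
  · have h1 : Set.range (x k p (ι := ι)) = mkA k p ι '' Set.range MvPolynomial.X := by
      rw [← Set.range_comp]; rfl
    rw [h1, ← AlgHom.map_adjoin, MvPolynomial.adjoin_range_X, Algebra.map_top,
      AlgHom.range_eq_top]
    exact mkA_surjective k p ι
  · rintro _ ⟨i, rfl⟩; exact h i

variable [CharP k p]

theorem pderiv_mem (i : ι) (f : MvPolynomial ι k) (hf : mkA k p ι f = 0) :
    mkA k p ι (MvPolynomial.pderiv i f) = 0 := by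
  rw [mkA_eq_zero_iff] at hf ⊢
  induction hf using Submodule.span_induction with
  | mem f hf =>
    obtain ⟨j, rfl⟩ := hf
    simp [Derivation.leibniz_pow]
  | zero => simp
  | add f g _ _ hf hg => rw [map_add]; exact add_mem hf hg
  | smul a f hf hf' =>
    rw [smul_eq_mul, Derivation.leibniz, smul_eq_mul, smul_eq_mul]
    exact add_mem (Ideal.mul_mem_left _ _ hf') (Ideal.mul_mem_right _ _ hf)

/-- The partial derivative `∂_i` of `A`. -/
def pd (i : ι) : Derivation k (A k p ι) (A k p ι) :=
  Derivation.liftOfSurjective (mkA_surjective k p ι) (pderiv_mem k p i)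

theorem pd_mkA (i : ι) (f : MvPolynomial ι k) :
    pd k p i (mkA k p ι f) = mkA k p ι (MvPolynomial.pderiv i f) :=
  Derivation.liftOfSurjective_apply (mkA_surjective k p ι) (pderiv_mem k p i) f

theorem pd_x [DecidableEq ι] (i j : ι) : pd k p i (x k p j) = if j = i then 1 else 0 := by
  rw [x, pd_mkA, MvPolynomial.pderiv_X]
  by_cases hij : j = i
  · subst hij; simp
  · simp [hij]

theorem pd_comm (i j : ι) (f : A k p ι) : pd k p i (pd k p j f) = pd k p j (pd k p i f) := by
  classical
  have h : ⁅pd k p i, pd k p j⁆ = (0 : Derivation k (A k p ι) (A k p ι)) := by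
    apply der_ext
    intro l
    rw [Derivation.commutator_apply, pd_x, pd_x]
    split_ifs <;> simp
  have := congrArg (fun D => D f) h
  simpa [Derivation.commutator_apply, sub_eq_zero] using this

theorem der_eq_sum [Fintype ι] (D : Derivation k (A k p ι) (A k p ι)) (f : A k p ι) :
    D f = ∑ i, D (x k p i) * pd k p i f := by
  classical
  have hsum : ∀ a : A k p ι, (∑ i, D (x k p i) • pd k p i) a = ∑ i, D (x k p i) * pd k p i a :=
    fun a => by
      rw [← Derivation.coeFnAddMonoidHom_apply, map_sum, Finset.sum_apply]
      rfl
  have h : D = ∑ i, D (x k p i) • pd k p i := by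
    apply der_ext
    intro l
    simp [hsum, pd_x]
  conv_lhs => rw [h]
  exact hsum f

/-- The Jacobson-Witt algebra `W = Der_k(A)`. -/
abbrev W (ι : Type*) : LieSubalgebra k (Derivation k (A k p ι) (A k p ι)) := ⊤

/-- The divergence `div(D) = ∑ ∂_i(D(x_i))`. -/
def divergence [Fintype ι] (D : Derivation k (A k p ι) (A k p ι)) : A k p ι :=
  ∑ i, pd k p i (D (x k p i))

theorem divergence_lie [Fintype ι] (D E : Derivation k (A k p ι) (A k p ι)) :
    divergence k p ⁅D, E⁆ = D (divergence k p E) - E (divergence k p D) := by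
  have key : ∀ D E : Derivation k (A k p ι) (A k p ι),
      ∑ i, pd k p i (D (E (x k p i))) = ∑ i, ∑ j, pd k p i (D (x k p j)) * pd k p j (E (x k p i))
        + D (divergence k p E) := by
    intro D E
    have h : ∀ i, pd k p i (D (E (x k p i))) =
        ∑ j, pd k p i (D (x k p j)) * pd k p j (E (x k p i))
          + D (pd k p i (E (x k p i))) := by
      intro i
      rw [der_eq_sum k p D (E (x k p i)), der_eq_sum k p D (pd k p i (E (x k p i))),
        map_sum, ← Finset.sum_add_distrib]
      refine Finset.sum_congr rfl fun j _ => ?_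
      rw [Derivation.leibniz, smul_eq_mul, smul_eq_mul, pd_comm k p j i]
      ring
    rw [Finset.sum_congr rfl fun i _ => h i, Finset.sum_add_distrib, divergence, map_sum]
  unfold divergence
  simp only [Derivation.commutator_apply, map_sub, Finset.sum_sub_distrib]
  rw [key D E, key E D, Finset.sum_comm]
  simp only [divergence, mul_comm]
  ring

/-- The Lie algebra `S = {D ∈ W ; div(D) = 0}`. -/
def S (ι : Type*) [Fintype ι] : LieSubalgebra k (Derivation k (A k p ι) (A k p ι)) where
  carrier := {D | divergence k p D = 0}
  zero_mem' := by simp [divergence]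
  add_mem' := by
    intro D E hD hE
    simp only [Set.mem_ofPred_eq, divergence] at hD hE ⊢
    simp [Finset.sum_add_distrib, hD, hE]
  smul_mem' := by
    intro c D hD
    simp only [Set.mem_ofPred_eq, divergence] at hD ⊢
    simp [← Finset.smul_sum, hD]
  lie_mem' := by
    intro D E hD hE
    change divergence k p D = 0 at hD
    change divergence k p E = 0 at hE
    change divergence k p ⁅D, E⁆ = 0
    rw [divergence_lie, hD, hE]
    simp

/-- The sign `σ(i)`; the variables `x_1, …, x_m` are indexed by `Sum.inl` and `x_{m+1}, …, x_{2m}`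
by `Sum.inr`, so that `i' = i.swap`. -/
def sgn {m : ℕ} : Fin m ⊕ Fin m → k
  | Sum.inl _ => 1
  | Sum.inr _ => -1

/-- The Lie algebra `H(2m)`: the `D = ∑ f_i ∂_i` in `W(2m)` with
`σ(i) ∂_{j'}(f_i) = σ(j) ∂_{i'}(f_j)` for all `i, j`; here `f_i = D(x_i)`. -/
def H (m : ℕ) :
    LieSubalgebra k (Derivation k (A k p (Fin m ⊕ Fin m)) (A k p (Fin m ⊕ Fin m))) where
  carrier := {D | ∀ i j, sgn k i • pd k p j.swap (D (x k p i)) =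
    sgn k j • pd k p i.swap (D (x k p j))}
  zero_mem' := by intro i j; simp
  add_mem' := by
    intro D E hD hE i j
    simp only [Derivation.add_apply, map_add, smul_add]
    rw [hD i j, hE i j]
  smul_mem' := by
    intro c D hD i j
    simp only [Derivation.smul_apply, Derivation.map_smul]
    rw [smul_comm, hD i j, smul_comm]
  lie_mem' := by
    intro D E hD hE i j
    have hs : ∀ l : Fin m ⊕ Fin m, sgn k l.swap = - sgn k l := by
      rintro (l | l) <;> simp [sgn]
    have key : ∀ D E : Derivation k (A k p (Fin m ⊕ Fin m)) (A k p (Fin m ⊕ Fin m)),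
        (∀ i j : Fin m ⊕ Fin m, sgn k i • pd k p j.swap (E (x k p i)) = sgn k j • pd k p i.swap (E (x k p j))) →
        ∀ i j : Fin m ⊕ Fin m, sgn k i • pd k p j.swap (D (E (x k p i))) =
        - ∑ l, sgn k l • (pd k p j.swap (D (x k p l)) * pd k p i.swap (E (x k p l.swap)))
          + D (sgn k i • pd k p j.swap (E (x k p i))) := by
      intro D E hE i j
      rw [der_eq_sum k p D (E (x k p i)), der_eq_sum k p D (sgn k i • _),
        map_sum, Finset.smul_sum, ← Finset.sum_neg_distrib, ← Finset.sum_add_distrib]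
      refine Finset.sum_congr rfl fun l _ => ?_
      have h := hE i l.swap
      rw [Sum.swap_swap, hs, neg_smul] at h
      have h' : sgn k i • (pd k p l (E (x k p i)) * pd k p j.swap (D (x k p l))) =
          -(sgn k l • (pd k p j.swap (D (x k p l)) * pd k p i.swap (E (x k p l.swap)))) := by
        rw [← smul_mul_assoc, h, neg_mul, smul_mul_assoc, mul_comm]
      rw [Derivation.leibniz, smul_eq_mul, smul_eq_mul, Derivation.map_smul,
        pd_comm k p l j.swap, smul_add, h', mul_smul_comm, add_comm]
    have hD' : ∀ i j : Fin m ⊕ Fin m, sgn k i • pd k p j.swap (D (x k p i)) =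
      sgn k j • pd k p i.swap (D (x k p j)) := hD
    have hE' : ∀ i j : Fin m ⊕ Fin m, sgn k i • pd k p j.swap (E (x k p i)) =
      sgn k j • pd k p i.swap (E (x k p j)) := hE
    have swapsum : ∀ i j : Fin m ⊕ Fin m,
        ∑ l, sgn k l • (pd k p j.swap (D (x k p l)) * pd k p i.swap (E (x k p l.swap))) =
        - ∑ l, sgn k l • (pd k p i.swap (E (x k p l)) * pd k p j.swap (D (x k p l.swap))) := by
      intro i j
      rw [← Finset.sum_neg_distrib]
      refine Fintype.sum_equiv (Equiv.sumComm _ _) _ _ fun l => ?_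
      simp only [Equiv.sumComm_apply, hs, Sum.swap_swap, neg_smul, neg_neg, mul_comm]
    simp only [Derivation.commutator_apply, map_sub, smul_sub]
    rw [key D E hE' i j, key E D hD' i j, key D E hE' j i, key E D hD' j i, hE' i j, hD' i j,
      swapsum i j, swapsum j i]
    ring

/-- The `j`-th derived algebra `L^{(j)}` of a Lie subalgebra `L` of `W`. -/
def derived (L : LieSubalgebra k (Derivation k (A k p ι) (A k p ι))) (j : ℕ) :
    LieSubalgebra k (Derivation k (A k p ι) (A k p ι)) :=
  (LieAlgebra.derivedSeries k L j).toLieSubalgebra.map L.incl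

/-- `z_i ∂_i`, where `z_i = 1 + x_i` if `shift` holds and `z_i = x_i` otherwise. -/
def euler (shift : Prop) [Decidable shift] (i : ι) : Derivation k (A k p ι) (A k p ι) :=
  (if shift then 1 + x k p i else x k p i) • pd k p i

/-- The standard torus `t_r^W` of `W(n)`, spanned by `(1 + x_i) ∂_i` for the first `r` indices `i`
and by `x_i ∂_i` for the others (indices run from `0` to `n - 1` in `Fin n`). -/
def torusW (n r : ℕ) : Submodule k (W k p (Fin n)) :=
  (Submodule.span k {D | ∃ i : Fin n, D = euler k p (i.val < r) i}).comap
    (W k p (Fin n)).toSubmodule.subtype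

/-- The standard torus `t_r^S` of `S(n)^{(1)}`, spanned by `(1 + x_i) ∂_i - x_n ∂_n` for the first
`r` indices `i < n` and by `x_i ∂_i - x_n ∂_n` for the other `i < n`; `l` is the last index. -/
def torusS (n r : ℕ) : Submodule k (derived k p (S k p (Fin n)) 1) :=
  (Submodule.span k {D | ∃ i l : Fin n, i < l ∧ l.val + 1 = n ∧
    D = euler k p (i.val < r) i - euler k p False l}).comap
    (derived k p (S k p (Fin n)) 1).toSubmodule.subtype

/-- The standard torus `t_r^H` of `H(2m)^{(2)}`, spanned by `(1 + x_i) ∂_i - x_{i'} ∂_{i'}` for the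
first `r` indices `i ≤ m` and by `x_i ∂_i - x_{i'} ∂_{i'}` for the other `i ≤ m`. -/
def torusH (m r : ℕ) : Submodule k (derived k p (H k p m) 2) :=
  (Submodule.span k {D | ∃ i : Fin m,
    D = euler k p (i.val < r) (Sum.inl i) - euler k p False (Sum.inr i)}).comap
    (derived k p (H k p m) 2).toSubmodule.subtype

end Families

end CartanType

end

open scoped Pointwise

noncomputable section

namespace CartanType

/-! The truncated polynomial ring: universal property, augmentation, finite dimension. -/

section Ring

variable {k : Type*} [Field k] {p : ℕ} {ι : Type*}

/-! One inclusion is formal: the normalizer keeps the torus, and the index is constant on orbits.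
For the other, an automorphism of `g` carrying `d` to another element of the index part has to be
replaced by one that normalizes the torus.

Elements of the torus are `∑ a_i z_i ∂_i`; let `R` be the set of shifted coordinates. If the `a_i`
with `i ∈ R` are dependent over the prime field, an invertible monomial substitution in the units
`z_i` makes one of these coefficients vanish. That coordinate need not be shifted, so the index
drops. Hence index `r` forces independence (`Indep`). Let `U` be the span over the prime field of
the `a_i`, `i ∈ R`. Two invariants matter: the space `U`, and, for each nonzero class modulo `U`,
the number of `j ∉ R` with `a_j` in that class.

Both are invariant under all automorphisms (`range_wt_eq`, `card_weight_eq`): they can be read off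
from the weight vectors of `ad d` once it is known which elements of `g` vanish at the origin. That
property is intrinsic, being detected by nilpotency of products of adjoint maps (`mem_fil_one_iff`).
`IsAmple` and `IsRich` list the elements `g` must contain for these arguments to work.

Conversely, suppose `a` and `b` have the same invariants. Their parts in `R` are two bases of `U`,
related by an invertible matrix `N` over the prime field, and off `R` a permutation `π` makes `b_j -
a_{π j}` lie in `U`. The substitution `z_i ↦ z^{N_i}`, `x_j ↦ x_{π j} z^{c_j}` then normalizes the
torus and carries `a` to `b`. This settles `W`. For `S`, vanishing of the coefficient sums forces
the columns of exponents to sum to one, which makes the substitution compatible with the divergence.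
For `H`, conjugate pairs are matched instead of single coordinates, and the conjugates of the
shifted coordinates go to `z^{-N_i}` times a quadratic Hamiltonian. `orbit_inter_indexPart_of_moves`
combines the invariants with the substitutions. -/

theorem x_pow (i : ι) : x k p i ^ p = 0 := by
  rw [x, ← map_pow, mkA_eq_zero_iff]
  exact Ideal.subset_span ⟨i, rfl⟩

/-- Induction principle for `A`: a predicate stable under linear combinations and under
multiplication by the generators. -/
theorem A_induction {P : A k p ι → Prop} (one : P 1) (add : ∀ f g, P f → P g → P (f + g))
    (smul : ∀ (c : k) f, P f → P (c • f)) (mul : ∀ f i, P f → P (f * x k p i)) (f : A k p ι) :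
    P f := by
  obtain ⟨f, rfl⟩ := mkA_surjective k p ι f
  induction f using MvPolynomial.induction_on with
  | C a =>
    have h := smul a 1 one
    rwa [← Algebra.algebraMap_eq_smul_one, ← (mkA k p ι).commutes, ← MvPolynomial.C_eq_algebraMap] at h
  | add f g hf hg => rw [map_add]; exact add _ _ hf hg
  | mul_X f i hf => rw [map_mul]; exact mul _ _ hf

theorem algHom_ext {B : Type*} [CommRing B] [Algebra k B] {f g : A k p ι →ₐ[k] B}
    (h : ∀ i, f (x k p i) = g (x k p i)) : f = g := by
  ext a
  induction a using A_induction with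
  | one => simp
  | add a b ha hb => simp [ha, hb]
  | smul c a ha => simp [ha]
  | mul a i ha => simp [ha, h]

/-- The algebra homomorphism `A → B` with `x_i ↦ y_i`, where `y_i ^ p = 0`. -/
def lift {B : Type*} [CommRing B] [Algebra k B] (y : ι → B) (hy : ∀ i, y i ^ p = 0) :
    A k p ι →ₐ[k] B :=
  Ideal.Quotient.liftₐ
    (Ideal.span (Set.range fun i : ι => (MvPolynomial.X i : MvPolynomial ι k) ^ p))
    (MvPolynomial.aeval y) (by
      intro a ha
      induction ha using Submodule.span_induction with
      | mem f hf => obtain ⟨j, rfl⟩ := hf; simp [hy]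
      | zero => simp
      | add f g _ _ hf hg => rw [map_add, hf, hg, add_zero]
      | smul a f _ hf => rw [smul_eq_mul, map_mul, hf, mul_zero])

theorem lift_x {B : Type*} [CommRing B] [Algebra k B] (y : ι → B) (hy : ∀ i, y i ^ p = 0) (i : ι) :
    lift y hy (x k p i) = y i :=
  MvPolynomial.aeval_X y i

variable [hp : Fact p.Prime]

variable (k p ι) in
/-- The augmentation `A → k`, `x_i ↦ 0`. -/
def aug : A k p ι →ₐ[k] k := lift (fun _ => 0) fun _ => zero_pow hp.out.ne_zero

@[simp] theorem aug_x (i : ι) : aug k p ι (x k p i) = 0 := lift_x _ _ i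

variable (k p ι) in
/-- The maximal ideal of `A`. -/
def maxI : Ideal (A k p ι) := RingHom.ker (aug k p ι)

theorem mem_maxI {f : A k p ι} : f ∈ maxI k p ι ↔ aug k p ι f = 0 := RingHom.mem_ker

theorem x_mem_maxI (i : ι) : x k p i ∈ maxI k p ι := mem_maxI.2 (aug_x i)

/-- Modulo the nilradical all generators die, so the quotient map and the augmentation followed by
the scalars are two algebra maps agreeing on generators. -/
theorem isNilpotent_sub_aug (f : A k p ι) :
    IsNilpotent (f - algebraMap k (A k p ι) (aug k p ι f)) := by
  have h : Ideal.Quotient.mkₐ k (nilradical (A k p ι)) =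
      ((Algebra.ofId k _).comp (aug k p ι)) := by
    apply algHom_ext
    intro i
    rw [AlgHom.comp_apply, aug_x, map_zero]
    exact Ideal.Quotient.eq_zero_iff_mem.2 ⟨p, x_pow i⟩
  have h1 := DFunLike.congr_fun h f
  change Ideal.Quotient.mk _ f = Ideal.Quotient.mk _ (algebraMap k _ (aug k p ι f)) at h1
  exact mem_nilradical.1 (Ideal.Quotient.eq.1 h1)

variable [Finite ι]

/-- `A` is of finite type, and integral because each element is a scalar plus a nilpotent. -/
instance : Module.Finite k (A k p ι) := by
  have hft : Algebra.FiniteType k (A k p ι) :=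
    Algebra.FiniteType.of_surjective (mkA k p ι) (mkA_surjective k p ι)
  have hint : Algebra.IsIntegral k (A k p ι) := by
    constructor
    intro f
    obtain ⟨n, hn⟩ := isNilpotent_sub_aug f
    have h1 : IsIntegral k (f - algebraMap k (A k p ι) (aug k p ι f)) := by
      rcases Nat.eq_zero_or_pos n with rfl | hn0
      · have : Subsingleton (A k p ι) := subsingleton_of_zero_eq_one (by simpa using hn.symm)
        rw [Subsingleton.elim (f - _) (0 : A k p ι)]; exact isIntegral_zero
      · refine IsIntegral.of_pow hn0 ?_
        rw [hn]; exact isIntegral_zero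
    have h2 := h1.add (isIntegral_algebraMap (x := aug k p ι f))
    rwa [sub_add_cancel] at h2
  exact Algebra.IsIntegral.finite

theorem maxI_isNilpotent : IsNilpotent (maxI k p ι) := by
  have : IsNoetherian k (A k p ι) := inferInstance
  have hN : IsNoetherianRing (A k p ι) := isNoetherian_of_tower k this
  rw [Ideal.FG.isNilpotent_iff_le_nilradical (hN.noetherian _)]
  intro f hf
  have h := isNilpotent_sub_aug f
  rw [mem_maxI.1 hf, map_zero, sub_zero] at h
  exact h

end Ring

/-! Derivations and the filtration by powers of the maximal ideal. -/

section Filtration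

variable {k : Type*} [Field k] {p : ℕ} [hp : Fact p.Prime] {ι : Type*}

theorem one_add_x_pow [CharP k p] (i : ι) : (1 + x k p i) ^ p = 1 := by
  have : CharP (A k p ι) p := by
    have : Nontrivial (A k p ι) := (aug k p ι).toRingHom.domain_nontrivial
    exact charP_of_injective_algebraMap (algebraMap k (A k p ι)).injective p
  rw [add_pow_char, x_pow, one_pow, add_zero]

/-- The value at the origin of a derivation. -/
def ev (ι : Type*) : Derivation k (A k p ι) (A k p ι) →ₗ[k] (ι → k) where
  toFun D i := aug k p ι (D (x k p i))
  map_add' D E := by ext i; simp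
  map_smul' c D := by ext i; simp

theorem ev_apply (D : Derivation k (A k p ι) (A k p ι)) (i : ι) :
    ev ι D i = aug k p ι (D (x k p i)) := rfl

/-- By the Leibniz rule a derivation lowers the order of vanishing by one and adds its own order
`s`. For `j = 0` the claimed exponent is weaker than the hypothesis, so truncated subtraction does
no harm. -/
theorem der_pow_mem {D : Derivation k (A k p ι) (A k p ι)} {s : ℕ}
    (hD : ∀ f, D f ∈ maxI k p ι ^ s) {j : ℕ} {f : A k p ι} (hf : f ∈ maxI k p ι ^ j) :
    D f ∈ maxI k p ι ^ (j + s - 1) := by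
  cases j with
  | zero => exact Ideal.pow_le_pow_right (by omega) (hD f)
  | succ j =>
    rw [show j + 1 + s - 1 = j + s by omega]
    induction j generalizing f with
    | zero => rw [zero_add]; exact hD f
    | succ j ih =>
      rw [pow_succ] at hf
      induction hf using Submodule.mul_induction_on' with
      | mem_mul_mem g hg h hh =>
        rw [Derivation.leibniz, smul_eq_mul, smul_eq_mul]
        refine add_mem ?_ ?_
        · rw [pow_add]
          exact Ideal.mul_mem_mul hg (hD h)
        · rw [show j + 1 + s = 1 + (j + s) by ring, pow_add, pow_one]
          exact Ideal.mul_mem_mul hh (ih hg)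
      | add g _ h _ hg hh => rw [map_add]; exact add_mem hg hh

variable (k p ι) in
/-- The derivations with image in the `s`-th power of the maximal ideal. -/
def fil (s : ℕ) : Submodule k (Derivation k (A k p ι) (A k p ι)) where
  carrier := {D | ∀ f, D f ∈ maxI k p ι ^ s}
  zero_mem' f := by simp
  add_mem' hD hE f := add_mem (hD f) (hE f)
  smul_mem' c D hD f := by
    rw [Derivation.smul_apply, Algebra.smul_def]; exact Ideal.mul_mem_left _ _ (hD f)

theorem mem_fil {s : ℕ} {D : Derivation k (A k p ι) (A k p ι)} :
    D ∈ fil k p ι s ↔ ∀ f, D f ∈ maxI k p ι ^ s := Iff.rfl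

theorem fil_anti {s t : ℕ} (h : s ≤ t) : fil k p ι t ≤ fil k p ι s :=
  fun _ hD f => Ideal.pow_le_pow_right h (hD f)

theorem mem_fil_zero (D : Derivation k (A k p ι) (A k p ι)) : D ∈ fil k p ι 0 := fun f => by simp

/-- The index of `fil` exceeds the usual degree by one (`x_i ∂_j` lies in `fil 1`), which is why the
exponents add up to `s + t - 1`. -/
theorem lie_mem_fil {s t : ℕ} {D E : Derivation k (A k p ι) (A k p ι)} (hD : D ∈ fil k p ι s)
    (hE : E ∈ fil k p ι t) : ⁅D, E⁆ ∈ fil k p ι (s + t - 1) := fun f => by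
  rw [Derivation.commutator_apply]
  refine sub_mem ?_ (der_pow_mem hE (hD f))
  rw [add_comm s t]
  exact der_pow_mem hD (hE f)

theorem exists_fil_eq_bot [Finite ι] : ∃ N, fil k p ι N = ⊥ := by
  obtain ⟨N, hN⟩ := maxI_isNilpotent (k := k) (p := p) (ι := ι)
  refine ⟨N, (Submodule.eq_bot_iff _).2 fun D hD => ?_⟩
  ext f
  simpa [hN] using hD f

variable [CharP k p]

section Fin

variable [Fintype ι]

theorem mem_fil_iff {s : ℕ} {D : Derivation k (A k p ι) (A k p ι)} :
    D ∈ fil k p ι s ↔ ∀ i, D (x k p i) ∈ maxI k p ι ^ s := by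
  refine ⟨fun h i => h _, fun h f => ?_⟩
  rw [der_eq_sum]
  exact sum_mem fun i _ => Ideal.mul_mem_right _ _ (h i)

theorem mem_fil_one {D : Derivation k (A k p ι) (A k p ι)} :
    D ∈ fil k p ι 1 ↔ ev ι D = 0 := by
  rw [mem_fil_iff, funext_iff]
  simp [mem_maxI, ev_apply]

/-- First-order Taylor expansion at the origin. -/
theorem sub_linear_mem (f : A k p ι) :
    f - algebraMap k _ (aug k p ι f) - ∑ j, aug k p ι (pd k p j f) • x k p j ∈
      maxI k p ι ^ 2 := by
  classical
  induction f using A_induction with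
  | one => simp
  | add f g hf hg =>
    convert add_mem hf hg using 1
    simp only [map_add, add_smul, Finset.sum_add_distrib]; ring
  | smul c f hf =>
    have := Ideal.mul_mem_left _ (algebraMap k _ c) hf
    convert this using 1
    rw [← Algebra.smul_def, smul_sub, smul_sub, Finset.smul_sum]
    simp [Algebra.algebraMap_eq_smul_one, mul_smul]
  | mul f i hf =>
    have h1 : (f - algebraMap k _ (aug k p ι f)) * x k p i ∈ maxI k p ι ^ 2 := by
      rw [pow_two]
      exact Ideal.mul_mem_mul (mem_maxI.2 (by simp)) (x_mem_maxI i)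
    convert h1 using 1
    simp only [map_mul, aug_x, mul_zero, map_zero, sub_zero, Derivation.leibniz, smul_eq_mul,
      pd_x, map_add, zero_mul, add_zero]
    simp [sub_mul, Algebra.algebraMap_eq_smul_one]

theorem mem_maxI_sq {f : A k p ι} (h0 : aug k p ι f = 0)
    (h : ∀ j, aug k p ι (pd k p j f) = 0) : f ∈ maxI k p ι ^ 2 := by
  simpa [h0, h] using sub_linear_mem f

end Fin

end Filtration

end CartanType

end

open scoped Pointwise

set_option linter.unusedSectionVars false

noncomputable section

namespace CartanType

/-! The standard maximal subalgebra is invariant under all automorphisms of the Lie algebra. -/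

section Invariance

variable {k : Type*} [Field k] {p : ℕ} [hp : Fact p.Prime] [CharP k p] {ι : Type*} [Fintype ι]
  [DecidableEq ι]

/-- Conditions on the components of degree `-1`, `0` and `2` of a Lie algebra of derivations
which make its subalgebra of derivations vanishing at the origin invariant. -/
structure IsAmple (g : LieSubalgebra k (Derivation k (A k p ι) (A k p ι))) : Prop where
  exists_ev : ∀ v : ι → k, ∃ D ∈ g, ev ι D = v
  exists_linear : ∀ (u : ι → k) (j₀ : ι), u ≠ 0 → ∃ y ∈ g, y ∈ fil k p ι 1 ∧
    ∀ (E : Derivation k (A k p ι) (A k p ι)) (s : k), ev ι E = s • u →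
      ∀ j, aug k p ι (E (y (x k p j))) = if j = j₀ then s else 0
  exists_cubic : ∀ v : ι → k, v ≠ 0 → ∃ m ∈ g, m ∈ fil k p ι 3 ∧ ∃ (u : ι → k) (c : k),
    u ≠ 0 ∧ c ≠ 0 ∧ ∀ (X Y E : Derivation k (A k p ι) (A k p ι)) (s : k), ev ι X = v → ev ι Y = v →
      ev ι E = s • u → ∀ i, aug k p ι (X (Y (E (m (x k p i))))) = c * s * u i

theorem aug_der_eq_zero {D : Derivation k (A k p ι) (A k p ι)} {s : ℕ} (hD : D ∈ fil k p ι s)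
    {j : ℕ} {f : A k p ι} (hf : f ∈ maxI k p ι ^ j) (h : 2 ≤ j + s) :
    aug k p ι (D f) = 0 := by
  have h1 := Ideal.pow_le_pow_right (show 1 ≤ j + s - 1 by omega) (der_pow_mem hD hf)
  rwa [pow_one, mem_maxI] at h1

/-- Third derivatives at the origin of a function of order three depend only on the values of the
derivations there, so the order is immaterial: the commutator costs one order instead of two. -/
theorem aug_der_swap (X Y E : Derivation k (A k p ι) (A k p ι)) {f : A k p ι}
    (hf : f ∈ maxI k p ι ^ 3) :
    aug k p ι (X (Y (E f))) = aug k p ι (X (E (Y f))) := by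
  have h : aug k p ι (X (⁅Y, E⁆ f)) = 0 :=
    aug_der_eq_zero (mem_fil_zero X) (der_pow_mem (mem_fil_zero ⁅Y, E⁆) hf) (by norm_num)
  rwa [Derivation.commutator_apply, map_sub, map_sub, sub_eq_zero] at h

variable {g : LieSubalgebra k (Derivation k (A k p ι) (A k p ι))}

/-- The case `s = 0` of the hypothesis says that `T` preserves the elements vanishing on the line's
quotient, so `T` acts on values at the origin along `u` as multiplication by `c ≠ 0`; its powers
never vanish there. -/
theorem not_isNilpotent_of_eigenvector (hev : ∀ v : ι → k, ∃ D ∈ g, ev ι D = v)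
    {T : Module.End k g} {u : ι → k} {c : k} (hu : u ≠ 0) (hc : c ≠ 0)
    (hT : ∀ (E : g) (s : k), ev ι (E : Derivation k (A k p ι) (A k p ι)) = s • u →
      ev ι (T E : Derivation k (A k p ι) (A k p ι)) = (c * s) • u) : ¬ IsNilpotent T := by
  rintro ⟨N, hN⟩
  obtain ⟨D, hD, hDu⟩ := hev u
  have h : ∀ n : ℕ, ev ι (((T ^ n) ⟨D, hD⟩ : g) : Derivation k (A k p ι) (A k p ι)) = c ^ n • u := by
    intro n
    induction n with
    | zero => simpa using hDu
    | succ n ih =>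
      rw [pow_succ', Module.End.mul_apply, hT _ _ ih, pow_succ']
  have h1 := h N
  rw [hN, LinearMap.zero_apply, ZeroMemClass.coe_zero, map_zero] at h1
  exact smul_ne_zero (pow_ne_zero N hc) hu h1.symm

theorem isNilpotent_of_fil {T : Module.End k g}
    (hT : ∀ (s : ℕ) (E : g), (E : Derivation k (A k p ι) (A k p ι)) ∈ fil k p ι s →
      (T E : Derivation k (A k p ι) (A k p ι)) ∈ fil k p ι (s + 1)) : IsNilpotent T := by
  obtain ⟨N, hN⟩ := exists_fil_eq_bot (k := k) (p := p) (ι := ι)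
  refine ⟨N, LinearMap.ext fun E => ?_⟩
  have h : ∀ n : ℕ, ((T ^ n) E : Derivation k (A k p ι) (A k p ι)) ∈ fil k p ι n := by
    intro n
    induction n with
    | zero => exact mem_fil_zero _
    | succ n ih =>
      rw [pow_succ', Module.End.mul_apply]
      exact hT _ _ ih
  have h1 := h N
  rw [hN, Submodule.mem_bot] at h1
  exact Subtype.ext h1

/-- The elements `x` for which all products `ad x ∘ ad y` are nilpotent. -/
def adNil (L : Type*) [LieRing L] [LieAlgebra k L] : Set L :=
  {x | ∀ y : L, IsNilpotent (LieAlgebra.ad k L x * LieAlgebra.ad k L y)}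

/-- Bracketing with `x` raises the filtration by two, bracketing with `y` lowers it by at most one,
so each application of the product gains at least one step. -/
theorem mem_adNil_of_mem_fil {x : g}
    (hx : (x : Derivation k (A k p ι) (A k p ι)) ∈ fil k p ι 3) : x ∈ adNil (k := k) g := by
  intro y
  refine isNilpotent_of_fil fun s E hE => ?_
  have h := lie_mem_fil hx (lie_mem_fil (mem_fil_zero (y : Derivation k _ _)) hE)
  exact fil_anti (by omega) h

theorem lie_eval (D E : Derivation k (A k p ι) (A k p ι)) (f : A k p ι) :
    ⁅D, E⁆ f = D (E f) - E (D f) := Derivation.commutator_apply f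

/-- After expanding the brackets, `m` still vanishes to positive order in every term except the one
where both copies of `x` and the field `E` all differentiate the coefficients of `m`. -/
theorem aug_lie_lie_lie {x m : Derivation k (A k p ι) (A k p ι)} (hm : m ∈ fil k p ι 3)
    (E : Derivation k (A k p ι) (A k p ι)) (f : A k p ι) :
    aug k p ι (⁅x, ⁅⁅x, m⁆, E⁆⁆ f) = -aug k p ι (x (x (E (m f)))) := by
  have hy : ⁅x, m⁆ ∈ fil k p ι 2 := fil_anti (by norm_num) (lie_mem_fil (mem_fil_zero x) hm)
  have hF : ⁅⁅x, m⁆, E⁆ ∈ fil k p ι 1 := fil_anti (by norm_num) (lie_mem_fil hy (mem_fil_zero E))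
  have h1 : aug k p ι (⁅⁅x, m⁆, E⁆ (x f)) = 0 := by
    have := mem_fil.1 hF (x f)
    rwa [pow_one, mem_maxI] at this
  have h2 : aug k p ι (x (⁅x, m⁆ (E f))) = 0 :=
    aug_der_eq_zero (mem_fil_zero x) (mem_fil.1 hy (E f)) (by norm_num)
  have h3 : aug k p ι (x (E (m (x f)))) = 0 :=
    aug_der_eq_zero (mem_fil_zero x) (der_pow_mem (mem_fil_zero E) (mem_fil.1 hm (x f))) (by norm_num)
  rw [lie_eval x, map_sub, h1, sub_zero, lie_eval _ E, map_sub,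
    map_sub, h2, zero_sub, lie_eval x m, map_sub, map_sub, map_sub, h3, sub_zero,
    aug_der_swap x E x (mem_fil.1 hm f)]

/-- Both fields vanish at the origin, so only `E (y (x f))` survives, and it sees just the linear
parts of `x` and `y`. -/
theorem aug_lie_lie_linear {x y : Derivation k (A k p ι) (A k p ι)} (hx : x ∈ fil k p ι 1)
    (hy : y ∈ fil k p ι 1) (E : Derivation k (A k p ι) (A k p ι)) (f : A k p ι) :
    aug k p ι (⁅x, ⁅y, E⁆⁆ f) =
      ∑ j, aug k p ι (pd k p j (x f)) * aug k p ι (E (y (CartanType.x k p j))) := by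
  have h0 : ∀ (z : Derivation k (A k p ι) (A k p ι)), z ∈ fil k p ι 1 → ∀ f, aug k p ι (z f) = 0 :=
    fun z hz f => by have := hz f; rwa [pow_one, mem_maxI] at this
  rw [Derivation.commutator_apply, map_sub, h0 x hx, zero_sub, Derivation.commutator_apply,
    map_sub, h0 y hy, zero_sub, neg_neg, der_eq_sum k p y (x f), map_sum, map_sum]
  refine Finset.sum_congr rfl fun j _ => ?_
  rw [Derivation.leibniz, map_add, smul_eq_mul, smul_eq_mul, map_mul, map_mul, h0 y hy]
  ring

/-- As in `aug_lie_lie_lie`: only the term in which all three derivations fall on the coefficients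
of `m` survives at the origin. -/
theorem aug_lie_sq_lie {y m : Derivation k (A k p ι) (A k p ι)} (hm : m ∈ fil k p ι 3)
    (E : Derivation k (A k p ι) (A k p ι)) (f : A k p ι) :
    aug k p ι (⁅y, ⁅y, ⁅m, E⁆⁆⁆ f) = -aug k p ι (y (y (E (m f)))) := by
  have hF : ⁅m, E⁆ ∈ fil k p ι 2 := fil_anti (by norm_num) (lie_mem_fil hm (mem_fil_zero E))
  have hF' : ⁅y, ⁅m, E⁆⁆ ∈ fil k p ι 1 := fil_anti (by norm_num) (lie_mem_fil (mem_fil_zero y) hF)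
  have h1 : aug k p ι (⁅y, ⁅m, E⁆⁆ (y f)) = 0 := by
    have := mem_fil.1 hF' (y f)
    rwa [pow_one, mem_maxI] at this
  have h2 : aug k p ι (y (⁅m, E⁆ (y f))) = 0 :=
    aug_der_eq_zero (mem_fil_zero y) (mem_fil.1 hF (y f)) (by norm_num)
  have h3 : aug k p ι (y (y (m (E f)))) = 0 :=
    aug_der_eq_zero (mem_fil_zero y) (der_pow_mem (mem_fil_zero y) (mem_fil.1 hm (E f))) (by norm_num)
  rw [lie_eval y, map_sub, h1, sub_zero, lie_eval y, map_sub,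
    map_sub, h2, sub_zero, lie_eval m E, map_sub, map_sub, map_sub, h3, zero_sub]

/-- A nonzero value or a nonzero linear part of `x` gives a `y` for which `ad x ∘ ad y` has a
nonzero eigenvalue on values at the origin: `y = [x, m]` with `m` cubic in the first case, a linear
`y` in the second. With `mem_adNil_of_mem_fil` this traps `adNil` between `fil 3` and `fil 2`, which
is precise enough for what follows. -/
theorem mem_fil_two_of_mem_adNil (hg : IsAmple g) {x : g} (hx : x ∈ adNil (k := k) g) :
    (x : Derivation k (A k p ι) (A k p ι)) ∈ fil k p ι 2 := by
  obtain ⟨x, hxg⟩ := x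
  have h1 : x ∈ fil k p ι 1 := by
    by_contra h
    rw [mem_fil_one] at h
    obtain ⟨m, hm, hm3, u, c, hu, hc, H⟩ := hg.exists_cubic _ h
    refine not_isNilpotent_of_eigenvector hg.exists_ev hu (neg_ne_zero.2 hc) ?_
      (hx ⁅(⟨x, hxg⟩ : g), ⟨m, hm⟩⁆)
    rintro ⟨E, hEg⟩ s hE
    ext i
    refine (aug_lie_lie_lie hm3 E _).trans ?_
    rw [H x x E s rfl rfl hE]
    simp
  by_contra h2
  have h3 : ∃ i j, aug k p ι (pd k p j (x (CartanType.x k p i))) ≠ 0 := by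
    by_contra! h
    refine h2 (mem_fil_iff.2 fun i => mem_maxI_sq ?_ (h i))
    exact congrFun (mem_fil_one.1 h1) i
  obtain ⟨i, j, hij⟩ := h3
  -- A nonzero column of the linear part of `x`; `y` is chosen so that `ad x ∘ ad y` fixes this
  -- direction.
  set u : ι → k := fun i => aug k p ι (pd k p j (x (CartanType.x k p i))) with hu
  have hu0 : u ≠ 0 := fun h => hij (congrFun h i)
  obtain ⟨y, hy, hy1, H⟩ := hg.exists_linear u j hu0
  refine not_isNilpotent_of_eigenvector hg.exists_ev hu0 one_ne_zero ?_ (hx ⟨y, hy⟩)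
  rintro ⟨E, hEg⟩ s hE
  ext i
  refine (aug_lie_lie_linear h1 hy1 E _).trans ?_
  simp only [H E s hE]
  simp [hu, mul_comm]

/-- An intrinsic description of vanishing at the origin. If `y` vanishes there, `ad y` does not
lower the filtration while `ad m` raises it, since `m ∈ fil 2`. If not, a cubic `m`, which lies in
`adNil`, gives a nonzero eigenvalue. -/
theorem mem_fil_one_iff (hg : IsAmple g) (y : g) :
    (y : Derivation k (A k p ι) (A k p ι)) ∈ fil k p ι 1 ↔ ∀ m ∈ adNil (k := k) g,
      IsNilpotent (LieAlgebra.ad k g y * LieAlgebra.ad k g y * LieAlgebra.ad k g m) := by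
  constructor
  · intro hy m hm
    refine isNilpotent_of_fil fun s E hE => ?_
    have h := lie_mem_fil hy (lie_mem_fil hy (lie_mem_fil (mem_fil_two_of_mem_adNil hg hm) hE))
    exact fil_anti (by omega) h
  · intro H
    by_contra h
    rw [mem_fil_one] at h
    obtain ⟨m, hm, hm3, u, c, hu, hc, H'⟩ := hg.exists_cubic _ h
    refine not_isNilpotent_of_eigenvector hg.exists_ev hu (neg_ne_zero.2 hc) ?_
      (H ⟨m, hm⟩ (mem_adNil_of_mem_fil hm3))
    rintro ⟨E, hEg⟩ s hE
    ext i
    refine (aug_lie_sq_lie hm3 E _).trans ?_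
    rw [H' y y E s rfl rfl hE]
    simp

variable {φ : g ≃ₗ[k] g}

theorem conj_ad (hφ : ∀ x y : g, φ ⁅x, y⁆ = ⁅φ x, φ y⁆) (x : g) :
    φ.conjRingEquiv (LieAlgebra.ad k g x) = LieAlgebra.ad k g (φ x) := by
  ext1 z
  change φ ⁅x, φ.symm z⁆ = ⁅φ x, z⁆
  rw [hφ, LinearEquiv.apply_symm_apply]

theorem adNil_map_iff (hφ : ∀ x y : g, φ ⁅x, y⁆ = ⁅φ x, φ y⁆) (x : g) :
    φ x ∈ adNil (k := k) g ↔ x ∈ adNil (k := k) g := by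
  change (∀ y, _) ↔ ∀ y, _
  rw [φ.surjective.forall]
  refine forall_congr' fun y => ?_
  rw [← conj_ad hφ, ← conj_ad hφ, ← map_mul]
  exact IsNilpotent.map_iff φ.conjRingEquiv.injective

/-- Automorphisms of `g` preserve the property of vanishing at the origin. -/
theorem ev_map_eq_zero_iff (hg : IsAmple g) (hφ : ∀ x y : g, φ ⁅x, y⁆ = ⁅φ x, φ y⁆) (y : g) :
    ev ι (φ y : Derivation k (A k p ι) (A k p ι)) = 0 ↔
      ev ι (y : Derivation k (A k p ι) (A k p ι)) = 0 := by
  rw [← mem_fil_one, ← mem_fil_one, mem_fil_one_iff hg, mem_fil_one_iff hg,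
    φ.surjective.forall]
  refine forall_congr' fun m => ?_
  rw [adNil_map_iff hφ, ← conj_ad hφ, ← conj_ad hφ, ← map_mul, ← map_mul]
  exact imp_congr_right fun _ => IsNilpotent.map_iff φ.conjRingEquiv.injective

end Invariance

end CartanType

end

open scoped Pointwise

set_option linter.unusedSectionVars false

noncomputable section

namespace CartanType

/-! Diagonal derivations with respect to the coordinates `z_i`, and their weights on `A`. -/

section Toral

variable {k : Type*} [Field k] {p : ℕ} [hp : Fact p.Prime] [CharP k p] {ι : Type*} [Fintype ι]
  [DecidableEq ι] (R : Finset ι)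

attribute [local instance] ZMod.algebra

variable (k p) in
/-- The coordinate `z_i`, equal to `1 + x_i` if `i ∈ R` and to `x_i` otherwise. -/
def z (i : ι) : A k p ι := if i ∈ R then 1 + x k p i else x k p i

variable {R} in
theorem z_of_mem {i : ι} (h : i ∈ R) : z k p R i = 1 + x k p i := if_pos h

variable {R} in
theorem z_of_notMem {i : ι} (h : i ∉ R) : z k p R i = x k p i := if_neg h

theorem x_eq (i : ι) : x k p i = z k p R i - if i ∈ R then 1 else 0 := by
  unfold z; split_ifs <;> simp

theorem der_z (D : Derivation k (A k p ι) (A k p ι)) (i : ι) :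
    D (z k p R i) = D (x k p i) := by
  unfold z; split_ifs <;> simp

theorem aug_z (i : ι) : aug k p ι (z k p R i) = if i ∈ R then 1 else 0 := by
  unfold z; split_ifs <;> simp

/-- The derivation with `x_i ↦ y_i`. -/
def derOf (y : ι → A k p ι) : Derivation k (A k p ι) (A k p ι) := ∑ i, y i • pd k p i

theorem der_sum_apply {κ : Type*} (s : Finset κ) (F : κ → Derivation k (A k p ι) (A k p ι))
    (f : A k p ι) : (∑ i ∈ s, F i) f = ∑ i ∈ s, F i f := by
  rw [← Derivation.coeFnAddMonoidHom_apply, map_sum, Finset.sum_apply]; rfl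

@[simp] theorem derOf_x (y : ι → A k p ι) (i : ι) : derOf y (x k p i) = y i := by
  simp [derOf, der_sum_apply, pd_x]

theorem derOf_apply (y : ι → A k p ι) (f : A k p ι) : derOf y f = ∑ i, y i * pd k p i f := by
  rw [der_eq_sum]; simp

variable (p) in
/-- The diagonal derivation `∑ a_i z_i ∂_i`. -/
def diag (a : ι → k) : Derivation k (A k p ι) (A k p ι) := derOf fun i => a i • z k p R i

@[simp] theorem diag_x (a : ι → k) (i : ι) : diag p R a (x k p i) = a i • z k p R i := derOf_x _ _

@[simp] theorem diag_z (a : ι → k) (i : ι) : diag p R a (z k p R i) = a i • z k p R i := by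
  rw [der_z, diag_x]

theorem euler_x {s : Prop} [Decidable s] (i j : ι) :
    euler k p s i (x k p j) = if j = i then (if s then 1 + x k p i else x k p i) else 0 := by
  rw [euler, Derivation.smul_apply, pd_x]
  split_ifs <;> simp

/-- The field `∂_i` has weight `-a_i`, so a field of weight `v` has `i`-th coefficient of weight `v
+ a_i`. -/
theorem lie_diag_iff (a : ι → k) (v : k) (D : Derivation k (A k p ι) (A k p ι)) :
    ⁅diag p R a, D⁆ = v • D ↔
      ∀ i, diag p R a (D (x k p i)) = (v + a i) • D (x k p i) := by
  constructor
  · intro h i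
    have h1 := DFunLike.congr_fun h (x k p i)
    rw [lie_eval, diag_x, Derivation.map_smul, der_z, Derivation.smul_apply, sub_eq_iff_eq_add] at h1
    rw [h1, add_smul]
  · intro h
    apply der_ext
    intro i
    rw [lie_eval, h i, diag_x, Derivation.map_smul, der_z, Derivation.smul_apply, add_smul,
      add_sub_cancel_right]

/-- The shifted coordinates are units of exponent `p`; hence exponents of monomials in them can be
taken in `ZMod p`. -/
theorem z_pow {i : ι} (h : i ∈ R) : z k p R i ^ p = 1 := by
  rw [z_of_mem h, one_add_x_pow]

variable (k) in
/-- The monomial `∏ z_i ^ α_i` in the invertible coordinates. -/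
def mon (α : ι → ZMod p) : A k p ι := ∏ i ∈ R, z k p R i ^ (α i).val

theorem mon_add (α β : ι → ZMod p) : mon k R (α + β) = mon k R α * mon k R β := by
  unfold mon
  rw [← Finset.prod_mul_distrib]
  refine Finset.prod_congr rfl fun i hi => ?_
  rw [Pi.add_apply, ZMod.val_add, ← pow_eq_pow_mod _ (z_pow R hi), pow_add]

theorem mon_zero : mon k R (0 : ι → ZMod p) = 1 := by simp [mon]

theorem mon_congr {α β : ι → ZMod p} (h : ∀ i ∈ R, α i = β i) : mon k R α = mon k R β :=
  Finset.prod_congr rfl fun i hi => by rw [h i hi]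

theorem mon_smul (c : ZMod p) (α : ι → ZMod p) : mon k R (c • α) = mon k R α ^ c.val := by
  unfold mon
  rw [← Finset.prod_pow]
  refine Finset.prod_congr rfl fun i hi => ?_
  rw [Pi.smul_apply, smul_eq_mul, ZMod.val_mul, ← pow_eq_pow_mod _ (z_pow R hi), mul_comm, pow_mul]

theorem mon_sum {κ : Type*} (s : Finset κ) (F : κ → ι → ZMod p) :
    mon k R (∑ i ∈ s, F i) = ∏ i ∈ s, mon k R (F i) := by
  classical
  induction s using Finset.induction_on with
  | empty => simp [mon_zero]
  | insert a s ha ih => rw [Finset.sum_insert ha, Finset.prod_insert ha, mon_add, ih]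

theorem mon_single {i : ι} (hi : i ∈ R) : mon k R (Pi.single i (1 : ZMod p)) = z k p R i := by
  have : Fact (1 < p) := ⟨hp.out.one_lt⟩
  unfold mon
  rw [Finset.prod_eq_single_of_mem i hi]
  · simp [ZMod.val_one]
  · intro j _ hj; simp [hj]

theorem mon_pow (α : ι → ZMod p) : mon k R α ^ p = 1 := by
  unfold mon
  rw [← Finset.prod_pow]
  exact Finset.prod_eq_one fun i hi => by rw [← pow_mul, mul_comm, pow_mul, z_pow R hi, one_pow]

theorem mon_mul_neg (α : ι → ZMod p) : mon k R α * mon k R (-α) = 1 := by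
  rw [← mon_add, add_neg_cancel, mon_zero]

theorem aug_mon (α : ι → ZMod p) : aug k p ι (mon k R α) = 1 := by
  unfold mon
  rw [map_prod]
  exact Finset.prod_eq_one fun i hi => by simp [aug_z, hi]

theorem natCast_val_mul (c : ZMod p) (y : k) : (c.val : k) * y = c • y := by
  rw [Algebra.smul_def]
  congr 1
  conv_rhs => rw [← ZMod.natCast_zmod_val c]
  rw [map_natCast]

/-- The weight of the monomial `z ^ α`. -/
def wt (a : ι → k) : (ι → ZMod p) →ₗ[ZMod p] k where
  toFun α := ∑ i ∈ R, α i • a i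
  map_add' α β := by simp [add_smul, Finset.sum_add_distrib]
  map_smul' c α := by simp [mul_smul, Finset.smul_sum]

theorem wt_apply (a : ι → k) (α : ι → ZMod p) : wt R a α = ∑ i ∈ R, α i • a i := rfl

theorem wt_single (a : ι → k) {i : ι} (hi : i ∈ R) : wt R a (Pi.single i (1 : ZMod p)) = a i := by
  rw [wt_apply, Finset.sum_eq_single_of_mem i hi]
  · simp
  · intro j _ hj; simp [hj]

/-- Logarithmic differentiation. Arbitrary `D` is allowed so that the result also covers partial
derivatives and Hamiltonian fields. -/
theorem der_mon {D : Derivation k (A k p ι) (A k p ι)} {a : ι → k}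
    (h : ∀ i ∈ R, D (z k p R i) = a i • z k p R i) (α : ι → ZMod p) :
    D (mon k R α) = wt R a α • mon k R α := by
  have key : ∀ s ⊆ R, D (∏ i ∈ s, z k p R i ^ (α i).val) =
      (∑ i ∈ s, α i • a i) • ∏ i ∈ s, z k p R i ^ (α i).val := by
    intro s
    induction s using Finset.induction_on with
    | empty => simp
    | insert i s his ih =>
      intro hs
      have hi : i ∈ R := hs (Finset.mem_insert_self _ _)
      rw [Finset.prod_insert his, Finset.sum_insert his, Derivation.leibniz,
        ih fun j hj => hs (Finset.mem_insert_of_mem hj)]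
      have h1 : D (z k p R i ^ (α i).val) = (α i • a i) • z k p R i ^ (α i).val := by
        rw [Derivation.leibniz_pow, h i hi, ← natCast_val_mul]
        -- Exponent zero is separate because the power rule uses the truncated exponent `n - 1`.
        rcases Nat.eq_zero_or_pos (α i).val with h0 | h0
        · simp [h0]
        · rw [smul_eq_mul, mul_smul_comm, ← pow_succ, Nat.sub_add_cancel h0, mul_smul,
            Nat.cast_smul_eq_nsmul]
      rw [h1, smul_eq_mul, smul_eq_mul, mul_smul_comm, mul_smul_comm, add_smul, add_comm]
      congr 2
      rw [mul_comm]
  exact key R subset_rfl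

theorem diag_mon (a : ι → k) (α : ι → ZMod p) :
    diag p R a (mon k R α) = wt R a α • mon k R α :=
  der_mon R (fun i _ => diag_z R a i) α

variable (k p) in
/-- The ideal generated by the coordinates vanishing at the origin. -/
def idealJ : Ideal (A k p ι) := Ideal.span (x k p '' {j | j ∉ R})

variable {R} in
theorem x_mem_idealJ {j : ι} (h : j ∉ R) : x k p j ∈ idealJ k p R := Ideal.subset_span ⟨j, h, rfl⟩

theorem aug_of_mem_idealJ {f : A k p ι} (hf : f ∈ idealJ k p R) : aug k p ι f = 0 := by
  have h : idealJ k p R ≤ maxI k p ι := by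
    rw [idealJ, Ideal.span_le]
    rintro _ ⟨j, _, rfl⟩
    exact x_mem_maxI j
  exact mem_maxI.1 (h hf)

theorem der_mem_idealJ {D : Derivation k (A k p ι) (A k p ι)}
    (h : ∀ j ∉ R, D (x k p j) ∈ idealJ k p R) {f : A k p ι} (hf : f ∈ idealJ k p R) :
    D f ∈ idealJ k p R := by
  induction hf using Submodule.span_induction with
  | mem f hf => obtain ⟨j, hj, rfl⟩ := hf; exact h j hj
  | zero => simp
  | add f g _ _ hf hg => rw [map_add]; exact add_mem hf hg
  | smul a f hf h' =>
    rw [smul_eq_mul, Derivation.leibniz, smul_eq_mul, smul_eq_mul]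
    exact add_mem (Ideal.mul_mem_left _ _ h') (Ideal.mul_mem_right _ _ hf)

theorem diag_mem_idealJ (a : ι → k) {f : A k p ι} (hf : f ∈ idealJ k p R) :
    diag p R a f ∈ idealJ k p R :=
  der_mem_idealJ R (fun j hj => by
    rw [diag_x, z_of_notMem hj, Algebra.smul_def]
    exact Ideal.mul_mem_left _ _ (x_mem_idealJ hj)) hf

/-- Modulo `idealJ` only the units `z_i` remain, so the quotient is spanned by their monomials and
carries only the weights in the range of `wt`. -/
theorem span_mon_sup_idealJ :
    Submodule.span k (Set.range (mon k R : (ι → ZMod p) → A k p ι)) ⊔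
      (idealJ k p R).restrictScalars k = ⊤ := by
  rw [eq_top_iff]
  rintro f -
  induction f using A_induction with
  | one =>
    rw [← mon_zero (k := k) (p := p) R]
    exact Submodule.mem_sup_left (Submodule.subset_span ⟨0, rfl⟩)
  | add f g hf hg => exact add_mem hf hg
  | smul c f hf => exact Submodule.smul_mem _ _ hf
  | mul f i hf =>
    by_cases hi : i ∈ R
    · rw [x_eq R i, if_pos hi, mul_sub, mul_one]
      refine sub_mem ?_ hf
      obtain ⟨g, hg, h, hh, rfl⟩ := Submodule.mem_sup.1 hf
      rw [add_mul]
      refine Submodule.add_mem_sup ?_ (Ideal.mul_mem_right _ _ hh)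
      rw [← mon_single R hi]
      clear hf
      induction hg using Submodule.span_induction with
      | mem f hf =>
        obtain ⟨α, rfl⟩ := hf
        rw [← mon_add]; exact Submodule.subset_span ⟨_, rfl⟩
      | zero => simp
      | add f g _ _ hf hg =>
        rw [add_mul]
        exact add_mem hf hg
      | smul c f _ hf =>
        rw [smul_mul_assoc]
        exact Submodule.smul_mem _ _ hf
    · exact Submodule.mem_sup_right (Ideal.mul_mem_left _ _ (x_mem_idealJ hi))

theorem aeval_apply_of_eq_smul {V : Type*} [AddCommGroup V] [Module k V] {T : Module.End k V}
    {v : V} {w : k} (h : T v = w • v) (P : Polynomial k) :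
    Polynomial.aeval T P v = P.eval w • v := by
  induction P using Polynomial.induction_on' with
  | add P Q hP hQ => simp [hP, hQ, add_smul]
  | monomial n c =>
    have : ∀ n : ℕ, (T ^ n) v = w ^ n • v := by
      intro n
      induction n with
      | zero => simp
      | succ n ih => rw [pow_succ, Module.End.mul_apply, h, map_smul, ih, smul_smul, pow_succ']
    simp [Polynomial.aeval_monomial, this, mul_smul, smul_comm c]

theorem aeval_mem_of_forall {V : Type*} [AddCommGroup V] [Module k V] {T : Module.End k V}
    {N : Submodule k V} (h : ∀ v ∈ N, T v ∈ N) (P : Polynomial k) {v : V} (hv : v ∈ N) :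
    Polynomial.aeval T P v ∈ N := by
  induction P using Polynomial.induction_on' with
  | add P Q hP hQ => rw [map_add]; exact add_mem hP hQ
  | monomial n c =>
    have : ∀ n : ℕ, (T ^ n) v ∈ N := by
      intro n
      induction n with
      | zero => simpa
      | succ n ih => rw [pow_succ', Module.End.mul_apply]; exact h _ ih
    rw [Polynomial.aeval_monomial, Module.End.mul_apply]
    exact Submodule.smul_mem _ _ (this n)

/-- The polynomial vanishing at the elements of a finite set of weights. -/
theorem exists_poly (a : ι → k) (W : Set k) (hW : W ⊆ Set.range (wt (p := p) R a)) :
    ∃ P : Polynomial k, ∀ w, P.eval w = 0 ↔ w ∈ W := by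
  have hfin : W.Finite := (Set.finite_range _).subset hW
  refine ⟨∏ u ∈ hfin.toFinset, (Polynomial.X - Polynomial.C u), fun w => ?_⟩
  rw [Polynomial.eval_prod, Finset.prod_eq_zero_iff]
  simp [sub_eq_zero]

theorem aeval_diag_mem (a : ι → k) {N : Submodule k (A k p ι)}
    (hN : (idealJ k p R).restrictScalars k ≤ N) {P : Polynomial k}
    (h : ∀ α : ι → ZMod p, P.eval (wt R a α) • mon k R α ∈ N) (f : A k p ι) :
    Polynomial.aeval (diag p R a : A k p ι →ₗ[k] A k p ι) P f ∈ N := by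
  have hf : f ∈ Submodule.span k (Set.range (mon k R : (ι → ZMod p) → A k p ι)) ⊔
      (idealJ k p R).restrictScalars k := by rw [span_mon_sup_idealJ]; trivial
  obtain ⟨g, hg, j, hj, rfl⟩ := Submodule.mem_sup.1 hf
  rw [map_add]
  refine add_mem ?_ (hN (aeval_mem_of_forall (fun v hv => diag_mem_idealJ R a hv) P hj))
  clear hf hj
  induction hg using Submodule.span_induction with
  | mem f hf =>
    obtain ⟨α, rfl⟩ := hf
    rw [aeval_apply_of_eq_smul (diag_mon R a α)]
    exact h α
  | zero => simp
  | add f g _ _ hf hg => rw [map_add]; exact add_mem hf hg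
  | smul c f _ hf => rw [map_smul]; exact Submodule.smul_mem _ _ hf

/-- A polynomial in `diag` vanishing at all monomial weights maps `A` into `idealJ`, yet multiplies
`f` by a nonzero scalar. -/
theorem mem_idealJ_of_weight_notMem {a : ι → k} {w : k} (hw : w ∉ Set.range (wt (p := p) R a))
    {f : A k p ι} (hf : diag p R a f = w • f) : f ∈ idealJ k p R := by
  obtain ⟨P, hP⟩ := exists_poly (p := p) R a _ subset_rfl
  have h : Polynomial.aeval (diag p R a : A k p ι →ₗ[k] A k p ι) P f ∈
      (idealJ k p R).restrictScalars k := aeval_diag_mem R a le_rfl (fun α => by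
    rw [(hP _).2 ⟨α, rfl⟩, zero_smul]; exact zero_mem _) f
  rw [aeval_apply_of_eq_smul hf] at h
  exact (Submodule.smul_mem_iff _ (fun h0 => hw ((hP w).1 h0))).1 h

theorem weight_mem_of_aug_ne_zero {a : ι → k} {w : k} {f : A k p ι}
    (hf : diag p R a f = w • f) (h : aug k p ι f ≠ 0) : w ∈ Set.range (wt (p := p) R a) := by
  by_contra hw
  exact h (aug_of_mem_idealJ R (mem_idealJ_of_weight_notMem R hw hf))

variable (p) in
/-- Linear independence over the prime field of the coefficients with index in `R`. -/
def Indep (a : ι → k) : Prop := ∀ α : ι → ZMod p, wt R a α = 0 → ∀ i ∈ R, α i = 0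

variable {R} in
-- Dividing by a monomial reduces to weight zero. Independence leaves only the constants as
-- monomials of weight zero, and the constant part is killed by the condition at the origin.
theorem Indep.mem_idealJ {a : ι → k} (ha : Indep p R a) {w : k} {f : A k p ι}
    (hf : diag p R a f = w • f) (h0 : aug k p ι f = 0) : f ∈ idealJ k p R := by
  by_cases hw : w ∈ Set.range (wt (p := p) R a)
  swap
  · exact mem_idealJ_of_weight_notMem R hw hf
  obtain ⟨β, rfl⟩ := hw
  suffices h : f * mon k R (-β) ∈ idealJ k p R by
    have h1 := Ideal.mul_mem_right (mon k R β) _ h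
    rwa [mul_assoc, ← mon_add, neg_add_cancel, mon_zero, mul_one] at h1
  -- Zero is omitted from the roots: this polynomial sends `A` into constants plus `idealJ` while
  -- acting invertibly on weight zero.
  obtain ⟨P, hP⟩ := exists_poly (p := p) R a (Set.range (wt (p := p) R a) \ {0}) Set.sdiff_subset
  have hd : diag p R a (f * mon k R (-β)) = (0 : k) • (f * mon k R (-β)) := by
    rw [Derivation.leibniz, hf, diag_mon, map_neg, smul_eq_mul, smul_eq_mul, neg_smul,
      mul_neg, mul_smul_comm, mul_smul_comm, mul_comm, neg_add_cancel, zero_smul]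
  have h1 := aeval_diag_mem R a (P := P)
    (N := Submodule.span k {1} ⊔ (idealJ k p R).restrictScalars k) le_sup_right (fun α => by
      by_cases h : wt R a α = 0
      · rw [mon_congr R (ha α h), ← Pi.zero_def, mon_zero]
        exact Submodule.smul_mem _ _ (Submodule.mem_sup_left (Submodule.subset_span rfl))
      · rw [(hP _).2 ⟨⟨α, rfl⟩, h⟩, zero_smul]; exact zero_mem _) (f * mon k R (-β))
  rw [aeval_apply_of_eq_smul hd, Submodule.smul_mem_iff _ (fun h => ((hP 0).1 h).2 rfl)] at h1
  obtain ⟨c, hc, j, hj, hcj⟩ := Submodule.mem_sup.1 h1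
  obtain ⟨c, rfl⟩ := Submodule.mem_span_singleton.1 hc
  have h2 := congrArg (aug k p ι) hcj
  rw [map_add, aug_of_mem_idealJ R hj, map_mul, h0, zero_mul, map_smul, map_one, add_zero,
    smul_eq_mul, mul_one] at h2
  rw [← hcj, h2, zero_smul, zero_add]
  exact hj

/-! The weights of units and the number of coordinates in each class of weights, recovered from
the action of a diagonal derivation on a Lie algebra of derivations. -/

variable {R} in
-- For `v` in the span a suitable `D` preserves `idealJ`, and by independence weight vectors
-- vanishing at the origin have coefficients in `idealJ`; so their brackets with `D` vanish there.
-- Conversely, if `D` has a nonzero component along an unshifted `j`, bracketing with `x_j ∂_l`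
-- gives a nonzero value. Thus the nonzero component lies along some `j ∈ R`, whence `v + a_j`, and
-- so `v`, is in the span.
theorem mem_range_wt_iff {g : LieSubalgebra k (Derivation k (A k p ι) (A k p ι))} {a : ι → k}
    (ha : Indep p R a) (hR : R.Nonempty)
    (h1 : ∀ j ∉ R, ∃ l ≠ j, derOf (fun i => if i = l then x k p j else 0) ∈ g)
    (h2 : ∀ i ∈ R, ∀ α : ι → ZMod p, ∃ D ∈ g, ⁅diag p R a, D⁆ = wt R a α • D ∧
      aug k p ι (D (x k p i)) ≠ 0 ∧ ∀ j ∉ R, D (x k p j) ∈ idealJ k p R) (v : k) :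
    v ∈ Set.range (wt (p := p) R a) ↔ ∃ D ∈ g, ⁅diag p R a, D⁆ = v • D ∧ ev ι D ≠ 0 ∧
      ∀ E ∈ g, ∀ w : k, ⁅diag p R a, E⁆ = w • E → ev ι E = 0 → ev ι ⁅D, E⁆ = 0 := by
  constructor
  · rintro ⟨α, rfl⟩
    obtain ⟨i, hi⟩ := hR
    obtain ⟨D, hD, hdD, h0, hJ⟩ := h2 i hi α
    refine ⟨D, hD, hdD, fun h => h0 (congrFun h i), fun E hE w hw hE0 => ?_⟩
    ext j
    rw [ev_apply, lie_eval, map_sub, aug_of_mem_idealJ R (der_mem_idealJ R hJ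
      (ha.mem_idealJ ((lie_diag_iff R a w E).1 hw j) (congrFun hE0 j))), zero_sub]
    have h3 := mem_fil.1 (mem_fil_one.2 hE0) (D (x k p j))
    rw [pow_one, mem_maxI] at h3
    rw [h3]; simp
  · rintro ⟨D, hD, hdD, hD0, hDE⟩
    rw [lie_diag_iff] at hdD
    obtain ⟨j, hj⟩ := Function.ne_iff.1 hD0
    by_cases hjR : j ∈ R
    · obtain ⟨β, hβ⟩ := weight_mem_of_aug_ne_zero R (hdD j) hj
      refine ⟨β - Pi.single j 1, ?_⟩
      rw [map_sub, hβ, wt_single R a hjR, add_sub_cancel_right]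
    · obtain ⟨l, hlj, hE⟩ := h1 j hjR
      refine absurd (congrFun (hDE _ hE (a j - a l) ?_ ?_) l) ?_
      · rw [lie_diag_iff]
        intro i
        rw [derOf_x]
        split_ifs with h
        · subst h; rw [diag_x, z_of_notMem hjR, sub_add_cancel]
        · simp
      · ext i
        rw [ev_apply, derOf_x]
        split_ifs <;> simp
      · rw [ev_apply, lie_eval, derOf_x, if_pos rfl, map_sub, derOf_apply, map_sum]
        rw [Finset.sum_eq_zero, sub_zero]
        · exact hj
        · intro i _
          split_ifs <;> simp

/-- The weight space of weight `v` in `g`. -/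
def weightSpace (g : LieSubalgebra k (Derivation k (A k p ι) (A k p ι))) (d : g) (v : k) :
    Submodule k g where
  carrier := {D | ⁅d, D⁆ = v • D}
  zero_mem' := by simp
  add_mem' := by
    intro D E hD hE
    change ⁅d, D⁆ = _ at hD
    change ⁅d, E⁆ = _ at hE
    change ⁅d, D + E⁆ = _
    rw [lie_add, hD, hE, smul_add]
  smul_mem' := by
    intro c D hD
    change ⁅d, D⁆ = _ at hD
    change ⁅d, c • D⁆ = _
    rw [lie_smul, hD, smul_comm]

/-- The value at the origin, as a linear map on `g`. -/
def evOn (g : LieSubalgebra k (Derivation k (A k p ι) (A k p ι))) : g →ₗ[k] (ι → k) :=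
  (ev ι).comp g.toSubmodule.subtype

variable {R} in
-- The `j`-th coefficient of a weight vector is nonzero at the origin only if `v + a_j` is a
-- monomial weight. Since `v` is not one, this excludes `j ∈ R`; `h3` realizes every remaining
-- coordinate direction.
theorem finrank_map_weightSpace {g : LieSubalgebra k (Derivation k (A k p ι) (A k p ι))} {a : ι → k}
    (d : g) (hd : (d : Derivation k (A k p ι) (A k p ι)) = diag p R a) (v : k)
    (hv : v ∉ Set.range (wt (p := p) R a))
    (h3 : ∀ j ∉ R, v + a j ∈ Set.range (wt (p := p) R a) →
      ∃ D ∈ g, ⁅diag p R a, D⁆ = v • D ∧ ev ι D = Pi.single j 1) :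
    Module.finrank k ((weightSpace g d v).map (evOn g)) =
      Nat.card {j // j ∉ R ∧ v + a j ∈ Set.range (wt (p := p) R a)} := by
  have hS : (weightSpace g d v).map (evOn g) = Submodule.span k (Set.range
      fun j : {j // j ∉ R ∧ v + a j ∈ Set.range (wt (p := p) R a)} => Pi.basisFun k ι j) := by
    apply le_antisymm
    · rintro _ ⟨D, hD, rfl⟩
      have hD' : ⁅diag p R a, (D : Derivation k (A k p ι) (A k p ι))⁆ = v • D := by
        rw [← hd]; exact congrArg Subtype.val hD
      rw [lie_diag_iff] at hD'
      rw [← (Pi.basisFun k ι).sum_repr (evOn g D)]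
      refine sum_mem fun i _ => ?_
      by_cases hi : evOn g D i = 0
      · rw [Pi.basisFun_repr, hi, zero_smul]; exact zero_mem _
      · refine Submodule.smul_mem _ _ (Submodule.subset_span ⟨⟨i, ?_, ?_⟩, rfl⟩)
        · intro hiR
          obtain ⟨β, hβ⟩ := weight_mem_of_aug_ne_zero R (hD' i) hi
          refine hv ⟨β - Pi.single i 1, ?_⟩
          rw [map_sub, hβ, wt_single R a hiR, add_sub_cancel_right]
        · exact weight_mem_of_aug_ne_zero R (hD' i) hi
    · rw [Submodule.span_le]
      rintro _ ⟨⟨j, hj, hvj⟩, rfl⟩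
      obtain ⟨D, hD, hdD, hDj⟩ := h3 j hj hvj
      refine ⟨⟨D, hD⟩, ?_, ?_⟩
      · apply Subtype.ext
        change ⁅(d : Derivation k (A k p ι) (A k p ι)), D⁆ = v • D
        rw [hd, hdD]
      · exact hDj.trans (Pi.basisFun_apply k ι j).symm
  classical
  rw [hS, Nat.card_eq_fintype_card]
  exact finrank_span_eq_card ((Pi.basisFun k ι).linearIndependent.comp _ Subtype.val_injective)

/-- Needed because an automorphism is known to preserve only the kernel of evaluation at the origin,
and does not commute with evaluation. -/
theorem finrank_map_eq_of_ker_eq {V V' : Type*} [AddCommGroup V] [Module k V] [AddCommGroup V']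
    [Module k V'] {f g : V →ₗ[k] V'} (h : LinearMap.ker f = LinearMap.ker g) (N : Submodule k V) :
    Module.finrank k (N.map f) = Module.finrank k (N.map g) := by
  have e : ∀ f : V →ₗ[k] V', Module.finrank k (N.map f) =
      Module.finrank k (N ⧸ Submodule.comap N.subtype (LinearMap.ker f)) := by
    intro f
    rw [← Submodule.range_subtype N, ← LinearMap.range_comp, ← LinearMap.ker_comp,
      Submodule.range_subtype]
    exact (LinearMap.quotKerEquivRange _).finrank_eq.symm
  rw [e, e, h]

theorem map_weightSpace {g : LieSubalgebra k (Derivation k (A k p ι) (A k p ι))} {φ : g ≃ₗ[k] g}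
    (hφ : ∀ x y : g, φ ⁅x, y⁆ = ⁅φ x, φ y⁆) (d : g) (v : k) :
    (weightSpace g d v).map (φ : g →ₗ[k] g) = weightSpace g (φ d) v := by
  ext D
  constructor
  · rintro ⟨E, hE, rfl⟩
    change ⁅φ d, φ E⁆ = v • φ E
    rw [← hφ, show ⁅d, E⁆ = v • E from hE, map_smul]
  · intro hD
    refine ⟨φ.symm D, ?_, φ.apply_symm_apply D⟩
    apply φ.injective
    rw [hφ, map_smul, φ.apply_symm_apply]
    exact hD

/-- The hypotheses under which the weights of a diagonal derivation can be recovered. -/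
structure IsRich (g : LieSubalgebra k (Derivation k (A k p ι) (A k p ι))) (R : Finset ι)
    (a : ι → k) : Prop where
  linear_mem : R.Nonempty → ∀ j ∉ R, ∃ l ≠ j, derOf (fun i => if i = l then x k p j else 0) ∈ g
  exists_unit : ∀ i ∈ R, ∀ α : ι → ZMod p, ∃ D ∈ g, ⁅diag p R a, D⁆ = wt R a α • D ∧
      aug k p ι (D (x k p i)) ≠ 0 ∧ ∀ j ∉ R, D (x k p j) ∈ idealJ k p R
  exists_value : ∀ v ∉ Set.range (wt (p := p) R a), ∀ j ∉ R,
    v + a j ∈ Set.range (wt (p := p) R a) →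
      ∃ D ∈ g, ⁅diag p R a, D⁆ = v • D ∧ ev ι D = Pi.single j 1

variable {g : LieSubalgebra k (Derivation k (A k p ι) (A k p ι))} {φ : g ≃ₗ[k] g} {a b : ι → k}

variable {R} in
-- The criterion of `mem_range_wt_iff` mentions only brackets with `d` and vanishing at the origin,
-- and `φ` respects both.
theorem range_wt_eq (hg : IsAmple g) (hφ : ∀ x y : g, φ ⁅x, y⁆ = ⁅φ x, φ y⁆) {d : g}
    (hd : (d : Derivation k (A k p ι) (A k p ι)) = diag p R a)
    (hφd : (φ d : Derivation k (A k p ι) (A k p ι)) = diag p R b)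
    (ha : Indep p R a) (hb : Indep p R b) (hra : IsRich g R a) (hrb : IsRich g R b) :
    Set.range (wt (p := p) R a) = Set.range (wt (p := p) R b) := by
  -- Without shifted coordinates both sets are `{0}`, and the criterion is not available.
  rcases R.eq_empty_or_nonempty with rfl | hR
  · ext v; simp [wt_apply]
  have key : ∀ (a : ι → k), IsRich g R a → Indep p R a → ∀ d : g,
      (d : Derivation k (A k p ι) (A k p ι)) = diag p R a → ∀ v,
      (v ∈ Set.range (wt (p := p) R a) ↔ ∃ D : g, ⁅d, D⁆ = v • D ∧ evOn g D ≠ 0 ∧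
        ∀ E : g, ∀ w : k, ⁅d, E⁆ = w • E → evOn g E = 0 → evOn g ⁅D, E⁆ = 0) := by
    intro a hra ha d hd v
    rw [mem_range_wt_iff ha hR (hra.linear_mem hR) hra.exists_unit]
    constructor
    · rintro ⟨D, hD, h1, h2, h3⟩
      refine ⟨⟨D, hD⟩, Subtype.ext (show ⁅(d : Derivation k (A k p ι) (A k p ι)), D⁆ = v • D by rw [hd, h1]), h2, fun E w hE hE0 => ?_⟩
      exact h3 E E.2 w (hd ▸ congrArg Subtype.val hE) hE0
    · rintro ⟨⟨D, hD⟩, h1, h2, h3⟩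
      refine ⟨D, hD, hd ▸ congrArg Subtype.val h1, h2, fun E hE w hw hE0 => ?_⟩
      exact h3 ⟨E, hE⟩ w (Subtype.ext (show ⁅(d : Derivation k (A k p ι) (A k p ι)), E⁆ = w • E by rw [hd, hw])) hE0
  have hev : ∀ y : g, evOn g (φ y) = 0 ↔ evOn g y = 0 := ev_map_eq_zero_iff hg hφ
  ext v
  rw [key a hra ha d hd, key b hrb hb _ hφd,
    φ.surjective.exists (p := fun D : g => ⁅φ d, D⁆ = v • D ∧ evOn g D ≠ 0 ∧
      ∀ E : g, ∀ w : k, ⁅φ d, E⁆ = w • E → evOn g E = 0 → evOn g ⁅D, E⁆ = 0)]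
  refine exists_congr fun D => and_congr ?_ (and_congr ?_ ?_)
  · rw [← hφ, ← map_smul, φ.injective.eq_iff]
  · exact not_congr (hev D).symm
  · rw [φ.surjective.forall (p := fun E : g => ∀ w : k, ⁅φ d, E⁆ = w • E → evOn g E = 0 →
      evOn g ⁅φ D, E⁆ = 0)]
    refine forall_congr' fun E => forall_congr' fun w => ?_
    rw [← hφ, ← map_smul, φ.injective.eq_iff, hev, ← hφ, hev]

variable {R} in
-- Both counts are dimensions of weight spaces modulo their elements vanishing at the origin, and
-- `φ` identifies the two quotients.
theorem card_weight_eq (hg : IsAmple g) (hφ : ∀ x y : g, φ ⁅x, y⁆ = ⁅φ x, φ y⁆) {d : g}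
    (hd : (d : Derivation k (A k p ι) (A k p ι)) = diag p R a)
    (hφd : (φ d : Derivation k (A k p ι) (A k p ι)) = diag p R b)
    (ha : Indep p R a) (hb : Indep p R b) (hra : IsRich g R a) (hrb : IsRich g R b)
    {v : k} (hv : v ∉ Set.range (wt (p := p) R a)) :
    Nat.card {j // j ∉ R ∧ v + a j ∈ Set.range (wt (p := p) R a)} =
      Nat.card {j // j ∉ R ∧ v + b j ∈ Set.range (wt (p := p) R a)} := by
  have hU := range_wt_eq hg hφ hd hφd ha hb hra hrb
  rw [← finrank_map_weightSpace d hd v hv (hra.exists_value v hv)]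
  rw [hU] at hv ⊢
  rw [← finrank_map_weightSpace (φ d) hφd v hv (hrb.exists_value v hv), ← map_weightSpace hφ,
    ← Submodule.map_comp]
  refine finrank_map_eq_of_ker_eq ?_ _
  ext D
  exact (ev_map_eq_zero_iff hg hφ D).symm

end Toral

/-- Matching the fibres off `q₀` gives a bijection between subsets of a finite set; it extends to a
permutation, which must then match the fibres over `q₀`. -/
theorem exists_perm_of_card_fiber_eq {J Q : Type*} [Finite J] (f g : J → Q) (q₀ : Q)
    (h : ∀ q ≠ q₀, Nat.card {j // f j = q} = Nat.card {j // g j = q}) :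
    ∃ π : Equiv.Perm J, ∀ j, f (π j) = g j := by
  classical
  have := Fintype.ofFinite J
  have key : ∀ f : J → Q, ∀ q : {q // q ≠ q₀},
      Nat.card {j : {j // f j ≠ q₀} // (⟨f j, j.2⟩ : {q // q ≠ q₀}) = q} =
        Nat.card {j // f j = q} := fun f q => Nat.card_congr
    { toFun := fun j => ⟨j, congrArg Subtype.val j.2⟩
      invFun := fun j => ⟨⟨j, by rw [j.2]; exact q.2⟩, Subtype.ext j.2⟩
      left_inv := fun _ => rfl
      right_inv := fun _ => rfl }
  let e := fun q : {q // q ≠ q₀} => (Finite.card_eq.1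
    (((key g q).trans (h q q.2).symm).trans (key f q).symm)).some
  let E : {j // g j ≠ q₀} ≃ {j // f j ≠ q₀} :=
    (Equiv.sigmaFiberEquiv _).symm.trans
      ((Equiv.sigmaCongrRight e).trans (Equiv.sigmaFiberEquiv _))
  refine ⟨E.extendSubtype, fun j => ?_⟩
  by_cases hj : g j = q₀
  · have := E.extendSubtype_not_mem j (not_not.2 hj)
    rw [hj]; exact not_not.1 this
  · rw [E.extendSubtype_apply_of_mem j hj]
    exact congrArg Subtype.val (e ⟨g j, hj⟩ ⟨⟨j, hj⟩, rfl⟩).2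

end CartanType

end

open scoped Pointwise

set_option linter.unusedSectionVars false

noncomputable section

namespace CartanType

/-! Automorphisms of a Lie algebra of derivations induced by automorphisms of `A`, and the
reduction of the theorem to the transitivity of the stabilizer of a torus. -/

section Conj

variable {k : Type*} [Field k] {p : ℕ} [hp : Fact p.Prime] [CharP k p] {ι : Type*} [Fintype ι]
  [DecidableEq ι]

instance : Module.Finite k (Derivation k (A k p ι) (A k p ι)) := by
  let f : Derivation k (A k p ι) (A k p ι) →ₗ[k] (A k p ι →ₗ[k] A k p ι) :=
    { toFun := fun D => D
      map_add' := fun _ _ => rfl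
      map_smul' := fun _ _ => rfl }
  exact Module.Finite.of_injective f fun D E h => Derivation.ext fun a => LinearMap.congr_fun h a

instance (g : LieSubalgebra k (Derivation k (A k p ι) (A k p ι))) : Module.Finite k g :=
  inferInstanceAs (Module.Finite k g.toSubmodule)

/-- The derivation `σ⁻¹ D σ`. -/
def conjDerAux (σ : A k p ι ≃ₐ[k] A k p ι) (D : Derivation k (A k p ι) (A k p ι)) :
    Derivation k (A k p ι) (A k p ι) :=
  Derivation.mk' (σ.symm.toLinearMap ∘ₗ (D : A k p ι →ₗ[k] A k p ι) ∘ₗ σ.toLinearMap)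
    fun a b => by simp

theorem conjDerAux_apply (σ : A k p ι ≃ₐ[k] A k p ι) (D : Derivation k (A k p ι) (A k p ι))
    (f : A k p ι) : conjDerAux σ D f = σ.symm (D (σ f)) := rfl

/-- Conjugation `D ↦ σ⁻¹ D σ` as a homomorphism of Lie algebras. -/
def conjDer (σ : A k p ι ≃ₐ[k] A k p ι) :
    Derivation k (A k p ι) (A k p ι) →ₗ⁅k⁆ Derivation k (A k p ι) (A k p ι) where
  toFun := conjDerAux σ
  map_add' D E := by ext f; simp [conjDerAux_apply]
  map_smul' c D := by ext f; simp [conjDerAux_apply]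
  map_lie' := by intro D E; ext f; simp [conjDerAux_apply, Derivation.commutator_apply]

@[simp] theorem conjDer_apply (σ : A k p ι ≃ₐ[k] A k p ι) (D : Derivation k (A k p ι) (A k p ι))
    (f : A k p ι) : conjDer σ D f = σ.symm (D (σ f)) := rfl

theorem conjDer_injective (σ : A k p ι ≃ₐ[k] A k p ι) : Function.Injective (conjDer σ) := by
  intro D E h
  ext f
  have := DFunLike.congr_fun h (σ.symm f)
  simpa using this

theorem toEnd_conjDer_pow (σ : A k p ι ≃ₐ[k] A k p ι) (D : Derivation k (A k p ι) (A k p ι))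
    (n : ℕ) (f : A k p ι) : (toEnd (conjDer σ D) ^ n) f = σ.symm ((toEnd D ^ n) (σ f)) := by
  induction n generalizing f with
  | zero => simp
  | succ n ih =>
    rw [pow_succ, Module.End.mul_apply, ih, pow_succ, Module.End.mul_apply]
    change σ.symm ((toEnd D ^ n) (σ (σ.symm (D (σ f))))) = _
    rw [σ.apply_symm_apply]; rfl

variable {g : LieSubalgebra k (Derivation k (A k p ι) (A k p ι))}

/-- The automorphism of `g` induced by an automorphism of `A`. -/
def autOf (σ : A k p ι ≃ₐ[k] A k p ι) (h : ∀ D ∈ g, conjDer σ D ∈ g) : autP p g :=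
  ⟨LinearEquiv.ofInjectiveEndo
    (((conjDer σ : Derivation k (A k p ι) (A k p ι) →ₗ[k] Derivation k (A k p ι) (A k p ι)).restrict
      h : g.toSubmodule →ₗ[k] g.toSubmodule))
    (fun D E hDE => Subtype.ext (conjDer_injective σ (congrArg Subtype.val hDE))), by
    refine ⟨fun D E => Subtype.ext (LieHom.map_lie (conjDer σ) _ _), fun D E => ?_⟩
    change toEnd (conjDer σ (E : Derivation k (A k p ι) (A k p ι))) =
      toEnd (conjDer σ (D : Derivation k (A k p ι) (A k p ι))) ^ p ↔
        toEnd (E : Derivation k (A k p ι) (A k p ι)) =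
          toEnd (D : Derivation k (A k p ι) (A k p ι)) ^ p
    rw [LinearMap.ext_iff, LinearMap.ext_iff]
    refine Iff.trans (forall_congr' fun f => ?_) σ.surjective.forall.symm
    rw [toEnd_conjDer_pow]
    exact σ.symm.injective.eq_iff⟩

theorem coe_autOf_smul (σ : A k p ι ≃ₐ[k] A k p ι) (h : ∀ D ∈ g, conjDer σ D ∈ g) (D : g) :
    ((autOf σ h • D : g) : Derivation k (A k p ι) (A k p ι)) = conjDer σ D := rfl

/-- The stabilizer demands equality; in finite dimension inclusion is enough. -/
theorem mem_normalizer_of_le {t : Submodule k g} (φ : autP p g) (h : ∀ x ∈ t, φ • x ∈ t) :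
    φ ∈ normalizer p g t := by
  rw [MulAction.mem_stabilizer_iff]
  have h1 : t.map ((φ : g ≃ₗ[k] g) : g →ₗ[k] g) ≤ t := by
    rintro _ ⟨x, hx, rfl⟩; exact h x hx
  have h2 := Submodule.eq_of_le_of_finrank_eq h1 (LinearEquiv.finrank_map_eq _ _)
  have h3 := congrArg (fun s : Submodule k g => (s : Set g)) h2
  exact h3

theorem index_smul (t : ℕ → Submodule k g) (φ : autP p g) (s : g) :
    index p g t (φ • s) = index p g t s := by
  unfold index
  rw [MulAction.orbit_smul]

theorem index_le {t : ℕ → Submodule k g} {s : g} {r : ℕ} (hr : r ≤ mu p g) (φ : autP p g)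
    (h : φ • s ∈ t r) : index p g t s ≤ r :=
  Nat.sInf_le ⟨hr, φ • s, MulAction.mem_orbit _ _, h⟩

/-- What remains to be shown is `H`: elements of the index part conjugate under the whole group are
conjugate under the normalizer. -/
theorem orbit_inter_indexPart {t : ℕ → Submodule k g} {r : ℕ}
    (hss : ∀ x ∈ t r, IsSemisimpleElt p g x)
    (H : ∀ d ∈ indexPart p g t r, ∀ φ : autP p g, φ • d ∈ indexPart p g t r →
      ∃ n ∈ normalizer p g (t r), n • d = φ • d)
    (d : g) (hd : d ∈ indexPart p g t r) :
    MulAction.orbit (autP p g) d ∩ indexPart p g t r =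
      {s | ∃ w : weylGroup p g (t r), s = (w • (⟨d, hd.1⟩ : (t r : Set g))).1} := by
  ext s
  constructor
  · rintro ⟨⟨φ, rfl⟩, hs⟩
    obtain ⟨n, hn, hnd⟩ := H d hd φ hs
    exact ⟨QuotientGroup.mk ⟨n, hn⟩, hnd.symm⟩
  · rintro ⟨w, rfl⟩
    induction w using QuotientGroup.induction_on with
    | H n =>
      have hmem : ((n : autP p g) • d) ∈ t r := (n • (⟨d, hd.1⟩ : (t r : Set g))).2
      refine ⟨⟨n, rfl⟩, hmem, hss _ hmem, ?_⟩
      change index p g t ((n : autP p g) • d) = r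
      rw [index_smul, hd.2.2]

/-! Diagonal derivations are semisimple. -/

variable (R : Finset ι)

/-- The spans of the tails of the sequence of Frobenius iterates decrease and hence stabilize, so
some iterate lies in the span of the later ones. Since `k` is perfect, inverse Frobenius brings this
relation back to `a`. -/
theorem exists_span_frobenius [IsAlgClosed k] (a : ι → k) :
    a ∈ Submodule.span k (Set.range fun j : ℕ => fun i => a i ^ p ^ (j + 1)) := by
  let W : ℕ → Submodule k (ι → k) := fun n =>
    Submodule.span k (Set.range fun j : ℕ => fun i => a i ^ p ^ (j + n))
  have hW : Antitone W := by
    intro m n hmn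
    refine Submodule.span_mono ?_
    rintro _ ⟨j, rfl⟩
    exact ⟨j + (n - m), by simp only [add_assoc, Nat.sub_add_cancel hmn]⟩
  obtain ⟨n, hn⟩ := IsArtinian.monotone_stabilizes (R := k) (M := ι → k)
    ⟨fun n => OrderDual.toDual (W n), hW⟩
  have h1 : W n = W (n + 1) := hn (n + 1) n.le_succ
  have h2 : (fun i => a i ^ p ^ n) ∈ W (n + 1) := by
    rw [← h1]; exact Submodule.subset_span ⟨0, by simp⟩
  have hexp : ExpChar k p := ExpChar.prime hp.out
  have hperf : PerfectRing k p := inferInstance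
  have key : ∀ y ∈ W (n + 1), (fun i => (iterateFrobeniusEquiv k p n).symm (y i)) ∈
      Submodule.span k (Set.range fun j : ℕ => fun i => a i ^ p ^ (j + 1)) := by
    intro y hy
    induction hy using Submodule.span_induction with
    | mem f hf =>
      obtain ⟨j, rfl⟩ := hf
      refine Submodule.subset_span ⟨j, ?_⟩
      ext i
      rw [eq_comm, RingEquiv.symm_apply_eq, iterateFrobeniusEquiv_def, ← pow_mul, ← pow_add]
      ring_nf
    | zero => simp only [Pi.zero_apply, map_zero]; exact zero_mem _
    | add f g _ _ hf hg => simp only [Pi.add_apply, map_add]; exact add_mem hf hg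
    | smul c f _ hf =>
      simp only [Pi.smul_apply, smul_eq_mul, map_mul]; exact Submodule.smul_mem _ _ hf
  convert key _ h2 using 2 with i
  rw [eq_comm, RingEquiv.symm_apply_eq, iterateFrobeniusEquiv_def]

/-- Monomials in all the `z_i` span `A`. The exponents serve for every `a` at once, which makes
diagonal derivations comparable on a common eigenbasis. -/
theorem span_eigenvectors :
    Submodule.span k {f : A k p ι | ∃ α : ι → ℕ, ∀ a : ι → k,
      diag p R a f = (∑ i, α i * a i) • f} = ⊤ := by
  rw [eq_top_iff]
  rintro f -
  have hmul : ∀ i, ∀ f ∈ Submodule.span k {f : A k p ι | ∃ α : ι → ℕ, ∀ a : ι → k,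
      diag p R a f = (∑ i, α i * a i) • f}, f * z k p R i ∈ Submodule.span k
        {f : A k p ι | ∃ α : ι → ℕ, ∀ a : ι → k, diag p R a f = (∑ i, α i * a i) • f} := by
    intro i f hf
    induction hf using Submodule.span_induction with
    | mem f hf =>
      obtain ⟨α, hα⟩ := hf
      refine Submodule.subset_span ⟨α + Pi.single i 1, fun a => ?_⟩
      rw [Derivation.leibniz, hα, diag_z, smul_eq_mul, smul_eq_mul, mul_smul_comm, mul_smul_comm,
        mul_comm (z k p R i), ← add_smul]
      congr 1
      simp [add_mul, Finset.sum_add_distrib, Pi.single_apply, add_comm]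
    | zero => simp
    | add f g _ _ hf hg => rw [add_mul]; exact add_mem hf hg
    | smul c f _ hf => rw [smul_mul_assoc]; exact Submodule.smul_mem _ _ hf
  induction f using A_induction with
  | one => exact Submodule.subset_span ⟨0, fun a => by simp⟩
  | add f g hf hg => exact add_mem hf hg
  | smul c f hf => exact Submodule.smul_mem _ _ hf
  | mul f i hf =>
    rw [x_eq R i, mul_sub]
    refine sub_mem (hmul i f hf) ?_
    split_ifs
    · simpa using hf
    · simp

theorem natCast_pow_pow (n j : ℕ) : (n : k) ^ p ^ j = n := by
  induction j with
  | zero => simp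
  | succ j ih =>
    rw [pow_succ, pow_mul, ih]
    exact map_natCast (frobenius k p) n

/-- On monomials the weight is an integral combination of the `a_i`, so the `p`-th power of a
diagonal derivation is the diagonal derivation with Frobenius applied to its coefficients. -/
theorem isSemisimpleElt_of_eq_diag [IsAlgClosed k] {d : g} {a : ι → k}
    (hd : (d : Derivation k (A k p ι) (A k p ι)) = diag p R a) : IsSemisimpleElt p g d := by
  unfold IsSemisimpleElt
  rw [hd]
  have hpow : ∀ (f : A k p ι) (α : ι → ℕ),
      (∀ a : ι → k, diag p R a f = (∑ i, α i * a i) • f) → ∀ j : ℕ,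
      (toEnd (diag p R a) ^ p ^ j) f = toEnd (diag p R fun i => a i ^ p ^ j) f := by
    intro f α hα j
    have h1 : ∀ n : ℕ, (toEnd (diag p R a) ^ n) f = (∑ i, α i * a i) ^ n • f := by
      intro n
      induction n with
      | zero => simp
      | succ n ih =>
        rw [pow_succ', Module.End.mul_apply, ih, map_smul]
        change _ • diag p R a f = _
        rw [hα, smul_smul, pow_succ]
    rw [h1]
    change _ = diag p R _ f
    rw [hα, sum_pow_char_pow]
    simp only [mul_pow, natCast_pow_pow]
  have hpow' : ∀ j : ℕ, toEnd (diag p R a) ^ p ^ j = toEnd (diag p R fun i => a i ^ p ^ j) := by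
    intro j
    refine LinearMap.ext_on (span_eigenvectors R) ?_
    rintro f ⟨α, hα⟩
    exact hpow f α hα j
  simp only [hpow']
  let L : (ι → k) →ₗ[k] Module.End k (A k p ι) :=
    { toFun := fun a => toEnd (diag p R a)
      map_add' := fun a b => by
        have : diag p R (a + b) = diag p R a + diag p R b := der_ext _ _ fun i => by simp [add_smul]
        rw [this]; rfl
      map_smul' := fun c a => by
        have : diag p R (c • a) = c • diag p R a := der_ext _ _ fun i => by simp [mul_smul]
        rw [this]; rfl }
  have h := Submodule.mem_map_of_mem (f := L) (exists_span_frobenius (p := p) a)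
  rw [Submodule.map_span, ← Set.range_comp] at h
  exact h

end Conj

end CartanType

end

open scoped Pointwise

set_option linter.unusedSectionVars false

noncomputable section

namespace CartanType

attribute [local instance] ZMod.algebra

/-! The general form of the theorem, given enough automorphisms of `A`. -/

section General

variable {k : Type*} [Field k] {p : ℕ} [hp : Fact p.Prime] [CharP k p] {ι : Type*} [Fintype ι]
  [DecidableEq ι] {g : LieSubalgebra k (Derivation k (A k p ι) (A k p ι))}

/-- This makes the value of `mu` irrelevant: beyond the last coordinate that can be shifted the tori
repeat and the index parts are empty. -/
theorem notMem_indexPart_of_eq {t : ℕ → Submodule k g} {r r' : ℕ} (hr : r ≤ mu p g) (h : r' < r)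
    (ht : t r = t r') (d : g) : d ∉ indexPart p g t r := by
  rintro ⟨h1, _, h2⟩
  have h3 := index_le (t := t) (s := d) (h.le.trans hr) 1 (by rw [one_smul, ← ht]; exact h1)
  omega

/-- `C` is the space of coefficients of the torus: all vectors for `W`, sum zero for `S`, skew for
`H`. By `hred` elements of index `r` have independent coefficients; the two invariants of `φ` then
provide the hypotheses of `hmove`, whose automorphism normalizes the torus. -/
theorem orbit_inter_indexPart_of_moves [IsAlgClosed k] {t : ℕ → Submodule k g} {r : ℕ}
    (hr : r ≤ mu p g) (R : Finset ι) (C : Set (ι → k)) (hg : IsAmple g)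
    (hrich : ∀ a ∈ C, Indep p R a → IsRich g R a)
    (ht : ∀ s : g, s ∈ t r ↔ ∃ a ∈ C, (s : Derivation k (A k p ι) (A k p ι)) = diag p R a)
    (hred : ∀ a ∈ C, ¬ Indep p R a → ∃ σ : A k p ι ≃ₐ[k] A k p ι, (∀ D ∈ g, conjDer σ D ∈ g) ∧
      ∃ r' < r, ∀ s : g, (s : Derivation k (A k p ι) (A k p ι)) = conjDer σ (diag p R a) →
        s ∈ t r')
    (hmove : ∀ a ∈ C, ∀ b ∈ C, Indep p R a → Indep p R b →
      Set.range (wt (p := p) R a) = Set.range (wt (p := p) R b) →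
      (∀ v ∉ Set.range (wt (p := p) R a),
        Nat.card {j // j ∉ R ∧ v + a j ∈ Set.range (wt (p := p) R a)} =
          Nat.card {j // j ∉ R ∧ v + b j ∈ Set.range (wt (p := p) R a)}) →
      ∃ σ : A k p ι ≃ₐ[k] A k p ι, (∀ D ∈ g, conjDer σ D ∈ g) ∧
        (∀ a' ∈ C, ∃ b' ∈ C, conjDer σ (diag p R a') = diag p R b') ∧
        conjDer σ (diag p R a) = diag p R b)
    (d : g) (hd : d ∈ indexPart p g t r) :
    MulAction.orbit (autP p g) d ∩ indexPart p g t r =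
      {s | ∃ w : weylGroup p g (t r), s = (w • (⟨d, hd.1⟩ : (t r : Set g))).1} := by
  have hind : ∀ s ∈ indexPart p g t r, ∃ a ∈ C,
      (s : Derivation k (A k p ι) (A k p ι)) = diag p R a ∧ Indep p R a := by
    rintro s ⟨hs, _, hi⟩
    obtain ⟨a, ha, hsa⟩ := (ht s).1 hs
    refine ⟨a, ha, hsa, ?_⟩
    by_contra hna
    obtain ⟨σ, hσ, r', hr', h⟩ := hred a ha hna
    have h1 := index_le (t := t) (s := s) (hr'.le.trans hr) (autOf σ hσ)
      (h _ (by rw [coe_autOf_smul, hsa]))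
    omega
  refine orbit_inter_indexPart (fun s hs => ?_) ?_ d hd
  · obtain ⟨a, _, ha⟩ := (ht s).1 hs
    exact isSemisimpleElt_of_eq_diag R ha
  · intro d hd φ hφd
    obtain ⟨a, haC, hda, ha⟩ := hind d hd
    obtain ⟨b, hbC, hdb, hb⟩ := hind _ hφd
    have hφ : ∀ x y : g, (φ : g ≃ₗ[k] g) ⁅x, y⁆ = ⁅(φ : g ≃ₗ[k] g) x, (φ : g ≃ₗ[k] g) y⁆ := φ.2.1
    have hra := hrich a haC ha
    have hrb := hrich b hbC hb
    obtain ⟨σ, hσ, hσC, hσd⟩ := hmove a haC b hbC ha hb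
      (range_wt_eq hg hφ hda hdb ha hb hra hrb)
      (fun v hv => card_weight_eq hg hφ hda hdb ha hb hra hrb hv)
    refine ⟨autOf σ hσ, mem_normalizer_of_le _ fun s hs => ?_, ?_⟩
    · obtain ⟨a', ha', hs'⟩ := (ht s).1 hs
      obtain ⟨b', hb', hab⟩ := hσC a' ha'
      exact (ht _).2 ⟨b', hb', by rw [coe_autOf_smul, hs', hab]⟩
    · apply Subtype.ext
      rw [coe_autOf_smul, hda, hσd, hdb]

end General

/-! Automorphisms of `A` given by invertible matrices over the prime field. -/

section Monomial

variable {k : Type*} [Field k] {p : ℕ} [hp : Fact p.Prime] [CharP k p] {ι : Type*} [Fintype ι]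
  [DecidableEq ι] (R : Finset ι)

/-- The blocks of `N` and `K` with indices in `R` are inverse to each other. -/
def IsInvPair (N K : ι → ι → ZMod p) : Prop :=
  (∀ l ∈ R, ∀ m ∈ R, ∑ i ∈ R, K l i * N i m = if l = m then 1 else 0) ∧
    ∀ l ∈ R, ∀ m ∈ R, ∑ i ∈ R, N l i * K i m = if l = m then 1 else 0

/-- A relation over the prime field is scaled to have entry one at `i₀` and made row `i₀` of an
elementary matrix; swapping rows `i₀` and `i₁` puts it where wanted. -/
theorem exists_invPair_of_not_indep {a : ι → k} (ha : ¬ Indep p R a) {i₁ : ι} (hi₁ : i₁ ∈ R) :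
    ∃ N K : ι → ι → ZMod p, IsInvPair R N K ∧ wt R a (N i₁) = 0 := by
  unfold Indep at ha
  push Not at ha
  obtain ⟨α, hα, i₀, hi₀, hαi⟩ := ha
  set β : ι → ZMod p := (α i₀)⁻¹ • α - Pi.single i₀ 1 with hβ
  have hβ0 : β i₀ = 0 := by simp [hβ, hαi]
  set τ := Equiv.swap i₀ i₁
  have hτ : ∀ i, τ i ∈ R ↔ i ∈ R := by
    intro i
    by_cases h0 : i = i₀
    · subst h0; simp [τ, hi₀, hi₁]
    by_cases h1 : i = i₁
    · subst h1; simp [τ, hi₀, hi₁]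
    · rw [Equiv.swap_apply_of_ne_of_ne h0 h1]
  -- Since `β i₀ = 0`, adding and subtracting `c β` in row `i₀` are inverse operations; `c = 1` and
  -- `c = -1` give the two products.
  have key : ∀ c : ZMod p, ∀ l ∈ R, ∀ m ∈ R,
      ∑ i ∈ R, (((if l = i then 1 else 0) + (if l = i₀ then -c * β i else 0)) *
        ((if i = m then 1 else 0) + (if i = i₀ then c * β m else 0)) : ZMod p) =
        if l = m then 1 else 0 := by
    intro c l hl m hm
    simp only [add_mul, mul_add, Finset.sum_add_distrib]
    by_cases hl0 : l = i₀
    · subst hl0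
      simp [hl, hm, hβ0]
    · simp [hl0]
      exact fun h => absurd hm h
  refine ⟨fun i m => (if τ i = m then 1 else 0) + (if τ i = i₀ then (1 : ZMod p) * β m else 0),
    fun l i => (if l = τ i then 1 else 0) + (if l = i₀ then -(1 : ZMod p) * β (τ i) else 0),
    ⟨?_, ?_⟩, ?_⟩
  · intro l hl m hm
    rw [← key 1 l hl m hm]
    exact Finset.sum_equiv τ (fun i => (hτ i).symm) fun i _ => rfl
  · intro l hl m hm
    have := key (-1) (τ l) ((hτ l).2 hl) (τ m) ((hτ m).2 hm)
    simp only [neg_neg, τ.injective.eq_iff] at this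
    exact this
  · have : (fun m => (if τ i₁ = m then 1 else 0) + (if τ i₁ = i₀ then (1 : ZMod p) * β m else 0)) =
        (α i₀)⁻¹ • α := by
      ext m
      simp [τ, hβ, Pi.single_apply, eq_comm]
    refine (congrArg (wt R a) this).trans ?_
    rw [map_smul, hα, smul_zero]

theorem wt_sum_smul (a : ι → k) {κ : Type*} (s : Finset κ) (c : κ → ZMod p) (F : κ → ι → ZMod p) :
    wt R a (∑ i ∈ s, c i • F i) = ∑ i ∈ s, c i • wt R a (F i) := by
  rw [map_sum]; simp

variable {R} in
theorem Indep.eq_of_wt_eq {a : ι → k} (ha : Indep p R a) {α β : ι → ZMod p}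
    (h : wt R a α = wt R a β) : ∀ i ∈ R, α i = β i := by
  intro i hi
  have := ha (α - β) (by rw [map_sub, h, sub_self]) i hi
  exact sub_eq_zero.1 this

variable {R} in
-- The coefficients of `a` and `b` in `R` are two bases of one space over the prime field; `N` and
-- `K` are the changes of basis.
theorem exists_invPair_of_range_eq {a b : ι → k} (ha : Indep p R a) (hb : Indep p R b)
    (h : Set.range (wt (p := p) R a) = Set.range (wt (p := p) R b)) :
    ∃ N K : ι → ι → ZMod p, IsInvPair R N K ∧ ∀ i ∈ R, wt R a (N i) = b i := by
  have h1 : ∀ i : ι, ∃ α : ι → ZMod p, i ∈ R → wt R a α = b i := fun i => by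
    by_cases hi : i ∈ R
    · have : b i ∈ Set.range (wt (p := p) R a) := by rw [h]; exact ⟨_, wt_single R b hi⟩
      obtain ⟨α, hα⟩ := this
      exact ⟨α, fun _ => hα⟩
    · exact ⟨0, fun h => absurd h hi⟩
  have h2 : ∀ i : ι, ∃ α : ι → ZMod p, i ∈ R → wt R b α = a i := fun i => by
    by_cases hi : i ∈ R
    · have : a i ∈ Set.range (wt (p := p) R b) := by rw [← h]; exact ⟨_, wt_single R a hi⟩
      obtain ⟨α, hα⟩ := this
      exact ⟨α, fun _ => hα⟩
    · exact ⟨0, fun h => absurd h hi⟩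
  choose N hN using h1
  choose K hK using h2
  have key : ∀ {a b : ι → k} {N K : ι → ι → ZMod p}, Indep p R a →
      (∀ i ∈ R, wt R a (N i) = b i) → (∀ i ∈ R, wt R b (K i) = a i) →
      ∀ l ∈ R, ∀ m ∈ R, ∑ i ∈ R, K l i * N i m = if l = m then 1 else 0 := by
    intro a b N K ha hN hK l hl m hm
    have h3 : wt R a (∑ i ∈ R, K l i • N i) = wt R a (Pi.single l (1 : ZMod p)) := by
      rw [wt_sum_smul, wt_single R a hl, ← hK l hl, wt_apply]
      exact Finset.sum_congr rfl fun i hi => by rw [hN i hi]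
    have h4 := ha.eq_of_wt_eq h3 m hm
    simpa [Pi.single_apply, eq_comm] using h4
  exact ⟨N, K, ⟨key ha hN hK, key hb hK hN⟩, hN⟩

theorem bijective_of_x_mem_range (f : A k p ι →ₐ[k] A k p ι) (h : ∀ i, x k p i ∈ f.range) :
    Function.Bijective f := by
  have hs : Function.Surjective f := by
    intro a
    change a ∈ f.range
    induction a using A_induction with
    | one => exact one_mem _
    | add a b ha hb => exact add_mem ha hb
    | smul c a ha => exact Subalgebra.smul_mem _ ha c
    | mul a i ha => exact mul_mem ha (h i)
  exact ⟨(LinearMap.injective_iff_surjective (f := f.toLinearMap)).2 hs, hs⟩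

/-- Invertibility of `N` lets any exponent be written in its rows, with `K` giving the coefficients.
This is what makes the substitutions surjective. -/
theorem mon_mem_of_invPair {N K : ι → ι → ZMod p} (hNK : IsInvPair R N K)
    (B : Subalgebra k (A k p ι)) (h : ∀ i ∈ R, mon k R (N i) ∈ B) (γ : ι → ZMod p) :
    mon k R γ ∈ B := by
  have h1 : mon k R γ = mon k R (∑ l ∈ R, ∑ i ∈ R, (γ l * K l i) • N i) := by
    apply mon_congr
    intro m hm
    have h2 : ∀ l ∈ R, ∑ i ∈ R, γ l * K l i * N i m = γ l * if l = m then 1 else 0 := by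
      intro l hl
      rw [← hNK.1 l hl m hm, Finset.mul_sum]
      exact Finset.sum_congr rfl fun i _ => by ring
    simp only [Finset.sum_apply, Pi.smul_apply, smul_eq_mul]
    rw [Finset.sum_congr rfl h2]
    simp [hm]
  rw [h1, mon_sum]
  refine prod_mem fun l _ => ?_
  rw [mon_sum]
  refine prod_mem fun i hi => ?_
  rw [mon_smul]
  exact pow_mem (h i hi) _

theorem map_mon {N : ι → ι → ZMod p} {B : Type*} [FunLike B (A k p ι) (A k p ι)]
    [AlgHomClass B k (A k p ι) (A k p ι)] (σ : B)
    (h : ∀ i ∈ R, σ (z k p R i) = mon k R (N i)) (γ : ι → ZMod p) :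
    σ (mon k R γ) = mon k R (∑ i ∈ R, γ i • N i) := by
  rw [mon_sum, mon, map_prod]
  exact Finset.prod_congr rfl fun i hi => by rw [map_pow, h i hi, mon_smul]

theorem sub_one_pow_char {f : A k p ι} (h : f ^ p = 1) : (f - 1) ^ p = 0 := by
  have : CharP (A k p ι) p := by
    have : Nontrivial (A k p ι) := (aug k p ι).toRingHom.domain_nontrivial
    exact charP_of_injective_algebraMap (algebraMap k (A k p ι)).injective p
  rw [sub_pow_char, h, one_pow, sub_self]

/-- The automorphism `z_i ↦ ∏ z_l ^ N_il` for `i ∈ R` and `x_j ↦ x_{π j} ∏ z_l ^ c_jl` for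
`j ∉ R`. -/
theorem exists_monomial_aut {N K : ι → ι → ZMod p} (hNK : IsInvPair R N K) {π : Equiv.Perm ι}
    (hπ : ∀ j, π j ∈ R ↔ j ∈ R) (c : ι → ι → ZMod p) :
    ∃ σ : A k p ι ≃ₐ[k] A k p ι, (∀ i ∈ R, σ (z k p R i) = mon k R (N i)) ∧
      ∀ j ∉ R, σ (x k p j) = x k p (π j) * mon k R (c j) := by
  let f : A k p ι →ₐ[k] A k p ι :=
    -- The image of `x_i` must have zero `p`-th power, so for `i ∈ R` it is a monomial minus one.
    lift (fun i => if i ∈ R then mon k R (N i) - 1 else x k p (π i) * mon k R (c i)) fun i => by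
      split_ifs
      · exact sub_one_pow_char (mon_pow R _)
      · rw [mul_pow, x_pow, zero_mul]
  have hf : ∀ i, f (x k p i) =
      if i ∈ R then mon k R (N i) - 1 else x k p (π i) * mon k R (c i) := lift_x _ _
  have hR : ∀ i ∈ R, f (z k p R i) = mon k R (N i) := by
    intro i hi
    rw [z_of_mem hi, map_add, map_one, hf, if_pos hi]; ring
  have hJ : ∀ j ∉ R, f (x k p j) = x k p (π j) * mon k R (c j) := fun j hj => by
    rw [hf, if_neg hj]
  have hmon := mon_mem_of_invPair R hNK f.range fun i hi => ⟨_, hR i hi⟩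
  have hrange : ∀ i, x k p i ∈ f.range := by
    intro i
    by_cases hi : i ∈ R
    · rw [x_eq R i, if_pos hi, ← mon_single R hi]
      exact sub_mem (hmon _) (one_mem _)
    · have hj : π.symm i ∉ R := by rwa [← hπ, π.apply_symm_apply]
      have h1 : x k p i = f (x k p (π.symm i)) * mon k R (-c (π.symm i)) := by
        rw [hJ _ hj, π.apply_symm_apply, mul_assoc, mon_mul_neg, mul_one]
      rw [h1]
      exact mul_mem ⟨_, rfl⟩ (hmon _)
  exact ⟨AlgEquiv.ofBijective f (bijective_of_x_mem_range f hrange), hR, hJ⟩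

theorem conjDer_diag {σ : A k p ι ≃ₐ[k] A k p ι} {a b : ι → k}
    (h : ∀ i, diag p R a (σ (z k p R i)) = b i • σ (z k p R i)) :
    conjDer σ (diag p R a) = diag p R b := by
  apply der_ext
  intro i
  have h1 : conjDer σ (diag p R a) (z k p R i) = b i • z k p R i := by
    rw [conjDer_apply, h, map_smul, σ.symm_apply_apply]
  rwa [der_z, ← diag_x] at h1

theorem conjDer_diag_of_monomial {σ : A k p ι ≃ₐ[k] A k p ι} {N : ι → ι → ZMod p} {π : Equiv.Perm ι}
    {c : ι → ι → ZMod p} (hπ : ∀ j, π j ∈ R ↔ j ∈ R)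
    (h1 : ∀ i ∈ R, σ (z k p R i) = mon k R (N i))
    (h2 : ∀ j ∉ R, σ (x k p j) = x k p (π j) * mon k R (c j)) (a : ι → k) :
    conjDer σ (diag p R a) =
      diag p R fun i => if i ∈ R then wt R a (N i) else a (π i) + wt R a (c i) := by
  apply conjDer_diag
  intro i
  split_ifs with hi
  · rw [h1 i hi, diag_mon]
  · rw [z_of_notMem hi, h2 i hi, Derivation.leibniz, diag_mon, diag_x,
      z_of_notMem (by rwa [hπ]), smul_eq_mul, smul_eq_mul, mul_smul_comm, mul_smul_comm, add_smul,
      mul_comm (mon k R (c i)), add_comm]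

theorem card_subtype_neg {U : AddSubgroup k} {a : ι → k} (q : k) :
    Nat.card {j // j ∉ R ∧ -q + a j ∈ U} =
      Nat.card {j : {j // j ∉ R} // (QuotientAddGroup.mk (a j) : k ⧸ U) = QuotientAddGroup.mk q} :=
  Nat.card_congr
    { toFun := fun j => ⟨⟨j, j.2.1⟩, (QuotientAddGroup.eq.2 j.2.2).symm⟩
      invFun := fun j => ⟨j, j.1.2, QuotientAddGroup.eq.1 j.2.symm⟩
      left_inv := fun _ => rfl
      right_inv := fun _ => rfl }

variable {R} in
/-- Matching of the coordinates outside `R` by the classes of their weights. -/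
theorem exists_perm_of_card_weight_eq {a b : ι → k}
    (h : ∀ v ∉ Set.range (wt (p := p) R a),
        Nat.card {j // j ∉ R ∧ v + a j ∈ Set.range (wt (p := p) R a)} =
          Nat.card {j // j ∉ R ∧ v + b j ∈ Set.range (wt (p := p) R a)}) :
    ∃ π : Equiv.Perm ι, (∀ j, π j ∈ R ↔ j ∈ R) ∧ ∃ c : ι → ι → ZMod p,
      ∀ j ∉ R, b j = a (π j) + wt R a (c j) := by
  let U : AddSubgroup k := (wt (p := p) R a).toAddMonoidHom.range
  have hU : ∀ v, v ∈ Set.range (wt (p := p) R a) ↔ v ∈ U := fun v => Iff.rfl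
  -- The hypothesis says nothing about weights inside `U`; the zero class is the exempt fibre.
  obtain ⟨π, hπ⟩ := exists_perm_of_card_fiber_eq
    (fun j : {j // j ∉ R} => (QuotientAddGroup.mk (a j) : k ⧸ U))
    (fun j : {j // j ∉ R} => (QuotientAddGroup.mk (b j) : k ⧸ U)) 0 (by
      intro q hq
      induction q using QuotientAddGroup.induction_on with
      | H q =>
        have hv : -q ∉ Set.range (wt (p := p) R a) := by
          rw [hU, neg_mem_iff]
          exact fun h => hq ((QuotientAddGroup.eq_zero_iff q).2 h)
        have := h (-q) hv
        simp only [hU] at this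
        rwa [card_subtype_neg, card_subtype_neg] at this)
  have h1 : ∀ j : ι, ∃ c : ι → ZMod p, ∀ hj : j ∉ R, b j = a (π ⟨j, hj⟩) + wt R a c := by
    intro j
    by_cases hj : j ∈ R
    · exact ⟨0, fun h => absurd hj h⟩
    · obtain ⟨c, hc⟩ := QuotientAddGroup.eq.1 (hπ ⟨j, hj⟩)
      refine ⟨c, fun _ => ?_⟩
      change wt R a c = _ at hc
      rw [hc]; ring
  choose c hc using h1
  refine ⟨Equiv.Perm.ofSubtype (p := fun j => j ∉ R) π, fun j => ?_, c, fun j hj => ?_⟩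
  · by_cases hj : j ∈ R
    · rw [Equiv.Perm.ofSubtype_apply_of_not_mem (p := fun j => j ∉ R) _ (not_not.2 hj)]
    · rw [Equiv.Perm.ofSubtype_apply_of_mem (p := fun j => j ∉ R) π hj]
      exact iff_of_false (π ⟨j, hj⟩).2 hj
  · rw [Equiv.Perm.ofSubtype_apply_of_mem (p := fun j => j ∉ R) π hj]
    exact hc j hj

end Monomial

end CartanType

end

open scoped Pointwise

set_option linter.unusedSectionVars false

noncomputable section

namespace CartanType

attribute [local instance] ZMod.algebra

/-! The Jacobson-Witt algebras. -/

section Witt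

variable {k : Type*} [Field k] {p : ℕ} [hp : Fact p.Prime] [CharP k p] {ι : Type*} [Fintype ι]
  [DecidableEq ι]

variable (k) in
theorem natCast_ne_zero_of_lt {n : ℕ} (h0 : 0 < n) (h : n < p) : (n : k) ≠ 0 := by
  rw [Ne, CharP.cast_eq_zero_iff k p]
  exact fun hd => absurd (Nat.le_of_dvd h0 hd) (by omega)

theorem two_ne_zero_of_three_le (h : 3 ≤ p) : (2 : k) ≠ 0 := by
  exact_mod_cast natCast_ne_zero_of_lt k (n := 2) (by norm_num) (by omega)

theorem six_ne_zero_of_five_le (h : 5 ≤ p) : (6 : k) ≠ 0 := by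
  have h2 := two_ne_zero_of_three_le (k := k) (p := p) (by omega)
  have h3 : (3 : k) ≠ 0 := by
    exact_mod_cast natCast_ne_zero_of_lt k (n := 3) (by norm_num) (by omega)
  have := mul_ne_zero h2 h3
  norm_num at this
  exact this

theorem aug_der_three (X Y E : Derivation k (A k p ι) (A k p ι)) (i j l : ι) :
    aug k p ι (X (Y (E (x k p i * x k p j * x k p l)))) =
      ev ι X i * ev ι Y j * ev ι E l + ev ι X i * ev ι E j * ev ι Y l +
      ev ι Y i * ev ι X j * ev ι E l + ev ι Y i * ev ι E j * ev ι X l +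
      ev ι E i * ev ι X j * ev ι Y l + ev ι E i * ev ι Y j * ev ι X l := by
  simp [ev_apply]
  ring

theorem cubic_mem (i j l : ι) : x k p i * x k p j * x k p l ∈ maxI k p ι ^ 3 := by
  rw [pow_succ, pow_two]
  exact Ideal.mul_mem_mul (Ideal.mul_mem_mul (x_mem_maxI i) (x_mem_maxI j)) (x_mem_maxI l)

/-- The derivation `f ∂_j`. -/
abbrev single (j : ι) (f : A k p ι) : Derivation k (A k p ι) (A k p ι) := derOf (Pi.single j f)

theorem single_x (j i : ι) (f : A k p ι) :
    single j f (x k p i) = if i = j then f else 0 := by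
  rw [derOf_x, Pi.single_apply]

/-- The cubic element is `x_i² x_j ∂_j` with `v_i ≠ 0`, and the eigenvector is `e_j`. The factor is
`2 v_i²` for `j ≠ i` and `6 v_i²` for `j = i`; so `p ≥ 5` is needed when there is only one variable.
-/
theorem isAmple_W (hp3 : 3 ≤ p) (h : Nontrivial ι ∨ 5 ≤ p) : IsAmple (W k p ι) where
  exists_ev v := ⟨derOf fun i => algebraMap k _ (v i), trivial, by ext i; simp [ev_apply]⟩
  exists_linear u j₀ hu := by
    obtain ⟨i, hi⟩ := Function.ne_iff.1 hu
    refine ⟨single j₀ ((u i)⁻¹ • x k p i), trivial, ?_, fun E s hE j => ?_⟩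
    · rw [mem_fil_one]; ext l
      rw [ev_apply, single_x]; split_ifs <;> simp
    · have hEi : ev ι E i = s * u i := congrFun hE i
      rw [single_x]
      split_ifs
      · rw [Derivation.map_smul, map_smul, ← ev_apply, hEi, smul_eq_mul, mul_comm s,
          inv_mul_cancel_left₀ hi]
      · simp
  exists_cubic v hv := by
    obtain ⟨i, hi⟩ := Function.ne_iff.1 hv
    have hi : v i ≠ 0 := hi
    have key : ∀ j, (j ≠ i ∨ 5 ≤ p) → single j (x k p i * x k p i * x k p j) ∈ fil k p ι 3 ∧
        ∃ (u : ι → k) (c : k), u ≠ 0 ∧ c ≠ 0 ∧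
          ∀ (X Y E : Derivation k (A k p ι) (A k p ι)) (s : k), ev ι X = v → ev ι Y = v →
            ev ι E = s • u → ∀ l, aug k p ι (X (Y (E (single j (x k p i * x k p i * x k p j)
              (x k p l))))) = c * s * u l := by
      intro j hj
      refine ⟨mem_fil_iff.2 fun l => ?_, Pi.single j 1, (if j = i then 6 else 2) * v i * v i, ?_, ?_,
        fun X Y E s hX hY hE l => ?_⟩
      · rw [single_x]; split_ifs
        · exact cubic_mem _ _ _
        · exact zero_mem _
      · exact fun h => one_ne_zero (α := k) (by simpa using congrFun h j)
      · refine mul_ne_zero (mul_ne_zero ?_ hi) hi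
        split_ifs with hji
        · exact six_ne_zero_of_five_le (p := p) (hj.resolve_left (not_not.2 hji))
        · exact two_ne_zero_of_three_le hp3
      · rw [single_x]
        by_cases hl : l = j
        · subst hl
          rw [if_pos rfl, aug_der_three, hX, hY, hE]
          by_cases hli : l = i
          · subst hli; simp; ring
          · have : i ≠ l := fun h => hli h.symm
            simp [hli, this]; ring
        · simp [hl]
    rcases h with h | h
    · obtain ⟨j, hj⟩ := exists_ne i
      exact ⟨_, trivial, key j (Or.inl hj)⟩
    · exact ⟨_, trivial, key i (Or.inr h)⟩

/-- The required fields are `x_j ∂_l`, `z^α z_i ∂_i` and `z^α ∂_j`. -/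
theorem isRich_W (R : Finset ι) (a : ι → k) : IsRich (W k p ι) R a where
  linear_mem := by
    rintro ⟨l, hl⟩ j hj
    exact ⟨l, ne_of_mem_of_not_mem hl hj, trivial⟩
  exists_unit i hi α := by
    refine ⟨single i (mon k R α * z k p R i), trivial, ?_, ?_, fun j hj => ?_⟩
    · rw [lie_diag_iff]
      intro l
      rw [single_x]
      split_ifs with h
      · subst h
        rw [Derivation.leibniz, diag_mon, diag_z, smul_eq_mul, smul_eq_mul, mul_smul_comm,
          mul_smul_comm, add_smul, mul_comm (z k p R l), add_comm]
      · simp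
    · rw [single_x, if_pos rfl, map_mul, aug_mon, aug_z, if_pos hi, mul_one]
      exact one_ne_zero
    · rw [single_x, if_neg (ne_of_mem_of_not_mem hi hj).symm]
      exact zero_mem _
  exists_value v _ j _ := by
    rintro ⟨α, hα⟩
    refine ⟨single j (mon k R α), trivial, ?_, ?_⟩
    · rw [lie_diag_iff]
      intro l
      rw [single_x]
      split_ifs with h
      · subst h; rw [diag_mon, hα]
      · simp
    · ext l
      rw [ev_apply, single_x, Pi.single_apply]
      split_ifs <;> simp [aug_mon]

/-! ### The standard torus of the Jacobson-Witt algebra and its orbits. -/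

/-- The indices of the shifted coordinates of the torus `t_r` in `Fin n`. -/
def initial (n r : ℕ) : Finset (Fin n) := Finset.univ.filter fun i => i.val < r

theorem mem_initial {n r : ℕ} {i : Fin n} : i ∈ initial n r ↔ i.val < r := by simp [initial]

/-- Shifting a coordinate with zero coefficient changes nothing; this is how a dependency lowers the
index. -/
theorem diag_congr {R R' : Finset ι} {a : ι → k} (h : ∀ i, a i ≠ 0 → (i ∈ R ↔ i ∈ R')) :
    diag p R a = diag p R' a := by
  apply der_ext
  intro i
  rw [diag_x, diag_x]
  by_cases hi : a i = 0
  · rw [hi, zero_smul, zero_smul]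
  · rw [z, z]; simp only [h i hi]

theorem smul_euler_sum_eq_diag {R : Finset ι} {s : ι → Prop} [DecidablePred s]
    (hs : ∀ i, s i ↔ i ∈ R) (a : ι → k) : ∑ i, a i • euler k p (s i) i = diag p R a := by
  apply der_ext
  intro j
  rw [der_sum_apply, diag_x]
  simp only [Derivation.smul_apply, euler_x, hs, z]
  simp

theorem mem_torusW {n r : ℕ} (D : W k p (Fin n)) :
    D ∈ torusW k p n r ↔ ∃ a : Fin n → k, (D : Derivation k (A k p (Fin n)) (A k p (Fin n))) =
      diag p (initial n r) a := by
  have h1 : {D | ∃ i : Fin n, D = euler k p (i.val < r) i} =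
      Set.range fun i : Fin n => euler k p (i.val < r) i := by
    ext D; simp [eq_comm]
  rw [torusW, Submodule.mem_comap, h1, Submodule.mem_span_range_iff_exists_fun]
  simp only [smul_euler_sum_eq_diag (fun i => mem_initial.symm)]
  exact exists_congr fun a => eq_comm

variable [IsAlgClosed k]

theorem orbit_inter_indexPart_W (hp3 : 3 ≤ p) (n r : ℕ) (h1 : n = 1 → 5 ≤ p) (hn : 1 ≤ n)
    (hr : r ≤ mu p (W k p (Fin n))) (d : W k p (Fin n))
    (hd : d ∈ indexPart p (W k p (Fin n)) (torusW k p n) r) :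
    MulAction.orbit (autP p (W k p (Fin n))) d ∩ indexPart p (W k p (Fin n)) (torusW k p n) r =
      {t | ∃ w : weylGroup p (W k p (Fin n)) (torusW k p n r),
        t = (w • (⟨d, hd.1⟩ : (torusW k p n r : Set (W k p (Fin n))))).1} := by
  rcases lt_or_ge n r with hnr | hnr
  · refine absurd hd (notMem_indexPart_of_eq hr hnr ?_ d)
    ext D
    have : initial n r = initial n n := by ext i; simp only [mem_initial]; omega
    rw [mem_torusW, mem_torusW, this]
  have hample : IsAmple (W k p (Fin n)) := by
    refine isAmple_W hp3 ?_
    by_cases h : n = 1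
    · exact Or.inr (h1 h)
    · exact Or.inl (Fin.nontrivial_iff_two_le.2 (by omega))
  refine orbit_inter_indexPart_of_moves hr (initial n r) Set.univ hample
    (fun a _ _ => isRich_W _ a) (fun s => by simp [mem_torusW]) ?_ ?_ d hd
  · intro a _ ha
    have hr0 : 0 < r := by
      by_contra h
      exact ha fun α _ i hi => absurd (mem_initial.1 hi) (by omega)
    -- The relation is placed at the last shifted coordinate, so that removing its coefficient lands
    -- in the torus with `r - 1` shifts.
    have hi₁ : (⟨r - 1, by omega⟩ : Fin n) ∈ initial n r := mem_initial.2 (by simp; omega)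
    obtain ⟨N, K, hNK, h0⟩ := exists_invPair_of_not_indep _ ha hi₁
    have hπ : ∀ j, (1 : Equiv.Perm (Fin n)) j ∈ initial n r ↔ j ∈ initial n r := fun j => Iff.rfl
    obtain ⟨σ, hσ1, hσ2⟩ := exists_monomial_aut (k := k) _ hNK hπ 0
    refine ⟨σ, fun _ _ => trivial, r - 1, by omega, fun s hs => (mem_torusW s).2 ?_⟩
    rw [conjDer_diag_of_monomial _ hπ hσ1 hσ2 a] at hs
    refine ⟨_, hs.trans (diag_congr fun i hi => ?_)⟩
    simp only [mem_initial] at hi ⊢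
    refine ⟨fun hir => ?_, fun hir => by omega⟩
    by_contra hir'
    have : i = ⟨r - 1, by omega⟩ := Fin.ext (by simp; omega)
    rw [if_pos hir, this] at hi
    exact hi h0
  · intro a _ b _ ha hb hU hcard
    obtain ⟨N, K, hNK, hN⟩ := exists_invPair_of_range_eq ha hb hU
    obtain ⟨π, hπ, c, hc⟩ := exists_perm_of_card_weight_eq hcard
    obtain ⟨σ, hσ1, hσ2⟩ := exists_monomial_aut (k := k) _ hNK hπ c
    have hconj := conjDer_diag_of_monomial _ hπ hσ1 hσ2
    refine ⟨σ, fun _ _ => trivial, fun a' _ => ⟨_, trivial, hconj a'⟩, ?_⟩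
    rw [hconj]
    congr 1
    ext i
    split_ifs with hi
    · exact hN i hi
    · exact (hc i hi).symm

end Witt

end CartanType

end

open scoped Pointwise

set_option linter.unusedSectionVars false

noncomputable section

namespace CartanType

attribute [local instance] ZMod.algebra

/-! Derived algebras. -/

section Derived

variable {k : Type*} [Field k] {p : ℕ} [hp : Fact p.Prime] [CharP k p] {ι : Type*} [Fintype ι]
  [DecidableEq ι] {L : LieSubalgebra k (Derivation k (A k p ι) (A k p ι))}

theorem mem_derived {j : ℕ} {D : Derivation k (A k p ι) (A k p ι)} :
    D ∈ derived k p L j ↔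
      ∃ h : D ∈ L, (⟨D, h⟩ : L) ∈ LieAlgebra.derivedSeries k L j := by
  constructor
  · rintro ⟨E, hE, rfl⟩
    exact ⟨E.2, hE⟩
  · rintro ⟨h, hD⟩
    exact ⟨⟨D, h⟩, hD, rfl⟩

theorem mem_derived_zero {D : Derivation k (A k p ι) (A k p ι)} :
    D ∈ derived k p L 0 ↔ D ∈ L := by
  rw [mem_derived]
  exact ⟨fun h => h.1, fun h => ⟨h, trivial⟩⟩

theorem lie_mem_derived {j : ℕ} {D E : Derivation k (A k p ι) (A k p ι)}
    (hD : D ∈ derived k p L j) (hE : E ∈ derived k p L j) : ⁅D, E⁆ ∈ derived k p L (j + 1) := by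
  obtain ⟨h1, h1'⟩ := mem_derived.1 hD
  obtain ⟨h2, h2'⟩ := mem_derived.1 hE
  refine mem_derived.2 ⟨L.lie_mem h1 h2, ?_⟩
  rw [LieAlgebra.derivedSeries_def, LieAlgebra.derivedSeriesOfIdeal_succ]
  exact LieSubmodule.lie_mem_lie h1' h2'

theorem conjDer_mem_derived {σ : A k p ι ≃ₐ[k] A k p ι} (h : ∀ D ∈ L, conjDer σ D ∈ L) (j : ℕ) :
    ∀ D ∈ derived k p L j, conjDer σ D ∈ derived k p L j := by
  intro D hD
  obtain ⟨h1, h2⟩ := mem_derived.1 hD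
  let f : L →ₗ⁅k⁆ L :=
    { toFun := fun D => ⟨conjDer σ D, h D D.2⟩
      map_add' := fun D E => Subtype.ext (map_add (conjDer σ) _ _)
      map_smul' := fun c D => Subtype.ext (map_smul (conjDer σ) _ _)
      map_lie' := Subtype.ext (LieHom.map_lie (conjDer σ) _ _) }
  exact mem_derived.2 ⟨h D h1, LieIdeal.derivedSeries_map_le j (LieIdeal.mem_map (f := f) h2)⟩

end Derived

/-! The special algebras. -/

section Special

variable {k : Type*} [Field k] {p : ℕ} [hp : Fact p.Prime] [CharP k p] {ι : Type*} [Fintype ι]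
  [DecidableEq ι] (R : Finset ι)

theorem divergence_smul (f : A k p ι) (D : Derivation k (A k p ι) (A k p ι)) :
    divergence k p (f • D) = f * divergence k p D + D f := by
  rw [divergence, divergence, der_eq_sum k p D f, Finset.mul_sum, ← Finset.sum_add_distrib]
  refine Finset.sum_congr rfl fun i _ => ?_
  rw [Derivation.smul_apply, smul_eq_mul, Derivation.leibniz, smul_eq_mul, smul_eq_mul]

theorem divergence_sum {κ : Type*} (s : Finset κ) (F : κ → Derivation k (A k p ι) (A k p ι)) :
    divergence k p (∑ i ∈ s, F i) = ∑ i ∈ s, divergence k p (F i) := by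
  simp only [divergence, der_sum_apply, map_sum]
  exact Finset.sum_comm

theorem divergence_single (j : ι) (f : A k p ι) : divergence k p (single j f) = pd k p j f := by
  rw [divergence, Finset.sum_eq_single j]
  · rw [single_x, if_pos rfl]
  · intro i _ hi; rw [single_x, if_neg hi, map_zero]
  · simp

theorem mem_S {D : Derivation k (A k p ι) (A k p ι)} : D ∈ S k p ι ↔ divergence k p D = 0 :=
  Iff.rfl

/-- Writing `D` in the basis `∂_i` and conjugating, the divergence becomes `σ⁻¹ (div D)` as soon as
all conjugates of the `∂_i` are divergence-free. -/
theorem conjDer_mem_S {σ : A k p ι ≃ₐ[k] A k p ι}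
    (h : ∀ i, divergence k p (conjDer σ (pd k p i)) = 0) :
    ∀ D ∈ S k p ι, conjDer σ D ∈ S k p ι := by
  intro D hD
  have h1 : conjDer σ D = ∑ i, σ.symm (D (x k p i)) • conjDer σ (pd k p i) := by
    ext f
    rw [conjDer_apply, der_eq_sum, map_sum, der_sum_apply]
    refine Finset.sum_congr rfl fun i _ => ?_
    rw [map_mul, Derivation.smul_apply, conjDer_apply, smul_eq_mul]
  rw [mem_S, h1, divergence_sum]
  simp only [divergence_smul, h, mul_zero, zero_add, conjDer_apply, σ.apply_symm_apply]
  rw [← map_sum]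
  rw [mem_S, divergence] at hD
  rw [hD, map_zero]

theorem divergence_diag (a : ι → k) :
    divergence k p (diag p R a) = algebraMap k _ (∑ i, a i) := by
  rw [divergence, map_sum]
  refine Finset.sum_congr rfl fun i _ => ?_
  rw [diag_x, Derivation.map_smul, der_z, pd_x, if_pos rfl, Algebra.algebraMap_eq_smul_one]

theorem pd_mon_of_notMem {j : ι} (hj : j ∉ R) (α : ι → ZMod p) : pd k p j (mon k R α) = 0 := by
  rw [der_mon R (a := 0), wt_apply]
  · simp
  · intro i hi
    rw [der_z, pd_x, if_neg (ne_of_mem_of_not_mem hi hj)]; simp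

theorem pd_mon_of_mem {i : ι} (hi : i ∈ R) (α : ι → ZMod p) :
    pd k p i (mon k R α) = (α i • (1 : k)) • mon k R (α - Pi.single i 1) := by
  have h1 : (z k p R i • pd k p i : Derivation k (A k p ι) (A k p ι)) (mon k R α) =
      wt R (Pi.single i (1 : k)) α • mon k R α := by
    refine der_mon R (fun l hl => ?_) α
    rw [Derivation.smul_apply, der_z, pd_x]
    split_ifs with h
    · subst h; simp
    · simp [h]
  have h2 : wt R (Pi.single i (1 : k)) α = α i • (1 : k) := by
    rw [wt_apply, Finset.sum_eq_single_of_mem i hi]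
    · simp
    · intro j _ hj; simp [hj]
  rw [Derivation.smul_apply, h2, smul_eq_mul] at h1
  have h3 := mon_mul_neg (k := k) R (Pi.single i (1 : ZMod p))
  rw [mon_single R hi] at h3
  have h4 := congrArg (fun f => f * mon k R (-Pi.single i (1 : ZMod p))) h1
  rw [mul_right_comm, h3, one_mul, smul_mul_assoc, ← mon_add, ← sub_eq_add_neg] at h4
  exact h4

/-- The column sums in `hsum` make conjugation preserve the divergence of each `z_i ∂_i` with `i ∈
R`. For `i ∉ R` the conjugate of `∂_i` is a monomial in the units times some `∂_l`, `l ∉ R`. -/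
theorem conjDer_mem_S_of_monomial {σ : A k p ι ≃ₐ[k] A k p ι} {N K : ι → ι → ZMod p}
    (hNK : IsInvPair R N K) {π : Equiv.Perm ι} {c : ι → ι → ZMod p} (hπ : ∀ j, π j ∈ R ↔ j ∈ R)
    (h1 : ∀ i ∈ R, σ (z k p R i) = mon k R (N i))
    (h2 : ∀ j ∉ R, σ (x k p j) = x k p (π j) * mon k R (c j))
    (hsum : ∀ l ∈ R, ∑ i, (if i ∈ R then N i l else c i l) = 1) :
    ∀ D ∈ S k p ι, conjDer σ D ∈ S k p ι := by
  refine conjDer_mem_S fun i => ?_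
  by_cases hi : i ∈ R
  · have h3 : diag p R (Pi.single i (1 : k)) = z k p R i • pd k p i := by
      apply der_ext; intro l
      rw [diag_x, Derivation.smul_apply, pd_x]
      split_ifs with h
      · subst h; simp
      · simp [h]
    -- The divergence of the conjugate of `z_i ∂_i` is computed twice: as a coefficient sum, which
    -- is one, and by the product rule as a unit times the unknown divergence plus one.
    have h4 := congrArg (fun D => divergence k p (conjDer σ D)) h3
    have h5 : conjDer σ (z k p R i • pd k p i) =
        σ.symm (z k p R i) • conjDer σ (pd k p i) := by
      ext f; simp
    have h6 : ∀ α : ι → ZMod p, wt R (Pi.single i (1 : k)) α = algebraMap (ZMod p) k (α i) := by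
      intro α
      rw [wt_apply, Finset.sum_eq_single_of_mem i hi]
      · simp [Algebra.algebraMap_eq_smul_one]
      · intro j _ hj; simp [hj]
    rw [conjDer_diag_of_monomial R hπ h1 h2, divergence_diag, h5, divergence_smul, conjDer_apply,
      σ.apply_symm_apply, der_z, pd_x, if_pos rfl, map_one] at h4
    have h7 : (∑ l, if l ∈ R then wt R (Pi.single i (1 : k)) (N l) else
        (Pi.single i (1 : k) : ι → k) (π l) + wt R (Pi.single i (1 : k)) (c l)) = 1 := by
      have h8 := congrArg (algebraMap (ZMod p) k) (hsum i hi)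
      rw [map_one, map_sum] at h8
      refine Eq.trans ?_ h8
      refine Finset.sum_congr rfl fun l _ => ?_
      split_ifs with hl
      · rw [h6]
      · rw [h6, Pi.single_eq_of_ne, zero_add]
        intro h; exact hl ((hπ l).1 (h ▸ hi))
    rw [h7, map_one] at h4
    have h8 : IsUnit (σ.symm (z k p R i)) := by
      refine IsUnit.map σ.symm (IsUnit.of_pow_eq_one (z_pow R hi) hp.out.ne_zero)
    exact (h8.mul_right_eq_zero).1 (by simpa using h4.symm)
  · set l := π.symm i with hl
    have hli : π l = i := π.apply_symm_apply i
    have hlR : l ∉ R := by rwa [← hπ, hli]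
    obtain ⟨γ, hγ⟩ : ∃ γ, σ (mon k R γ) = mon k R (c l) := by
      -- `K` inverts the action of `σ` on exponents.
      refine ⟨∑ m ∈ R, c l m • K m, ?_⟩
      rw [map_mon R σ h1]
      refine mon_congr R fun m hm => ?_
      simp only [Finset.sum_apply, Pi.smul_apply, smul_eq_mul, Finset.sum_mul]
      rw [Finset.sum_comm]
      have : ∀ y ∈ R, ∑ x ∈ R, c l y * K y x * N x m = c l y * if y = m then 1 else 0 := by
        intro y hy
        rw [← hNK.1 y hy m hm, Finset.mul_sum]
        exact Finset.sum_congr rfl fun i _ => by ring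
      rw [Finset.sum_congr rfl this]
      simp [hm]
    have h3 : conjDer σ (pd k p i) = single l (mon k R γ) := by
      apply der_ext
      intro m
      rw [single_x, conjDer_apply]
      by_cases hm : m ∈ R
      · have : pd k p i (σ (x k p m)) = 0 := by
          rw [x_eq R m, if_pos hm, map_sub, h1 m hm, map_one, map_sub, pd_mon_of_notMem R hi]
          simp
        rw [this, map_zero, if_neg (ne_of_mem_of_not_mem hm hlR)]
      · rw [h2 m hm, Derivation.leibniz, pd_mon_of_notMem R hi, pd_x, smul_zero, zero_add]
        by_cases hml : m = l
        · rw [if_pos hml, if_pos (by rw [hml, hli]), hml, ← hγ]; simp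
        · rw [if_neg hml, if_neg (fun h => hml (π.injective (h.trans hli.symm)))]; simp
    rw [h3, divergence_single, pd_mon_of_notMem R hlR]

/-! ### Elements of the derived special algebra. -/

theorem pd_mem_S (l : ι) : single l (1 : A k p ι) ∈ S k p ι := by
  rw [mem_S, divergence_single]; simp

theorem lie_single_one (l : ι) (y : ι → A k p ι) :
    ⁅single l (1 : A k p ι), derOf y⁆ = derOf fun i => pd k p l (y i) := by
  have h : ∀ f, single l (1 : A k p ι) f = pd k p l f := by
    intro f
    rw [derOf_apply, Finset.sum_eq_single l]
    · simp
    · intro i _ hi; simp [hi]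
    · simp
  apply der_ext
  intro i
  rw [lie_eval, h, h, derOf_x, pd_x, derOf_x]
  split_ifs <;> simp

/-- The divergence-free derivation `∂_j(f) ∂_i - ∂_i(f) ∂_j`. -/
def dij (i j : ι) (f : A k p ι) : Derivation k (A k p ι) (A k p ι) :=
  derOf (Pi.single i (pd k p j f) - Pi.single j (pd k p i f))

theorem dij_x (i j l : ι) (f : A k p ι) : dij i j f (x k p l) =
    (if l = i then pd k p j f else 0) - if l = j then pd k p i f else 0 := by
  rw [dij, derOf_x, Pi.sub_apply, Pi.single_apply, Pi.single_apply]

theorem dij_mem_S (i j : ι) (f : A k p ι) : dij i j f ∈ S k p ι := by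
  rw [mem_S, divergence]
  simp only [dij_x, map_sub, Finset.sum_sub_distrib]
  rw [Finset.sum_eq_single i, Finset.sum_eq_single j, if_pos rfl, if_pos rfl, pd_comm, sub_self]
  · intro b _ hb; simp [hb]
  · simp
  · intro b _ hb; simp [hb]
  · simp

/-- Bracketing with `∂_l` differentiates the potential, so potentials that are themselves partial
derivatives give elements of the derived algebra. -/
theorem dij_pd_mem (i j l : ι) (f : A k p ι) :
    dij i j (pd k p l f) ∈ derived k p (S k p ι) 1 := by
  have h : dij i j (pd k p l f) = ⁅single l (1 : A k p ι), dij i j f⁆ := by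
    rw [dij, dij, lie_single_one]
    congr 1
    ext m
    simp only [Pi.sub_apply, Pi.single_apply, map_sub]
    rw [pd_comm k p j l, pd_comm k p i l]
    split_ifs <;> simp
  rw [h]
  exact lie_mem_derived (mem_derived_zero.2 (pd_mem_S l)) (mem_derived_zero.2 (dij_mem_S i j f))

theorem single_pd_mem {j l : ι} {f : A k p ι} (h : pd k p j f = 0) :
    single j (pd k p l f) ∈ derived k p (S k p ι) 1 := by
  have h1 : single j (pd k p l f) = ⁅single l (1 : A k p ι), single j f⁆ := by
    rw [lie_single_one]
    apply der_ext
    intro m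
    rw [single_x, derOf_x, Pi.single_apply]
    split_ifs <;> simp
  rw [h1]
  exact lie_mem_derived (mem_derived_zero.2 (pd_mem_S l))
    (mem_derived_zero.2 (by rw [mem_S, divergence_single, h]))

theorem single_x_mem {i j l : ι} (hij : i ≠ j) (hli : l ≠ i) (hlj : l ≠ j) :
    single j (x k p i) ∈ derived k p (S k p ι) 1 := by
  have h : pd k p l (x k p i * x k p l) = x k p i := by
    rw [Derivation.leibniz, pd_x, pd_x, if_pos rfl, if_neg hli.symm]; simp
  rw [← h]
  refine single_pd_mem ?_
  rw [Derivation.leibniz, pd_x, pd_x, if_neg hij, if_neg hlj]; simp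

theorem exists_two_ne (h3 : 3 ≤ Fintype.card ι) (i j : ι) : ∃ l, l ≠ i ∧ l ≠ j := by
  by_contra! h
  have : (Finset.univ : Finset ι) ⊆ {i, j} := fun l _ => by
    by_cases hl : l = i
    · simp [hl]
    · simp [h l hl]
  have := (Finset.card_le_card this).trans Finset.card_le_two
  rw [Finset.card_univ] at this
  omega

/-- The cubic element is `x_i² x_j ∂_j - x_i² x_l ∂_l` with `i, j, l` distinct; the second term
corrects the divergence and does not affect the eigenvector `e_j`. -/
theorem isAmple_S (hp3 : 3 ≤ p) (h3 : 3 ≤ Fintype.card ι) :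
    IsAmple (derived k p (S k p ι) 1) where
  exists_ev v := by
    refine ⟨∑ i, v i • single i (1 : A k p ι), sum_mem fun i _ => ?_, ?_⟩
    · refine (derived k p (S k p ι) 1).smul_mem _ ?_
      obtain ⟨l, hl, -⟩ := exists_two_ne h3 i i
      have h : pd k p l (x k p l) = 1 := by rw [pd_x, if_pos rfl]
      rw [← h]
      exact single_pd_mem (by rw [pd_x, if_neg hl])
    · ext i
      rw [ev_apply, der_sum_apply]
      simp [Derivation.smul_apply, Pi.single_apply]
  exists_linear u j₀ hu := by
    obtain ⟨i, hi⟩ := Function.ne_iff.1 hu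
    have hi : u i ≠ 0 := hi
    by_cases hij : i = j₀
    · subst hij
      obtain ⟨l, hli, -⟩ := exists_two_ne h3 i i
      obtain ⟨m, hmi, hml⟩ := exists_two_ne h3 i l
      have hpd : pd k p m (x k p i * x k p l * x k p m) = x k p i * x k p l := by
        simp [Derivation.leibniz, pd_x, hmi.symm, hml.symm]
      have hx : ∀ j, ((u i)⁻¹ • dij i l (x k p i * x k p l) +
          ((u i)⁻¹ * (u i)⁻¹ * u l) • single l (x k p i)) (x k p j) =
          if j = i then (u i)⁻¹ • x k p i else if j = l then
            (-(u i)⁻¹) • x k p l + ((u i)⁻¹ * (u i)⁻¹ * u l) • x k p i else 0 := by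
        intro j
        rw [Derivation.add_apply, Derivation.smul_apply, Derivation.smul_apply, dij_x, single_x]
        by_cases hji : j = i
        · subst hji
          simp [Derivation.leibniz, pd_x, hli.symm]
        · by_cases hjl : j = l
          · subst hjl
            simp [Derivation.leibniz, pd_x, hli]
          · simp [hji, hjl]
      -- The diagonal field `x_i ∂_i` must be balanced by `-x_l ∂_l`; the multiple of `x_i ∂_l`
      -- cancels the resulting `l`-th component along `u`.
      refine ⟨(u i)⁻¹ • dij i l (x k p i * x k p l) +
        ((u i)⁻¹ * (u i)⁻¹ * u l) • single l (x k p i), add_mem ?_ ?_, ?_, fun E s hE j => ?_⟩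
      · refine (derived k p (S k p ι) 1).smul_mem _ ?_
        rw [← hpd]
        exact dij_pd_mem _ _ _ _
      · exact (derived k p (S k p ι) 1).smul_mem _ (single_x_mem hli.symm hmi hml)
      · rw [mem_fil_one]
        ext j
        rw [ev_apply, hx]
        split_ifs <;> simp
      · have hE' : ∀ j, aug k p ι (E (x k p j)) = s * u j := fun j => congrFun hE j
        rw [hx]
        split_ifs
        · rw [Derivation.map_smul, map_smul, hE', smul_eq_mul, mul_comm s, inv_mul_cancel_left₀ hi]
        · rw [map_add, Derivation.map_smul, Derivation.map_smul, map_add, map_smul, map_smul, hE',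
            hE', smul_eq_mul, smul_eq_mul]
          field_simp
          ring
        · simp
    · obtain ⟨l, hl1, hl2⟩ := exists_two_ne h3 i j₀
      refine ⟨(u i)⁻¹ • single j₀ (x k p i), (derived k p (S k p ι) 1).smul_mem _
        (single_x_mem hij hl1 hl2), ?_, fun E s hE j => ?_⟩
      · rw [mem_fil_one]; ext l
        rw [ev_apply, Derivation.smul_apply, single_x]; split_ifs <;> simp
      · have hEi : ev ι E i = s * u i := congrFun hE i
        rw [Derivation.smul_apply, single_x]
        split_ifs
        · rw [Derivation.map_smul, map_smul, ← ev_apply, hEi, smul_eq_mul, mul_comm s,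
            inv_mul_cancel_left₀ hi]
        · simp
  exists_cubic v hv := by
    obtain ⟨i, hi⟩ := Function.ne_iff.1 hv
    have hi : v i ≠ 0 := hi
    have h2 := two_ne_zero_of_three_le (k := k) hp3
    obtain ⟨j, hji, -⟩ := exists_two_ne h3 i i
    obtain ⟨l, hli, hlj⟩ := exists_two_ne h3 i j
    -- An antiderivative of the potential puts the field in the derived algebra; here `p ≠ 2` is
    -- used.
    have hpd : pd k p j ((2 : k)⁻¹ • (x k p i * x k p i * x k p j * x k p j * x k p l)) =
        x k p i * x k p i * x k p j * x k p l := by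
      have h1 : pd k p j (x k p i * x k p i * x k p j * x k p j * x k p l) =
          (2 : k) • (x k p i * x k p i * x k p j * x k p l) := by
        simp [Derivation.leibniz, pd_x, hji.symm, hlj, two_smul]
        ring
      rw [Derivation.map_smul, h1, inv_smul_smul₀ h2]
    have hx : ∀ m, dij j l (x k p i * x k p i * x k p j * x k p l) (x k p m) =
        (if m = j then x k p i * x k p i * x k p j else 0) -
          if m = l then x k p i * x k p i * x k p l else 0 := by
      intro m
      rw [dij_x]
      congr 2
      · simp [Derivation.leibniz, pd_x, hli.symm, hlj.symm]
      · simp [Derivation.leibniz, pd_x, hji.symm, hlj]; ring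
    refine ⟨dij j l (x k p i * x k p i * x k p j * x k p l), ?_, mem_fil_iff.2 fun m => ?_,
      Pi.single j 1, 2 * v i * v i, ?_, mul_ne_zero (mul_ne_zero h2 hi) hi,
      fun X Y E s hX hY hE m => ?_⟩
    · rw [← hpd]; exact dij_pd_mem _ _ _ _
    · rw [hx]
      refine sub_mem ?_ ?_
      · split_ifs
        · exact cubic_mem _ _ _
        · exact zero_mem _
      · split_ifs
        · exact cubic_mem _ _ _
        · exact zero_mem _
    · exact fun h => one_ne_zero (α := k) (by simpa using congrFun h j)
    · rw [hx]
      by_cases hmj : m = j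
      · subst hmj
        rw [if_pos rfl, if_neg hlj.symm, sub_zero, aug_der_three, hX, hY, hE]
        simp [hji.symm]; ring
      · by_cases hml : m = l
        · subst hml
          rw [if_pos rfl, if_neg hmj, zero_sub, map_neg, map_neg, map_neg, map_neg, aug_der_three,
            hX, hY, hE]
          simp [hji.symm, hmj]
        · simp [hmj, hml]

/-- The unshifted coordinate `n₀` absorbs divergence: `z^β ∂_i` is corrected by a multiple of
`x_{n₀} ∂_{n₀}`, whose coefficient lies in `idealJ`. -/
theorem isRich_S (hp3 : 3 ≤ p) (h3 : 3 ≤ Fintype.card ι) {n₀ : ι} (hn₀ : n₀ ∉ R) (a : ι → k)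
    (ha : ∑ i, a i = 0) : IsRich (derived k p (S k p ι) 1) R a where
  linear_mem := by
    rintro - j -
    obtain ⟨l, hlj, -⟩ := exists_two_ne h3 j j
    obtain ⟨m, hmj, hml⟩ := exists_two_ne h3 j l
    refine ⟨l, hlj, ?_⟩
    have := single_x_mem (k := k) (p := p) hlj.symm hmj hml
    convert this using 2
    ext i; rw [Pi.single_apply]
  exists_unit i hi α := by
    have h2 := two_ne_zero_of_three_le (k := k) hp3
    have hin : i ≠ n₀ := ne_of_mem_of_not_mem hi hn₀
    set β := α + Pi.single i 1
    have hβ : mon k R β = mon k R α * z k p R i := by rw [mon_add, mon_single R hi]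
    have hpd : pd k p n₀ ((2 : k)⁻¹ • (mon k R β * x k p n₀ * x k p n₀)) =
        mon k R β * x k p n₀ := by
      have h1 : pd k p n₀ (mon k R β * x k p n₀ * x k p n₀) = (2 : k) • (mon k R β * x k p n₀) := by
        simp [Derivation.leibniz, pd_x, pd_mon_of_notMem R hn₀, two_smul]
        ring
      rw [Derivation.map_smul, h1, inv_smul_smul₀ h2]
    have hx : ∀ m, dij i n₀ (mon k R β * x k p n₀) (x k p m) = (if m = i then mon k R β else 0) -
        if m = n₀ then x k p n₀ * (β i • (1 : k)) • mon k R α else 0 := by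
      intro m
      rw [dij_x]
      congr 2
      · simp [Derivation.leibniz, pd_x, pd_mon_of_notMem R hn₀]
      · rw [Derivation.leibniz, pd_x, if_neg hin.symm, pd_mon_of_mem R hi]
        simp [β]
    refine ⟨dij i n₀ (mon k R β * x k p n₀), ?_, ?_, ?_, fun j hj => ?_⟩
    · rw [← hpd]; exact dij_pd_mem _ _ _ _
    · rw [lie_diag_iff]
      intro m
      rw [hx]
      by_cases hmi : m = i
      · subst hmi
        rw [if_pos rfl, if_neg hin, sub_zero, diag_mon, map_add, wt_single R a hi]
      · by_cases hmn : m = n₀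
        · subst hmn
          rw [if_neg hmi, if_pos rfl, zero_sub, map_neg, Derivation.leibniz, Derivation.map_smul,
            diag_mon, diag_x, z_of_notMem hn₀, smul_neg]
          simp only [smul_eq_mul, mul_smul_comm, smul_mul_assoc]
          rw [mul_comm (mon k R α)]
          module
        · simp [hmi, hmn]
    · rw [hx, if_pos rfl, if_neg hin, sub_zero, aug_mon]
      exact one_ne_zero
    · rw [hx, if_neg (ne_of_mem_of_not_mem hi hj).symm, zero_sub, neg_mem_iff]
      split_ifs
      · exact Ideal.mul_mem_right _ _ (x_mem_idealJ hn₀)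
      · exact zero_mem _
  exists_value v hv j hj := by
    rintro ⟨α, hα⟩
    -- A second unshifted coordinate is needed to integrate `z^α`. If `j` were the only one, the
    -- zero coefficient sum would put `a_j`, hence `v`, in the span of monomial weights.
    have hl : ∃ l ∉ R, l ≠ j := by
      by_contra! h
      refine hv ⟨α + 1, ?_⟩
      have h1 : wt (p := p) R a 1 = -a j := by
        rw [eq_neg_iff_add_eq_zero, ← ha, wt_apply]
        have : (Finset.univ : Finset ι) = insert j R := by
          ext l
          by_cases hlR : l ∈ R
          · simp [hlR]
          · simp [h l hlR]
        rw [this, Finset.sum_insert hj, add_comm]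
        simp
      rw [map_add, hα, h1]; ring
    obtain ⟨l, hlR, hlj⟩ := hl
    have hpd : pd k p l (mon k R α * x k p l) = mon k R α := by
      simp [Derivation.leibniz, pd_x, pd_mon_of_notMem R hlR]
    refine ⟨single j (mon k R α), ?_, ?_, ?_⟩
    · rw [← hpd]
      refine single_pd_mem ?_
      rw [Derivation.leibniz, pd_x, if_neg hlj, pd_mon_of_notMem R hj]; simp
    · rw [lie_diag_iff]
      intro l
      rw [single_x]
      split_ifs with h
      · subst h; rw [diag_mon, hα]
      · simp
    · ext l
      rw [ev_apply, single_x, Pi.single_apply]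
      split_ifs <;> simp [aug_mon]

/-! ### The standard torus of the special algebra and its orbits. -/

theorem euler_sub_eq_diag (i n₀ : ι) (h : n₀ ∉ R) {s : Prop} [Decidable s] (hs : s ↔ i ∈ R) :
    euler k p s i - euler k p False n₀ =
      diag p R (Pi.single i (1 : k) - Pi.single n₀ (1 : k)) := by
  apply der_ext
  intro j
  rw [Derivation.sub_apply, euler_x, euler_x, diag_x, Pi.sub_apply, sub_smul, Pi.single_apply,
    Pi.single_apply]
  congr 1
  · split_ifs with h1 h2
    · rw [h1, z_of_mem (hs.1 h2), one_smul]
    · rw [h1, z_of_notMem (fun h => h2 (hs.2 h)), one_smul]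
    · simp
  · by_cases h1 : j = n₀
    · rw [if_pos h1, if_neg not_false, if_pos h1, h1, z_of_notMem h, one_smul]
    · rw [if_neg h1, if_neg h1, zero_smul]

variable (p) in
/-- The diagonal derivation as a linear function of its coefficients. -/
def diagLin : (ι → k) →ₗ[k] Derivation k (A k p ι) (A k p ι) where
  toFun := diag p R
  map_add' a b := der_ext _ _ fun i => by simp [add_smul]
  map_smul' c a := der_ext _ _ fun i => by simp [mul_smul]

theorem diagLin_apply (a : ι → k) : diagLin p R a = diag p R a := rfl

theorem sum_eq_wt_one_add (a : ι → k) :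
    ∑ i, a i = wt R a (1 : ι → ZMod p) + ∑ j, if j ∈ R then 0 else a j := by
  have h : wt R a (1 : ι → ZMod p) = ∑ i, if i ∈ R then a i else 0 := by
    rw [wt_apply]; simp
  rw [h, ← Finset.sum_add_distrib]
  refine Finset.sum_congr rfl fun i _ => ?_
  split_ifs <;> simp

/-- The sum of the transformed coefficients depends on the exponents only through their column sums;
when these are one it agrees with the original sum. -/
theorem sum_monomial_coeff {N c : ι → ι → ZMod p} {π : Equiv.Perm ι} (hπ : ∀ j, π j ∈ R ↔ j ∈ R)
    (a : ι → k) : ∑ i, (if i ∈ R then wt R a (N i) else a (π i) + wt R a (c i)) =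
      wt R a (fun l => ∑ i, if i ∈ R then N i l else c i l) + ∑ j, if j ∈ R then 0 else a j := by
  have h1 : (fun l => ∑ i, if i ∈ R then N i l else c i l) =
      ∑ i, if i ∈ R then N i else c i := by
    ext l
    rw [Finset.sum_apply]
    refine Finset.sum_congr rfl fun i _ => ?_
    split_ifs <;> rfl
  rw [h1, map_sum, ← Equiv.sum_comp π (fun j => if j ∈ R then 0 else a j),
    ← Finset.sum_add_distrib]
  refine Finset.sum_congr rfl fun i _ => ?_
  simp only [hπ]
  split_ifs
  · rw [add_zero]
  · rw [add_comm]

theorem wt_congr (a : ι → k) {α β : ι → ZMod p} (h : ∀ i ∈ R, α i = β i) :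
    wt R a α = wt R a β := by
  rw [wt_apply, wt_apply]
  exact Finset.sum_congr rfl fun i hi => by rw [h i hi]

theorem torusS_generators {n r : ℕ} {n₀ : Fin n} (hn : n₀.val + 1 = n) (hn₀ : n₀ ∉ initial n r) :
    {D | ∃ i l : Fin n, i < l ∧ l.val + 1 = n ∧
      D = euler k p (i.val < r) i - euler k p False l} =
    {D | ∃ i, i ≠ n₀ ∧ D = diag p (initial n r) (Pi.single i (1 : k) - Pi.single n₀ 1)} := by
  ext D
  constructor
  · rintro ⟨i, l, hil, hl, rfl⟩
    obtain rfl : l = n₀ := Fin.ext (by omega)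
    exact ⟨i, hil.ne, euler_sub_eq_diag _ i l hn₀ mem_initial.symm⟩
  · rintro ⟨i, hi, rfl⟩
    refine ⟨i, n₀, ?_, hn, (euler_sub_eq_diag _ i n₀ hn₀ mem_initial.symm).symm⟩
    have : i.val ≠ n₀.val := fun h => hi (Fin.ext h)
    rw [Fin.lt_def]
    omega

theorem mem_torusS {n r : ℕ} (hn : 0 < n) (hr : r ≤ n - 1) (D : derived k p (S k p (Fin n)) 1) :
    D ∈ torusS k p n r ↔ ∃ a ∈ {a : Fin n → k | ∑ i, a i = 0},
      (D : Derivation k (A k p (Fin n)) (A k p (Fin n))) = diag p (initial n r) a := by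
  obtain ⟨n₀, hn⟩ : ∃ n₀ : Fin n, n₀.val + 1 = n := ⟨⟨n - 1, by omega⟩, by simp only; omega⟩
  have hn₀ : n₀ ∉ initial n r := by rw [mem_initial]; omega
  have hgen := torusS_generators (k := k) (p := p) hn hn₀
  rw [torusS, Submodule.mem_comap, hgen]
  constructor
  · intro h
    change (D : Derivation k (A k p (Fin n)) (A k p (Fin n))) ∈ _ at h
    generalize (D : Derivation k (A k p (Fin n)) (A k p (Fin n))) = E at h ⊢
    induction h using Submodule.span_induction with
    | mem D h =>
      obtain ⟨i, hi, rfl⟩ := h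
      exact ⟨_, by simp, rfl⟩
    | zero => exact ⟨0, by simp, (map_zero (diagLin p _)).symm⟩
    | add D E _ _ hD hE =>
      obtain ⟨a, ha, rfl⟩ := hD
      obtain ⟨b, hb, rfl⟩ := hE
      refine ⟨a + b, ?_, (map_add (diagLin p _) a b).symm⟩
      rw [Set.mem_ofPred_eq] at ha hb ⊢
      simp [Finset.sum_add_distrib, ha, hb]
    | smul c D _ hD =>
      obtain ⟨a, ha, rfl⟩ := hD
      refine ⟨c • a, ?_, (map_smul (diagLin p _) c a).symm⟩
      rw [Set.mem_ofPred_eq] at ha ⊢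
      simp [← Finset.mul_sum, ha]
  · rintro ⟨a, ha, hD⟩
    have h1 : a = ∑ i, a i • (Pi.single i (1 : k) - Pi.single n₀ 1) := by
      simp only [smul_sub, Finset.sum_sub_distrib, ← Finset.sum_smul]
      rw [show ∑ i, a i = 0 from ha, zero_smul, sub_zero]
      ext j
      simp [Pi.single_apply]
    change (D : Derivation k (A k p (Fin n)) (A k p (Fin n))) ∈ _
    rw [hD, h1, ← diagLin_apply]
    rw [map_sum]
    refine sum_mem fun i _ => ?_
    rw [map_smul]
    by_cases hi : i = n₀
    · rw [hi, sub_self, map_zero, smul_zero]; exact zero_mem _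
    · exact Submodule.smul_mem _ _ (Submodule.subset_span ⟨i, hi, rfl⟩)

theorem euler_congr {s t : Prop} [Decidable s] [Decidable t] (h : s ↔ t) (i : ι) :
    euler k p s i = euler k p t i := by
  apply der_ext; intro j
  simp only [euler_x, h]

theorem torusS_eq {n r : ℕ} (hr : n - 1 < r) : torusS k p n r = torusS k p n (n - 1) := by
  unfold torusS
  congr 2
  ext D
  refine exists_congr fun i => exists_congr fun l => and_congr_right fun hil =>
    and_congr_right fun hl => ?_
  rw [Fin.lt_def] at hil
  rw [euler_congr (s := i.val < r) (t := i.val < n - 1) (by omega)]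

variable [IsAlgClosed k]

theorem orbit_inter_indexPart_S (hp3 : 3 ≤ p) (n r : ℕ) (hn : 3 ≤ n)
    (hr : r ≤ mu p (derived k p (S k p (Fin n)) 1)) (d : derived k p (S k p (Fin n)) 1)
    (hd : d ∈ indexPart p (derived k p (S k p (Fin n)) 1) (torusS k p n) r) :
    MulAction.orbit (autP p (derived k p (S k p (Fin n)) 1)) d ∩
        indexPart p (derived k p (S k p (Fin n)) 1) (torusS k p n) r =
      {t | ∃ w : weylGroup p (derived k p (S k p (Fin n)) 1) (torusS k p n r),
        t = (w • (⟨d, hd.1⟩ :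
          (torusS k p n r : Set (derived k p (S k p (Fin n)) 1)))).1} := by
  rcases lt_or_ge (n - 1) r with hnr | hnr
  · exact absurd hd (notMem_indexPart_of_eq hr hnr (torusS_eq hnr) d)
  have h3 : 3 ≤ Fintype.card (Fin n) := by rwa [Fintype.card_fin]
  set n₀ : Fin n := ⟨n - 1, by omega⟩
  have hn₀ : n₀ ∉ initial n r := by rw [mem_initial]; simp only [n₀]; omega
  have hzero : ∀ {N : Fin n → Fin n → ZMod p} {π : Equiv.Perm (Fin n)} {c : Fin n → Fin n → ZMod p},
      (∀ j, π j ∈ initial n r ↔ j ∈ initial n r) →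
      (∀ l ∈ initial n r, ∑ i, (if i ∈ initial n r then N i l else c i l) = 1) →
      ∀ a : Fin n → k, ∑ i, (if i ∈ initial n r then wt (initial n r) a (N i) else
        a (π i) + wt (initial n r) a (c i)) = ∑ i, a i := by
    intro N π c hπ hs a
    rw [sum_monomial_coeff _ hπ, sum_eq_wt_one_add (p := p) (initial n r) a, wt_congr _ a hs]
    rfl
  refine orbit_inter_indexPart_of_moves hr (initial n r) {a | ∑ i, a i = 0} (isAmple_S hp3 h3)
    (fun a ha _ => isRich_S _ hp3 h3 hn₀ a ha) (fun s => mem_torusS (by omega) hnr s) ?_ ?_ d hd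
  · intro a ha0 ha
    have hr0 : 0 < r := by
      by_contra h
      exact ha fun α _ i hi => absurd (mem_initial.1 hi) (by omega)
    have hi₁ : (⟨r - 1, by omega⟩ : Fin n) ∈ initial n r := mem_initial.2 (by simp; omega)
    obtain ⟨N, K, hNK, h0⟩ := exists_invPair_of_not_indep _ ha hi₁
    have hπ : ∀ j, (1 : Equiv.Perm (Fin n)) j ∈ initial n r ↔ j ∈ initial n r := fun j => Iff.rfl
    -- The shift of `x_{n₀}` is free here; it is chosen to make all column sums equal to one.
    set c : Fin n → Fin n → ZMod p :=
      Pi.single n₀ fun l => 1 - ∑ i ∈ initial n r, N i l with hc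
    have hsum : ∀ l ∈ initial n r, ∑ i, (if i ∈ initial n r then N i l else c i l) = 1 := by
      intro l _
      have h1 : ∑ i ∈ Finset.univ.filter (· ∉ initial n r), c i l =
          1 - ∑ i ∈ initial n r, N i l := by
        rw [Finset.sum_eq_single_of_mem n₀ (by simpa using hn₀)]
        · simp [hc]
        · intro i _ hi; simp [hc, hi]
      rw [Finset.sum_ite, h1, Finset.filter_univ_mem, add_sub_cancel]
    obtain ⟨σ, hσ1, hσ2⟩ := exists_monomial_aut (k := k) _ hNK hπ c
    refine ⟨σ, conjDer_mem_derived (conjDer_mem_S_of_monomial _ hNK hπ hσ1 hσ2 hsum) 1, r - 1,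
      by omega, fun s hs => (mem_torusS (by omega) (by omega) s).2 ?_⟩
    rw [conjDer_diag_of_monomial _ hπ hσ1 hσ2 a] at hs
    refine ⟨_, (hzero hπ hsum a).trans ha0, hs.trans (diag_congr fun i hi => ?_)⟩
    simp only [mem_initial] at hi ⊢
    refine ⟨fun hir => ?_, fun hir => by omega⟩
    by_contra hir'
    have : i = ⟨r - 1, by omega⟩ := Fin.ext (by simp; omega)
    rw [if_pos hir, this] at hi
    exact hi h0
  · intro a ha0 b hb0 ha hb hU hcard
    obtain ⟨N, K, hNK, hN⟩ := exists_invPair_of_range_eq ha hb hU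
    obtain ⟨π, hπ, c, hc⟩ := exists_perm_of_card_weight_eq hcard
    obtain ⟨σ, hσ1, hσ2⟩ := exists_monomial_aut (k := k) _ hNK hπ c
    have hconj := conjDer_diag_of_monomial _ hπ hσ1 hσ2
    have hab : (fun i => if i ∈ initial n r then wt (initial n r) a (N i) else
        a (π i) + wt (initial n r) a (c i)) = b := by
      ext i
      split_ifs with hi
      · exact hN i hi
      · exact (hc i hi).symm
    -- Here there is no freedom, but the coefficient sums of `a` and `b` both vanish, so
    -- independence of `a` forces the column sums to be one.
    have hsum : ∀ l ∈ initial n r, ∑ i, (if i ∈ initial n r then N i l else c i l) = 1 := by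
      refine ha.eq_of_wt_eq (β := 1) ?_
      have h1 := sum_monomial_coeff (initial n r) hπ (N := N) (c := c) a
      rw [congrArg (fun f : Fin n → k => ∑ i, f i) hab] at h1
      exact add_right_cancel ((h1.symm.trans (Eq.trans hb0 ha0.symm)).trans (sum_eq_wt_one_add (p := p) (initial n r) a))
    refine ⟨σ, conjDer_mem_derived (conjDer_mem_S_of_monomial _ hNK hπ hσ1 hσ2 hsum) 1,
      fun a' ha' => ⟨_, (hzero hπ hsum a').trans ha', hconj a'⟩, ?_⟩
    rw [hconj, hab]

end Special

end CartanType

end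

open scoped Pointwise

set_option linter.unusedSectionVars false

noncomputable section

namespace CartanType

attribute [local instance] ZMod.algebra

/-! The Hamiltonian algebras. -/

section Hamiltonian

variable {k : Type*} [Field k] {p : ℕ} [hp : Fact p.Prime] [CharP k p] {m : ℕ}

theorem sgn_swap (i : Fin m ⊕ Fin m) : sgn k i.swap = -sgn k i := by
  rcases i with i | i <;> simp [sgn]

theorem sgn_mul_self (i : Fin m ⊕ Fin m) : sgn k i * sgn k i = 1 := by
  rcases i with i | i <;> simp [sgn]

theorem sgn_ne_zero (i : Fin m ⊕ Fin m) : sgn k i ≠ 0 :=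
  left_ne_zero_of_mul_eq_one (sgn_mul_self i)

theorem swap_ne (i : Fin m ⊕ Fin m) : i.swap ≠ i := by
  rcases i with i | i <;> simp

theorem swap_eq_iff {i j : Fin m ⊕ Fin m} : i.swap = j ↔ i = j.swap :=
  ⟨fun h => by rw [← h, Sum.swap_swap], fun h => by rw [h, Sum.swap_swap]⟩

/-- The Hamiltonian derivation `x_i ↦ σ(i) ∂_{i'}(f)`. -/
def ham : A k p (Fin m ⊕ Fin m) →ₗ[k]
    Derivation k (A k p (Fin m ⊕ Fin m)) (A k p (Fin m ⊕ Fin m)) where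
  toFun f := derOf fun i => sgn k i • pd k p i.swap f
  map_add' f g := der_ext _ _ fun i => by simp
  map_smul' c f := der_ext _ _ fun i => by simp [smul_comm c]

theorem ham_x (f : A k p (Fin m ⊕ Fin m)) (i : Fin m ⊕ Fin m) :
    ham f (x k p i) = sgn k i • pd k p i.swap f := derOf_x _ i

theorem ham_x_x (i j : Fin m ⊕ Fin m) :
    ham (x k p i) (x k p j) = if i = j.swap then algebraMap k _ (sgn k j) else 0 := by
  rw [ham_x, pd_x]
  split_ifs
  · rw [Algebra.algebraMap_eq_smul_one]
  · rw [smul_zero]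

/-- `ham f g` is the Poisson bracket; antisymmetry comes from exchanging the members of each
conjugate pair. -/
theorem ham_comm (f g : A k p (Fin m ⊕ Fin m)) : ham f g = -ham g f := by
  rw [der_eq_sum, der_eq_sum k p (ham g), ← Finset.sum_neg_distrib]
  refine Fintype.sum_equiv (Equiv.sumComm _ _) _ _ fun l => ?_
  rw [Equiv.sumComm_apply, ham_x, ham_x, sgn_swap, Sum.swap_swap, neg_smul, neg_mul, neg_neg,
    smul_mul_assoc, smul_mul_assoc, mul_comm]

theorem ham_mul (f g h : A k p (Fin m ⊕ Fin m)) :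
    ham (f * g) h = f * ham g h + g * ham f h := by
  rw [ham_comm, Derivation.leibniz, ham_comm h g, ham_comm h f, smul_eq_mul, smul_eq_mul]
  ring

theorem ham_one : ham (1 : A k p (Fin m ⊕ Fin m)) = 0 :=
  der_ext _ _ fun i => by simp [ham_x]

theorem ham_mem_H (f : A k p (Fin m ⊕ Fin m)) : ham f ∈ H k p m := by
  intro i j
  rw [ham_x, ham_x, Derivation.map_smul, Derivation.map_smul, smul_smul, smul_smul, sgn_mul_self,
    sgn_mul_self, pd_comm]

theorem lie_single_ham (l : Fin m ⊕ Fin m) (f : A k p (Fin m ⊕ Fin m)) :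
    ⁅single l (1 : A k p (Fin m ⊕ Fin m)), ham f⁆ = ham (pd k p l f) := by
  change ⁅single l (1 : A k p (Fin m ⊕ Fin m)), derOf _⁆ = _
  rw [lie_single_one]
  refine der_ext _ _ fun i => ?_
  rw [derOf_x, ham_x, Derivation.map_smul, pd_comm]

theorem single_one_eq_ham (l : Fin m ⊕ Fin m) :
    single l (1 : A k p (Fin m ⊕ Fin m)) = ham (sgn k l • x k p l.swap) := by
  refine der_ext _ _ fun i => ?_
  rw [map_smul, Derivation.smul_apply, ham_x_x, single_x]
  by_cases h : i = l
  · rw [if_pos h, if_pos (by rw [h]), h, Algebra.algebraMap_eq_smul_one, smul_smul, sgn_mul_self,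
      one_smul]
  · rw [if_neg h, if_neg, smul_zero]
    exact fun h' => h (by rw [← Sum.swap_swap i, ← h', Sum.swap_swap])

/-! ### Elements of the second derived Hamiltonian algebra. -/

theorem ham_pd_mem_derived_one (l : Fin m ⊕ Fin m) (f : A k p (Fin m ⊕ Fin m)) :
    ham (pd k p l f) ∈ derived k p (H k p m) 1 := by
  rw [← lie_single_ham]
  refine lie_mem_derived (mem_derived_zero.2 ?_) (mem_derived_zero.2 (ham_mem_H f))
  rw [single_one_eq_ham]
  exact ham_mem_H _

/-- Each bracket with a constant field costs one derivative of the Hamiltonian, and the constant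
fields themselves lie in the first derived algebra. -/
theorem ham_pd_pd_mem (a b : Fin m ⊕ Fin m) (f : A k p (Fin m ⊕ Fin m)) :
    ham (pd k p a (pd k p b f)) ∈ derived k p (H k p m) 2 := by
  rw [← lie_single_ham]
  refine lie_mem_derived ?_ (ham_pd_mem_derived_one b f)
  rw [single_one_eq_ham]
  -- The linear Hamiltonian of `∂_a` is itself a partial derivative, of `x_a x_{a'}` up to sign.
  have h : pd k p a (sgn k a • (x k p a * x k p a.swap)) = sgn k a • x k p a.swap := by
    rw [Derivation.map_smul, Derivation.leibniz, pd_x, pd_x, if_pos rfl, if_neg (swap_ne a)]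
    simp
  rw [← h]
  exact ham_pd_mem_derived_one _ _

theorem pd_mul_pow {a : Fin m ⊕ Fin m} {u : A k p (Fin m ⊕ Fin m)} (h : pd k p a u = 0) {n : ℕ}
    (hn : n + 1 < p) :
    pd k p a (((n + 1 : ℕ) : k)⁻¹ • (u * x k p a ^ (n + 1))) = u * x k p a ^ n := by
  have h1 := natCast_ne_zero_of_lt k (Nat.succ_pos n) hn
  rw [Derivation.map_smul, Derivation.leibniz, h, Derivation.leibniz_pow, pd_x, if_pos rfl,
    smul_zero, add_zero, Nat.add_sub_cancel, smul_eq_mul, smul_eq_mul, mul_one, mul_smul_comm,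
    ← Nat.cast_smul_eq_nsmul k, inv_smul_smul₀ h1]

/-- Integrate once in each of two variables. For `p = 3` this form is needed, as integrating twice
in one variable is too restrictive; `ham_mul_pow_mem` handles a single variable for larger `p`. -/
theorem ham_mul_pow_mul_pow_mem {a b : Fin m ⊕ Fin m} (hab : a ≠ b) {u : A k p (Fin m ⊕ Fin m)}
    (ha : pd k p a u = 0) (hb : pd k p b u = 0) {r s : ℕ} (hr : r + 1 < p) (hs : s + 1 < p) :
    ham (u * x k p a ^ r * x k p b ^ s) ∈ derived k p (H k p m) 2 := by
  have h1 : pd k p b (u * x k p a ^ r) = 0 := by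
    rw [Derivation.leibniz, hb, Derivation.leibniz_pow, pd_x, if_neg hab]; simp
  have h2 : pd k p a (u * x k p b ^ (s + 1)) = 0 := by
    rw [Derivation.leibniz, ha, Derivation.leibniz_pow, pd_x, if_neg hab.symm]; simp
  have h3 := pd_mul_pow h2 hr
  rw [← pd_mul_pow h1 hs, mul_right_comm, ← h3, ← Derivation.map_smul]
  exact ham_pd_pd_mem _ _ _

theorem ham_mul_pow_mem {a : Fin m ⊕ Fin m} {u : A k p (Fin m ⊕ Fin m)} (ha : pd k p a u = 0)
    {r : ℕ} (hr : r + 2 < p) : ham (u * x k p a ^ r) ∈ derived k p (H k p m) 2 := by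
  rw [← pd_mul_pow ha (show r + 1 < p by omega), ← pd_mul_pow ha hr, ← Derivation.map_smul]
  exact ham_pd_pd_mem _ _ _

theorem ham_x_mem (hp3 : 3 ≤ p) (i : Fin m ⊕ Fin m) : ham (x k p i) ∈ derived k p (H k p m) 2 := by
  have := ham_mul_pow_mul_pow_mem (k := k) (p := p) (u := 1) (r := 1) (s := 0) (swap_ne i).symm
    (by simp) (by simp) (by omega) (by omega)
  simpa using this

theorem ham_x_mul_x_mem (hp3 : 3 ≤ p) (hm : (∀ i : Fin m ⊕ Fin m, ∃ j, j ≠ i ∧ j ≠ i.swap) ∨ 5 ≤ p)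
    (i j : Fin m ⊕ Fin m) : ham (x k p i * x k p j) ∈ derived k p (H k p m) 2 := by
  by_cases hij : i = j
  · subst hij
    rcases hm with hm | hm
    · obtain ⟨j, h1, h2⟩ := hm i
      have h3 : i ≠ j.swap := fun h => h2 (by rw [h, Sum.swap_swap])
      have := ham_mul_pow_mul_pow_mem (k := k) (p := p) (u := x k p i * x k p i) (r := 0) (s := 0)
        (swap_ne j).symm (by simp [pd_x, h1.symm]) (by simp [pd_x, h3]) (by omega) (by omega)
      simpa using this
    · have := ham_mul_pow_mem (k := k) (p := p) (u := 1) (a := i) (r := 2) (by simp) (by omega)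
      simpa [pow_two] using this
  · have := ham_mul_pow_mul_pow_mem (k := k) (p := p) (u := 1) (r := 1) (s := 1) hij
      (by simp) (by simp) (by omega) (by omega)
    simpa using this

/-- With `u_i ≠ 0` and `t` the conjugate of `j₀`, the Hamiltonian `x_i x_t` produces the component
`j₀`, together with an unwanted component at the conjugate of `i`; a multiple of `x_i²` cancels the
latter. When `i = t` the square alone suffices. -/
theorem exists_linear_H (hp3 : 3 ≤ p)
    (hm : (∀ i : Fin m ⊕ Fin m, ∃ j, j ≠ i ∧ j ≠ i.swap) ∨ 5 ≤ p)
    {u : Fin m ⊕ Fin m → k} (j₀ : Fin m ⊕ Fin m) (hu : u ≠ 0) :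
    ∃ y ∈ derived k p (H k p m) 2, y ∈ fil k p (Fin m ⊕ Fin m) 1 ∧
      ∀ (E : Derivation k (A k p (Fin m ⊕ Fin m)) (A k p (Fin m ⊕ Fin m))) (s : k),
        ev (Fin m ⊕ Fin m) E = s • u →
          ∀ j, aug k p (Fin m ⊕ Fin m) (E (y (x k p j))) = if j = j₀ then s else 0 := by
  obtain ⟨i, hi⟩ := Function.ne_iff.1 hu
  have hi : u i ≠ 0 := hi
  have h2 := two_ne_zero_of_three_le (k := k) hp3
  obtain ⟨t, rfl⟩ : ∃ t : Fin m ⊕ Fin m, j₀ = t.swap := ⟨j₀.swap, (Sum.swap_swap j₀).symm⟩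
  have hx : ∀ α β : k, ∀ l, ham (α • (x k p i * x k p t) + β • (x k p i * x k p i)) (x k p l) =
      sgn k l • ((if i = l.swap then α • x k p t + (2 * β) • x k p i else 0) +
        if t = l.swap then α • x k p i else 0) := by
    intro α β l
    rw [ham_x, map_add, Derivation.map_smul, Derivation.map_smul, Derivation.leibniz,
      Derivation.leibniz, pd_x, pd_x]
    congr 1
    split_ifs <;> (simp [mul_smul, two_smul]; try abel)
  have hmem : ∀ α β : k, ham (α • (x k p i * x k p t) + β • (x k p i * x k p i)) ∈
      derived k p (H k p m) 2 := by
    intro α β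
    rw [map_add, map_smul, map_smul]
    exact add_mem ((derived k p (H k p m) 2).smul_mem _ (ham_x_mul_x_mem hp3 hm _ _))
      ((derived k p (H k p m) 2).smul_mem _ (ham_x_mul_x_mem hp3 hm _ _))
  have hfil : ∀ α β : k, ham (α • (x k p i * x k p t) + β • (x k p i * x k p i)) ∈
      fil k p (Fin m ⊕ Fin m) 1 := by
    intro α β
    rw [mem_fil_one]
    ext l
    rw [ev_apply, hx]
    split_ifs <;> simp
  have hE : ∀ α β : k, ∀ (E : Derivation k (A k p (Fin m ⊕ Fin m)) (A k p (Fin m ⊕ Fin m))) (s : k),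
        ev (Fin m ⊕ Fin m) E = s • u → ∀ l,
      aug k p (Fin m ⊕ Fin m)
        (E (ham (α • (x k p i * x k p t) + β • (x k p i * x k p i)) (x k p l))) =
      sgn k l * ((if i = l.swap then α * (s * u t) + 2 * β * (s * u i) else 0) +
        if t = l.swap then α * (s * u i) else 0) := by
    intro α β E s hE l
    have hE' : ∀ j, aug k p (Fin m ⊕ Fin m) (E (x k p j)) = s * u j := fun j => congrFun hE j
    rw [hx, Derivation.map_smul, map_smul, map_add, map_add, smul_eq_mul]
    congr 2
    · split_ifs
      · rw [map_add, map_add, Derivation.map_smul, Derivation.map_smul, map_smul, map_smul, hE',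
          hE', smul_eq_mul, smul_eq_mul]
      · simp
    · split_ifs
      · rw [Derivation.map_smul, map_smul, hE', smul_eq_mul]
      · simp
  by_cases hit : i = t
  · subst hit
    refine ⟨_, hmem 0 ((2 * u i)⁻¹ * sgn k i.swap), hfil _ _, fun E s hEs l => ?_⟩
    rw [hE _ _ E s hEs]
    by_cases hl : l = i.swap
    · subst hl
      rw [if_pos (Sum.swap_swap i).symm, if_pos (Sum.swap_swap i).symm, if_pos rfl]
      have := sgn_mul_self (k := k) i.swap
      field_simp
      linear_combination s * this
    · have : i ≠ l.swap := fun h => hl (by rw [h, Sum.swap_swap])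
      simp [hl, this]
  · refine ⟨_, hmem (sgn k t.swap * (u i)⁻¹) (-(2 * u i)⁻¹ * (sgn k t.swap * (u i)⁻¹ * u t)),
      hfil _ _, fun E s hEs l => ?_⟩
    rw [hE _ _ E s hEs]
    by_cases hl : l = t.swap
    · subst hl
      rw [if_neg (by rwa [Sum.swap_swap]), if_pos (Sum.swap_swap t).symm, if_pos rfl]
      have := sgn_mul_self (k := k) t.swap
      field_simp
      linear_combination s * this
    · have : t ≠ l.swap := fun h => hl (by rw [h, Sum.swap_swap])
      rw [if_neg this, if_neg hl, add_zero]
      split_ifs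
      · field_simp
        ring
      · simp

theorem isAmple_H (hp3 : 3 ≤ p)
    (hm : (∀ i : Fin m ⊕ Fin m, ∃ j, j ≠ i ∧ j ≠ i.swap) ∨ 5 ≤ p) :
    IsAmple (derived k p (H k p m) 2) where
  exists_ev v := by
    refine ⟨∑ i, v i • single i (1 : A k p (Fin m ⊕ Fin m)), sum_mem fun i _ => ?_, ?_⟩
    · refine (derived k p (H k p m) 2).smul_mem _ ?_
      rw [single_one_eq_ham, map_smul]
      exact (derived k p (H k p m) 2).smul_mem _ (ham_x_mem hp3 _)
    · ext i
      rw [ev_apply, der_sum_apply]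
      simp [Derivation.smul_apply, Pi.single_apply]
  exists_linear u j₀ hu := exists_linear_H hp3 hm j₀ hu
  exists_cubic v hv := by
    obtain ⟨i, hi⟩ := Function.ne_iff.1 hv
    have hi : v i ≠ 0 := hi
    have h2 := two_ne_zero_of_three_le (k := k) hp3
    rcases hm with hm | hm
    · obtain ⟨j, hji, hji'⟩ := hm i
      have hij' : i ≠ j.swap := fun h => hji' (by rw [h, Sum.swap_swap])
      have hx : ∀ l, ham (x k p i * x k p i * x k p j * x k p j.swap) (x k p l) = sgn k l •
          ((if l = i.swap then (2 : k) • (x k p i * x k p j * x k p j.swap) else 0) +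
            (if l = j then x k p i * x k p i * x k p j else 0) +
            if l = j.swap then x k p i * x k p i * x k p j.swap else 0) := by
        intro l
        rw [ham_x]
        congr 1
        have h1 : i = l.swap ↔ l = i.swap := by rw [← swap_eq_iff, eq_comm]
        have h2 : j = l.swap ↔ l = j.swap := by rw [← swap_eq_iff, eq_comm]
        have h3 : j.swap = l.swap ↔ l = j := by rw [swap_eq_iff, Sum.swap_swap, eq_comm]
        simp only [Derivation.leibniz, pd_x, smul_eq_mul, h1, h2, h3]
        split_ifs <;> (try simp only [two_smul]) <;> ring
      -- The Hamiltonian is `x_i² x_j x_{j'}` with `j` in another pair. Its `∂_{i'}` part forces the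
      -- second summand of the eigenvector.
      refine ⟨ham (x k p i * x k p i * x k p j * x k p j.swap), ?_, mem_fil_iff.2 fun l => ?_,
        Pi.single j 1 + Pi.single i.swap (2 * sgn k i.swap * sgn k j * v j.swap * (v i)⁻¹),
        sgn k j * 2 * v i * v i, ?_, ?_, fun X Y E s hX hY hE l => ?_⟩
      · have := ham_mul_pow_mul_pow_mem (k := k) (p := p) (u := x k p i * x k p i) (r := 1) (s := 1)
          (swap_ne j).symm (by simp [pd_x, hji.symm]) (by simp [pd_x, hij']) (by omega) (by omega)
        simpa using this
      · rw [hx]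
        refine Submodule.smul_of_tower_mem _ _ (add_mem (add_mem ?_ ?_) ?_)
        · split_ifs
          · exact Submodule.smul_of_tower_mem _ _ (cubic_mem _ _ _)
          · exact zero_mem _
        · split_ifs
          · exact cubic_mem _ _ _
          · exact zero_mem _
        · split_ifs
          · exact cubic_mem _ _ _
          · exact zero_mem _
      · exact fun h => one_ne_zero (α := k) (by simpa [hji'] using congrFun h j)
      · exact mul_ne_zero (mul_ne_zero (mul_ne_zero (sgn_ne_zero j) h2) hi) hi
      · have hEj : ev _ E j = s := by rw [hE]; simp [hji']
        have hEi : ev _ E i = 0 := by rw [hE]; simp [hji.symm, (swap_ne i).symm]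
        have hEj' : ev _ E j.swap = 0 := by
          rw [hE]
          have : j.swap ≠ i.swap := fun h => hji (by rw [← Sum.swap_swap j, h, Sum.swap_swap])
          simp [this, swap_ne j]
        rw [hx]
        simp only [Derivation.map_smul, map_smul, map_add]
        by_cases hl1 : l = i.swap
        · subst hl1
          rw [if_pos rfl, if_neg (Ne.symm hji'), if_neg]
          swap
          · exact fun h => hji (by rw [← Sum.swap_swap j, ← h, Sum.swap_swap])
          simp only [Derivation.map_smul, map_smul, map_zero, aug_der_three, hX, hY, hEj, hEi, hEj']
          simp [Ne.symm hji']
          have := sgn_mul_self (k := k) j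
          field_simp
          linear_combination (-2 * sgn k i.swap * v j.swap * s) * this
        · by_cases hl2 : l = j
          · subst hl2
            rw [if_neg hl1, if_pos rfl, if_neg (swap_ne l).symm]
            simp only [map_zero, aug_der_three, hX, hY, hEj, hEi]
            simp [hl1]
            ring
          · by_cases hl3 : l = j.swap
            · subst hl3
              rw [if_neg hl1, if_neg hl2, if_pos rfl]
              simp only [map_zero, aug_der_three, hX, hY, hEi, hEj']
              simp [hl1, swap_ne]
            · simp [hl1, hl2, hl3]
    · have hx : ∀ l, ham (x k p i * x k p i * x k p i * x k p i.swap) (x k p l) = sgn k l •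
          ((if l = i.swap then (3 : k) • (x k p i * x k p i * x k p i.swap) else 0) +
            if l = i then x k p i * x k p i * x k p i else 0) := by
        intro l
        rw [ham_x]
        congr 1
        have h1 : i = l.swap ↔ l = i.swap := by rw [← swap_eq_iff, eq_comm]
        have h3 : i.swap = l.swap ↔ l = i := by rw [swap_eq_iff, Sum.swap_swap, eq_comm]
        simp only [Derivation.leibniz, pd_x, smul_eq_mul, h1, h3, Algebra.smul_def, map_ofNat]
        split_ifs <;> ring
      -- With no second pair available, `x_i³ x_{i'}` is used; its eigenvalue contains `6`, whence
      -- `p ≥ 5`.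
      refine ⟨ham (x k p i * x k p i * x k p i * x k p i.swap), ?_, mem_fil_iff.2 fun l => ?_,
        Pi.single i.swap 1, sgn k i.swap * 6 * v i * v i, ?_, ?_, fun X Y E s hX hY hE l => ?_⟩
      · have := ham_mul_pow_mul_pow_mem (k := k) (p := p) (u := 1) (r := 3) (s := 1)
          (swap_ne i).symm (by simp) (by simp) (by omega) (by omega)
        simpa [pow_succ] using this
      · rw [hx]
        refine Submodule.smul_of_tower_mem _ _ (add_mem ?_ ?_)
        · split_ifs
          · exact Submodule.smul_of_tower_mem _ _ (cubic_mem _ _ _)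
          · exact zero_mem _
        · split_ifs
          · exact cubic_mem _ _ _
          · exact zero_mem _
      · exact fun h => one_ne_zero (α := k) (by simpa using congrFun h i.swap)
      · exact mul_ne_zero (mul_ne_zero (mul_ne_zero (sgn_ne_zero _)
          (six_ne_zero_of_five_le (p := p) hm)) hi) hi
      · have hEi : ev _ E i = 0 := by rw [hE]; simp [(swap_ne i).symm]
        have hEi' : ev _ E i.swap = s := by rw [hE]; simp
        rw [hx]
        simp only [Derivation.map_smul, map_smul, map_add]
        by_cases hl1 : l = i.swap
        · subst hl1
          rw [if_pos rfl, if_neg (swap_ne i)]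
          simp only [Derivation.map_smul, map_smul, map_zero, aug_der_three, hX, hY, hEi, hEi']
          simp
          ring
        · by_cases hl2 : l = i
          · subst hl2
            rw [if_neg hl1, if_pos rfl]
            simp only [map_zero, aug_der_three, hX, hY, hEi]
            simp [hl1]
          · simp [hl1, hl2]

/-! ### Weights of Hamiltonian fields. -/

/-- The coefficients of the diagonal derivations in the Hamiltonian algebra. -/
def IsSkew (a : Fin m ⊕ Fin m → k) : Prop := ∀ i, a i.swap = -a i

variable {R : Finset (Fin m ⊕ Fin m)}

theorem lie_diag_pd (a : Fin m ⊕ Fin m → k) (i : Fin m ⊕ Fin m) :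
    ⁅diag p R a, pd k p i⁆ = (-a i) • pd k p i := by
  rw [lie_diag_iff]
  intro l
  rw [pd_x]
  split_ifs with h
  · rw [h]; simp
  · simp

/-- Skewness gives conjugate coordinates opposite weights, so passing from a Hamiltonian to its
field preserves weights. -/
theorem lie_diag_ham {a : Fin m ⊕ Fin m → k} (ha : IsSkew a) {w : k} {f : A k p (Fin m ⊕ Fin m)}
    (hf : diag p R a f = w • f) : ⁅diag p R a, ham f⁆ = w • ham f := by
  rw [lie_diag_iff]
  intro l
  have h := DFunLike.congr_fun (lie_diag_pd (p := p) (R := R) a l.swap) f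
  rw [lie_eval, hf, Derivation.map_smul, sub_eq_iff_eq_add, Derivation.smul_apply, ha, neg_neg,
    ← add_smul] at h
  rw [ham_x, Derivation.map_smul, h, smul_comm, add_comm]

theorem swap_notMem (hR : ∀ i ∈ R, sgn k i = 1) (hp3 : 3 ≤ p) {i : Fin m ⊕ Fin m} (hi : i ∈ R) :
    i.swap ∉ R := by
  intro h
  have h1 := hR _ h
  rw [sgn_swap, hR i hi] at h1
  refine two_ne_zero_of_three_le (k := k) hp3 ?_
  linear_combination -h1

/-- The Hamiltonians are `x_j²`, `z^α z_i x_{i'}` and `z^α x_{j'}`. In the last case `j'` is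
unshifted, since otherwise `v` would be a monomial weight. -/
theorem isRich_H (hp3 : 3 ≤ p) (hm : (∀ i : Fin m ⊕ Fin m, ∃ j, j ≠ i ∧ j ≠ i.swap) ∨ 5 ≤ p)
    (hR : ∀ i ∈ R, sgn k i = 1) {a : Fin m ⊕ Fin m → k} (ha : IsSkew a) :
    IsRich (derived k p (H k p m) 2) R a where
  linear_mem := by
    rintro - j -
    have h2 := two_ne_zero_of_three_le (k := k) hp3
    refine ⟨j.swap, swap_ne j, ?_⟩
    have h : derOf (fun i => if i = j.swap then x k p j else 0) =
        (sgn k j.swap * 2⁻¹) • ham (x k p j * x k p j) := by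
      refine der_ext _ _ fun l => ?_
      rw [derOf_x, Derivation.smul_apply, ham_x]
      by_cases hl : l = j.swap
      · subst hl
        rw [if_pos rfl, Sum.swap_swap, Derivation.leibniz, pd_x, if_pos rfl, smul_eq_mul, mul_one,
          ← two_smul k, smul_smul, smul_smul, mul_right_comm, mul_assoc, mul_assoc,
          inv_mul_cancel_left₀ h2, sgn_mul_self, one_smul]
      · have : j ≠ l.swap := fun h => hl (by rw [h, Sum.swap_swap])
        simp [pd_x, hl, this]
    rw [h]
    exact (derived k p (H k p m) 2).smul_mem _ (ham_x_mul_x_mem hp3 hm _ _)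
  exists_unit i hi α := by
    have hi' := swap_notMem hR hp3 hi
    refine ⟨ham (mon k R (α + Pi.single i 1) * x k p i.swap), ?_, lie_diag_ham ha ?_, ?_,
      fun j hj => ?_⟩
    · rcases hm with hm | hm
      · obtain ⟨t, ht, htR⟩ : ∃ t, t ≠ i.swap ∧ t ∉ R := by
          obtain ⟨j, h1, h2⟩ := hm i
          by_cases hj : j ∈ R
          · exact ⟨j.swap, fun h => h1 (by rw [← Sum.swap_swap j, h, Sum.swap_swap]),
              swap_notMem hR hp3 hj⟩
          · exact ⟨j, h2, hj⟩
        have := ham_mul_pow_mul_pow_mem (k := k) (p := p) (r := 1) (s := 0) ht.symm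
          (pd_mon_of_notMem R hi' (α + Pi.single i 1)) (pd_mon_of_notMem R htR _) (by omega)
          (by omega)
        simpa using this
      · have := ham_mul_pow_mem (k := k) (p := p) (r := 1)
          (pd_mon_of_notMem R hi' (α + Pi.single i 1)) (by omega)
        simpa using this
    · rw [Derivation.leibniz, diag_mon, diag_x, z_of_notMem hi', ha, map_add, wt_single R a hi,
        smul_eq_mul, smul_eq_mul, mul_comm (x k p i.swap), mul_smul_comm, smul_mul_assoc,
        ← add_smul]
      congr 1
      ring
    · rw [ham_x, Derivation.leibniz, pd_x, if_pos rfl, pd_mon_of_notMem R hi', map_smul, smul_zero,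
        add_zero, smul_eq_mul, smul_eq_mul, mul_one, aug_mon, mul_one]
      exact sgn_ne_zero i
    · rw [ham_x, Derivation.leibniz, pd_x, if_neg, smul_zero, zero_add, smul_eq_mul]
      · exact Submodule.smul_of_tower_mem _ _ (Ideal.mul_mem_right _ _ (x_mem_idealJ hi'))
      · intro h
        exact hj (by rwa [← Sum.swap_swap j, ← h, Sum.swap_swap])
  exists_value v hv j hj := by
    rintro ⟨α, hα⟩
    have hj' : j.swap ∉ R := by
      intro hj'
      refine hv ⟨α + Pi.single j.swap 1, ?_⟩
      rw [map_add, hα, wt_single R a hj', ha]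
      ring
    refine ⟨sgn k j • ham (mon k R α * x k p j.swap), ?_, ?_, ?_⟩
    · refine (derived k p (H k p m) 2).smul_mem _ ?_
      have := ham_mul_pow_mul_pow_mem (k := k) (p := p) (r := 1) (s := 0) (swap_ne j)
        (pd_mon_of_notMem R hj' α) (pd_mon_of_notMem R hj _) (by omega) (by omega)
      simpa using this
    · rw [← map_smul]
      refine lie_diag_ham ha ?_
      rw [Derivation.map_smul, smul_comm v]
      congr 1
      rw [Derivation.leibniz, diag_mon, diag_x, z_of_notMem hj', ha, hα,
        smul_eq_mul, smul_eq_mul, mul_comm (x k p j.swap), mul_smul_comm, smul_mul_assoc,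
        ← add_smul]
      congr 1
      ring
    · ext l
      rw [ev_apply, Derivation.smul_apply, ham_x, smul_smul, Derivation.leibniz, pd_x, map_smul,
        map_add, Pi.single_apply]
      by_cases hl : l = j
      · subst hl
        rw [if_pos rfl, if_pos rfl, sgn_mul_self]
        simp [aug_mon]
      · rw [if_neg hl, if_neg]
        · simp
        · exact fun h => hl (by rw [← Sum.swap_swap l, ← h, Sum.swap_swap])

end Hamiltonian

end CartanType

end

open scoped Pointwise

set_option linter.unusedSectionVars false

noncomputable section

namespace CartanType

attribute [local instance] ZMod.algebra

/-! Symplectic automorphisms of the truncated polynomial ring. -/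

section Symplectic

variable {k : Type*} [Field k] {p : ℕ} [hp : Fact p.Prime] [CharP k p] {m : ℕ}
  {R : Finset (Fin m ⊕ Fin m)}

theorem sgn_smul_eq_iff {M : Type*} [AddCommGroup M] [Module k M] (i j : Fin m ⊕ Fin m) {X Y : M} :
    sgn k i • X = sgn k j • Y ↔ sgn k j • X = sgn k i • Y := by
  rcases i with i | i <;> rcases j with j | j <;> simp [sgn, neg_eq_iff_eq_neg]

/-- The defining equations of `H` say that `D` is a derivation of the Poisson bracket on pairs of
coordinates. Antisymmetry allows the extension from coordinates to functions, one argument at a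
time. -/
theorem lie_ham_of_mem_H {D : Derivation k (A k p (Fin m ⊕ Fin m)) (A k p (Fin m ⊕ Fin m))}
    (hD : D ∈ H k p m) (f : A k p (Fin m ⊕ Fin m)) : ⁅D, ham f⁆ = ham (D f) := by
  have h1 : ∀ j, ⁅D, ham (x k p j)⁆ = ham (D (x k p j)) := by
    intro j
    refine der_ext _ _ fun i => ?_
    have h2 : D (ham (x k p j) (x k p i)) = 0 := by
      rw [ham_x_x]; split_ifs <;> simp
    rw [lie_eval, h2, zero_sub, ham_comm, neg_neg, ham_x, ham_x]
    exact (sgn_smul_eq_iff i j).1 (hD i j)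
  refine der_ext _ _ fun j => ?_
  have h2 := DFunLike.congr_fun (h1 j) f
  rw [lie_eval] at h2 ⊢
  rw [ham_comm f (x k p j), ham_comm f (D (x k p j)), map_neg, ← h2, ham_comm (D f)]
  ring

theorem mem_H_of_lie_ham {D : Derivation k (A k p (Fin m ⊕ Fin m)) (A k p (Fin m ⊕ Fin m))}
    (h : ∀ j, ⁅D, ham (x k p j)⁆ = ham (D (x k p j))) : D ∈ H k p m := by
  intro i j
  have h1 := DFunLike.congr_fun (h j) (x k p i)
  have h2 : D (ham (x k p j) (x k p i)) = 0 := by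
    rw [ham_x_x]; split_ifs <;> simp
  rw [lie_eval, h2, zero_sub, ham_comm, neg_neg, ham_x, ham_x] at h1
  exact (sgn_smul_eq_iff j i).1 h1

/-- If `σ` preserves the brackets of the coordinates, it carries Hamiltonian fields to Hamiltonian
fields, and commuting with `ham` in the sense of `lie_ham_of_mem_H` characterizes `H`. -/
theorem conjDer_mem_H {σ : A k p (Fin m ⊕ Fin m) ≃ₐ[k] A k p (Fin m ⊕ Fin m)}
    (h : ∀ i j, ham (σ (x k p i)) (σ (x k p j)) =
      if i = j.swap then algebraMap k _ (sgn k j) else 0) :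
    ∀ D ∈ H k p m, conjDer σ D ∈ H k p m := by
  have h1 : ∀ i, conjDer σ (ham (σ (x k p i))) = ham (x k p i) := by
    intro i
    refine der_ext _ _ fun j => ?_
    rw [conjDer_apply, h, ham_x_x]
    split_ifs
    · exact σ.symm.commutes _
    · exact map_zero _
  have h2 : ∀ f, conjDer σ (ham (σ f)) = ham f := by
    intro f
    refine der_ext _ _ fun j => ?_
    rw [conjDer_apply, ham_comm, map_neg, ← conjDer_apply, h1, ham_comm, neg_neg]
  intro D hD
  refine mem_H_of_lie_ham fun j => ?_
  conv_lhs => rw [← h1, ← LieHom.map_lie, lie_ham_of_mem_H hD]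
  conv_rhs => rw [← h2, conjDer_apply, σ.apply_symm_apply]

theorem ham_mon_x (α : Fin m ⊕ Fin m → ZMod p)
    {i : Fin m ⊕ Fin m} (hi : i.swap ∉ R) : ham (mon k R α) (x k p i) = 0 := by
  rw [ham_x, pd_mon_of_notMem R hi, smul_zero]

/-- No two shifted coordinates are conjugate, so their monomials Poisson commute. -/
theorem ham_mon_mon (hR : ∀ i ∈ R, i.swap ∉ R) (α β : Fin m ⊕ Fin m → ZMod p) :
    ham (mon k R α) (mon k R β) = 0 := by
  rw [der_mon R (a := 0) (fun i hi => ?_), wt_apply]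
  · simp
  · rw [der_z, ham_x, pd_mon_of_notMem R (hR i hi)]; simp

/-! ### Quadratic Hamiltonians and symplectic monomial substitutions. -/

variable (p R) in
/-- The quadratic Hamiltonian of a diagonal derivation. -/
def quad (d : Fin m ⊕ Fin m → k) : A k p (Fin m ⊕ Fin m) :=
  ∑ i : Fin m, d (Sum.inl i) • (z k p R (Sum.inl i) * x k p (Sum.inr i))

theorem ham_quad (hR : ∀ i : Fin m, Sum.inr i ∉ R) {d : Fin m ⊕ Fin m → k} (hd : IsSkew d) :
    ham (quad p R d) = diag p R d := by
  refine der_ext _ _ fun l => ?_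
  rw [ham_x, diag_x, quad, map_sum]
  rcases l with l | l
  · rw [Finset.sum_eq_single l]
    · rw [Sum.swap_inl, Derivation.map_smul, Derivation.leibniz, pd_x, der_z, pd_x]
      simp [sgn]
    · intro i _ hi
      rw [Sum.swap_inl, Derivation.map_smul, Derivation.leibniz, pd_x, der_z, pd_x]
      simp [hi]
    · simp
  · have h := hd (Sum.inl l)
    rw [Sum.swap_inl] at h
    rw [Finset.sum_eq_single l]
    · rw [Sum.swap_inr, Derivation.map_smul, Derivation.leibniz, pd_x, der_z, pd_x, h,
        z_of_notMem (hR l)]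
      simp [sgn]
    · intro i _ hi
      rw [Sum.swap_inr, Derivation.map_smul, Derivation.leibniz, pd_x, der_z, pd_x]
      simp [hi]
    · simp

/-- Each product `z_i x_{i'}` has weight `a_i - a_i = 0`. -/
theorem diag_quad (hR : ∀ i : Fin m, Sum.inr i ∉ R) {a : Fin m ⊕ Fin m → k} (ha : IsSkew a)
    (d : Fin m ⊕ Fin m → k) : diag p R a (quad p R d) = 0 := by
  rw [quad, map_sum]
  refine Finset.sum_eq_zero fun i _ => ?_
  have h := ha (Sum.inl i)
  rw [Sum.swap_inl] at h
  rw [Derivation.map_smul, Derivation.leibniz, diag_z, diag_x, z_of_notMem (hR i), h, neg_smul,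
    smul_neg, smul_eq_mul, smul_eq_mul, mul_smul_comm, mul_smul_comm, mul_comm (x k p (Sum.inr i)),
    neg_add_cancel, smul_zero]

theorem quad_pow (d : Fin m ⊕ Fin m → k) : quad p R d ^ p = 0 := by
  have : CharP (A k p (Fin m ⊕ Fin m)) p := by
    have : Nontrivial (A k p (Fin m ⊕ Fin m)) :=
      (aug k p (Fin m ⊕ Fin m)).toRingHom.domain_nontrivial
    exact charP_of_injective_algebraMap (algebraMap k _).injective p
  rw [quad, sum_pow_char]
  refine Finset.sum_eq_zero fun i _ => ?_
  rw [smul_pow, mul_pow, x_pow, mul_zero, smul_zero]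

/-- The data defining a symplectic automorphism which is monomial in the shifted coordinates. -/
structure IsSymplData (R : Finset (Fin m ⊕ Fin m)) (N K c : Fin m ⊕ Fin m → Fin m ⊕ Fin m → ZMod p)
    (τ : Equiv.Perm (Fin m ⊕ Fin m)) : Prop where
  inr_notMem : ∀ i : Fin m, Sum.inr i ∉ R
  invPair : IsInvPair R N K
  perm_swap : ∀ i, τ i.swap = (τ i).swap
  perm_mem : ∀ i, (τ i ∈ R ∨ (τ i).swap ∈ R) ↔ (i ∈ R ∨ i.swap ∈ R)
  shift_swap : ∀ i, c i.swap = -c i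

/-- The coefficients of the Hamiltonian field of the momentum conjugate to a shifted coordinate. -/
def momentum (R : Finset (Fin m ⊕ Fin m)) (K c : Fin m ⊕ Fin m → Fin m ⊕ Fin m → ZMod p)
    (τ : Equiv.Perm (Fin m ⊕ Fin m)) (i l : Fin m ⊕ Fin m) : ZMod p :=
  if l ∈ R then K l i else if l.swap ∈ R then -K l.swap i else
    -∑ j ∈ R, K j i * c (τ.symm l) j

/-- The signs making a permutation of the coordinates symplectic. -/
def permSign (k : Type*) [Field k] (τ : Equiv.Perm (Fin m ⊕ Fin m)) : Fin m ⊕ Fin m → k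
  | Sum.inl i => sgn k (τ (Sum.inl i))
  | Sum.inr _ => 1

variable (k) in
/-- The images of the coordinates under the symplectic automorphism. -/
def symplImage (R : Finset (Fin m ⊕ Fin m)) (N K c : Fin m ⊕ Fin m → Fin m ⊕ Fin m → ZMod p)
    (τ : Equiv.Perm (Fin m ⊕ Fin m)) (i : Fin m ⊕ Fin m) : A k p (Fin m ⊕ Fin m) :=
  if i ∈ R then mon k R (N i) else if i.swap ∈ R then
    mon k R (-N i.swap) * quad p R fun l => algebraMap (ZMod p) k (momentum R K c τ i.swap l)
  else permSign k τ i • x k p (τ i) * mon k R (c i)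

variable {N K c : Fin m ⊕ Fin m → Fin m ⊕ Fin m → ZMod p} {τ : Equiv.Perm (Fin m ⊕ Fin m)}

theorem permSign_mul_self (i : Fin m ⊕ Fin m) : permSign k τ i * permSign k τ i = 1 := by
  rcases i with i | i <;> simp [permSign, sgn_mul_self]

/-- When `τ` reverses a pair the bracket changes sign; the sign on the left member compensates. -/
theorem permSign_mul_swap (hτ : ∀ i, τ i.swap = (τ i).swap) (i : Fin m ⊕ Fin m) :
    permSign k τ i.swap * permSign k τ i * sgn k (τ i) = sgn k i := by
  rcases i with i | i
  · rw [Sum.swap_inl, permSign, permSign, one_mul, sgn_mul_self, sgn]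
  · have h := hτ (Sum.inl i)
    rw [Sum.swap_inl] at h
    rw [Sum.swap_inr, permSign, permSign, h, sgn_swap, mul_one, mul_neg, sgn_mul_self, sgn]

theorem IsSymplData.swap_notMem (hd : IsSymplData R N K c τ) : ∀ i ∈ R, i.swap ∉ R := by
  rintro (i | i) hi
  · exact hd.inr_notMem i
  · exact absurd hi (hd.inr_notMem i)

theorem IsSymplData.symm_swap (hd : IsSymplData R N K c τ) (i : Fin m ⊕ Fin m) :
    τ.symm i.swap = (τ.symm i).swap := by
  rw [Equiv.symm_apply_eq, hd.perm_swap, τ.apply_symm_apply]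

theorem IsSymplData.isSkew_momentum (hd : IsSymplData R N K c τ) (i : Fin m ⊕ Fin m) :
    IsSkew fun l => algebraMap (ZMod p) k (momentum R K c τ i l) := by
  intro l
  rw [← map_neg]
  refine congrArg (algebraMap (ZMod p) k) ?_
  unfold momentum
  by_cases h1 : l ∈ R
  · rw [if_neg (hd.swap_notMem l h1), Sum.swap_swap, if_pos h1, if_pos h1]
  · by_cases h2 : l.swap ∈ R
    · rw [if_pos h2, if_neg h1, if_pos h2, neg_neg]
    · rw [if_neg h2, Sum.swap_swap, if_neg h1, if_neg h1, if_neg h2, hd.symm_swap, hd.shift_swap]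
      simp

theorem wt_momentum (i : Fin m ⊕ Fin m) (γ : Fin m ⊕ Fin m → ZMod p) :
    wt R (fun l => algebraMap (ZMod p) k (momentum R K c τ i l)) γ =
      algebraMap (ZMod p) k (∑ l ∈ R, γ l * K l i) := by
  rw [wt_apply, map_sum]
  refine Finset.sum_congr rfl fun l hl => ?_
  rw [momentum, if_pos hl, map_mul, Algebra.smul_def]

/-- The images satisfy the canonical relations. The quadratic `Q_i` act diagonally; as `K` inverts
`N`, they satisfy `{Q_i, z^{N_l}} = δ_{il} z^{N_l}`, so `z^{-N_i} Q_i` is conjugate to `z^{N_i}`.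
The `Q_i` commute with one another, being of weight zero, and with the images of the free
coordinates. -/
theorem IsSymplData.ham_symplImage (hd : IsSymplData R N K c τ) (i j : Fin m ⊕ Fin m) :
    ham (symplImage k R N K c τ i) (symplImage k R N K c τ j) =
      if i = j.swap then algebraMap k _ (sgn k j) else 0 := by
  have hR := hd.swap_notMem
  have hsgn : ∀ i ∈ R, sgn k i = 1 := by
    rintro (i | i) hi
    · rfl
    · exact absurd hi (hd.inr_notMem i)
  set Q : Fin m ⊕ Fin m → A k p (Fin m ⊕ Fin m) := fun i =>
    quad p R fun l => algebraMap (ZMod p) k (momentum R K c τ i l) with hQ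
  have hamQ : ∀ i, ham (Q i) = diag p R fun l => algebraMap (ZMod p) k (momentum R K c τ i l) :=
    fun i => ham_quad hd.inr_notMem (hd.isSkew_momentum i)
  have hQQ : ∀ i l, ham (Q i) (Q l) = 0 := fun i l => by
    rw [hamQ]; exact diag_quad hd.inr_notMem (hd.isSkew_momentum i) _
  have hQN : ∀ i ∈ R, ∀ l ∈ R, ham (Q i) (mon k R (N l)) = if l = i then mon k R (N l) else 0 := by
    intro i hi l hl
    rw [hamQ, diag_mon, wt_momentum, hd.invPair.2 l hl i hi]
    split_ifs <;> simp
  have hQN' : ∀ i ∈ R, ∀ l ∈ R, ham (Q i) (mon k R (-N l)) =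
      if l = i then -mon k R (-N l) else 0 := by
    intro i hi l hl
    rw [hamQ, diag_mon, map_neg, wt_momentum, hd.invPair.2 l hl i hi]
    split_ifs <;> simp
  have hMX : ∀ α j, j ∉ R → j.swap ∉ R →
      ham (mon k R α) (permSign k τ j • x k p (τ j) * mon k R (c j)) = 0 := by
    intro α j h1 h2
    have h3 : (τ j).swap ∉ R := fun h => not_or.2 ⟨h1, h2⟩ ((hd.perm_mem j).1 (Or.inr h))
    rw [Derivation.leibniz, ham_mon_mon hR, Derivation.map_smul, ham_mon_x α h3]
    simp
  have hQX : ∀ i, ∀ j, j ∉ R → j.swap ∉ R →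
      ham (Q i) (permSign k τ j • x k p (τ j) * mon k R (c j)) = 0 := by
    intro i j h1 h2
    have h3 : ¬ (τ j ∈ R ∨ (τ j).swap ∈ R) := fun h => not_or.2 ⟨h1, h2⟩ ((hd.perm_mem j).1 h)
    rw [not_or] at h3
    -- The coefficient of `momentum` at a free coordinate was chosen so that its weight cancels that
    -- of the factor `z^{c_j}`.
    rw [hamQ, Derivation.leibniz, diag_mon, Derivation.map_smul, diag_x, wt_momentum, momentum,
      if_neg h3.1, if_neg h3.2, τ.symm_apply_apply, z_of_notMem h3.1, map_neg,
      Finset.sum_congr rfl fun l _ => mul_comm (K l i) (c j l)]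
    simp only [smul_eq_mul, neg_smul, smul_neg, mul_neg, smul_smul, mul_smul_comm,
      smul_mul_assoc]
    rw [mul_comm (x k p (τ j)), mul_comm (permSign k τ j), add_neg_cancel]
  have key1 : ∀ i ∈ R, ∀ j ∈ R, ham (mon k R (-N i) * Q i) (mon k R (N j)) =
      if j = i then 1 else 0 := by
    intro i hi j hj
    rw [ham_mul, hQN i hi j hj, ham_mon_mon hR, mul_zero, add_zero]
    split_ifs with h
    · rw [h, mul_comm, mon_mul_neg]
    · rw [mul_zero]
  have key2 : ∀ i ∈ R, ∀ j ∈ R, ham (mon k R (-N i) * Q i) (mon k R (-N j) * Q j) = 0 := by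
    intro i hi j hj
    rw [ham_mul, Derivation.leibniz, Derivation.leibniz, hQQ, hQN' i hi j hj, ham_mon_mon hR,
      ham_comm _ (Q j), hQN' j hj i hi]
    by_cases h : i = j
    · subst h
      simp only [if_true, smul_eq_mul]
      ring
    · rw [if_neg h, if_neg (Ne.symm h)]
      simp
  have key3 : ∀ i ∈ R, ∀ j, j ∉ R → j.swap ∉ R →
      ham (mon k R (-N i) * Q i) (permSign k τ j • x k p (τ j) * mon k R (c j)) = 0 := by
    intro i hi j h1 h2
    rw [ham_mul, hQX i j h1 h2, hMX _ j h1 h2]; simp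
  have key4 : ∀ i, i ∉ R → i.swap ∉ R → ∀ j, j ∉ R → j.swap ∉ R →
      ham (permSign k τ i • x k p (τ i) * mon k R (c i))
        (permSign k τ j • x k p (τ j) * mon k R (c j)) =
      if i = j.swap then algebraMap k _ (sgn k j) else 0 := by
    intro i hi hi' j hj hj'
    have h3 : (τ i).swap ∉ R := fun h => not_or.2 ⟨hi, hi'⟩ ((hd.perm_mem i).1 (Or.inr h))
    rw [ham_mul, hMX _ j hj hj', mul_zero, zero_add, Derivation.leibniz, ham_comm _ (mon k R (c j)),
      Derivation.map_smul, ham_mon_x _ h3, smul_zero, neg_zero, smul_zero, zero_add,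
      Derivation.map_smul, map_smul, Derivation.smul_apply, ham_x_x, ← hd.perm_swap]
    by_cases h : i = j.swap
    · subst h
      rw [if_pos rfl, if_pos rfl, ← permSign_mul_swap hd.perm_swap j, hd.shift_swap, smul_eq_mul, Algebra.smul_def,
        Algebra.smul_def, map_mul, map_mul]
      linear_combination (algebraMap k (A k p (Fin m ⊕ Fin m)) (permSign k τ j.swap) *
        algebraMap k (A k p (Fin m ⊕ Fin m)) (permSign k τ j) *
        algebraMap k (A k p (Fin m ⊕ Fin m)) (sgn k (τ j))) * mon_mul_neg (k := k) R (c j)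
    · rw [if_neg h, if_neg (fun h' => h (τ.injective h'))]
      simp
  unfold symplImage
  by_cases hi : i ∈ R
  · rw [if_pos hi]
    by_cases hj : j ∈ R
    · rw [if_pos hj, ham_mon_mon hR, if_neg]
      exact fun h => hR j hj (h ▸ hi)
    · rw [if_neg hj]
      by_cases hj' : j.swap ∈ R
      · rw [if_pos hj', ham_comm]
        change -ham (mon k R (-N j.swap) * Q j.swap) _ = _
        rw [key1 _ hj' _ hi]
        split_ifs
        · have := hsgn _ hj'
          rw [sgn_swap, neg_eq_iff_eq_neg] at this
          rw [this, map_neg, map_one]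
        · rw [neg_zero]
      · rw [if_neg hj', hMX _ j hj hj', if_neg]
        exact fun h => hj' (h ▸ hi)
  · rw [if_neg hi]
    by_cases hi' : i.swap ∈ R
    · rw [if_pos hi']
      change ham (mon k R (-N i.swap) * Q i.swap) _ = _
      by_cases hj : j ∈ R
      · rw [if_pos hj, key1 _ hi' _ hj, hsgn j hj, map_one]
        simp only [eq_comm (a := j), swap_eq_iff]
      · rw [if_neg hj]
        by_cases hj' : j.swap ∈ R
        · rw [if_pos hj', if_neg (fun h => hi (by rw [h]; exact hj'))]
          exact key2 _ hi' _ hj'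
        · rw [if_neg hj', key3 _ hi' j hj hj', if_neg]
          exact fun h => hj (by rw [h, Sum.swap_swap] at hi'; exact hi')
    · rw [if_neg hi']
      by_cases hj : j ∈ R
      · rw [if_pos hj, ham_comm, hMX _ i hi hi', if_neg (fun h => hi' (by rwa [h, Sum.swap_swap])),
          neg_zero]
      · rw [if_neg hj]
        by_cases hj' : j.swap ∈ R
        · rw [if_pos hj', if_neg (fun h => hi (by rw [h]; exact hj')), ham_comm]
          change -ham (mon k R (-N j.swap) * Q j.swap) _ = _
          rw [key3 _ hj' i hi hi', neg_zero]
        · rw [if_neg hj']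
          exact key4 i hi hi' j hj hj'

theorem symplImage_pow (i : Fin m ⊕ Fin m) :
    (symplImage k R N K c τ i - if i ∈ R then 1 else 0) ^ p = 0 := by
  unfold symplImage
  split_ifs
  · exact sub_one_pow_char (mon_pow R _)
  · rw [sub_zero, mul_pow, quad_pow, mul_zero]
  · rw [sub_zero, mul_pow, smul_pow, x_pow, smul_zero, zero_mul]

theorem quad_sum_smul {κ : Type*} (s : Finset κ) (e : κ → k) (d : κ → Fin m ⊕ Fin m → k) :
    quad p R (fun l => ∑ i ∈ s, e i * d i l) = ∑ i ∈ s, e i • quad p R (d i) := by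
  simp only [quad, Finset.smul_sum, Finset.sum_smul, smul_smul]
  exact Finset.sum_comm

/-- Surjectivity: the range contains all unit monomials, then the free coordinates, then the
quadratics, from which the conjugates of the shifted coordinates are solved for. -/
theorem IsSymplData.exists_aut (hd : IsSymplData R N K c τ) :
    ∃ σ : A k p (Fin m ⊕ Fin m) ≃ₐ[k] A k p (Fin m ⊕ Fin m),
      ∀ i, σ (z k p R i) = symplImage k R N K c τ i := by
  let f : A k p (Fin m ⊕ Fin m) →ₐ[k] A k p (Fin m ⊕ Fin m) :=
    lift (fun i => symplImage k R N K c τ i - if i ∈ R then 1 else 0) symplImage_pow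
  have hf : ∀ i, f (z k p R i) = symplImage k R N K c τ i := by
    intro i
    have h : f (x k p i) = symplImage k R N K c τ i - if i ∈ R then 1 else 0 := lift_x _ _ i
    rw [x_eq R i, map_sub] at h
    by_cases hi : i ∈ R
    · simpa [hi] using h
    · simpa [hi] using h
  have hmem : ∀ i, symplImage k R N K c τ i ∈ f.range := fun i => ⟨_, hf i⟩
  have hmon := mon_mem_of_invPair R hd.invPair f.range fun i hi => by
    have := hmem i
    rwa [symplImage, if_pos hi] at this
  have hfree : ∀ q, q ∉ R → q.swap ∉ R → x k p q ∈ f.range := by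
    intro q hq hq'
    have h1 : ¬ (τ.symm q ∈ R ∨ (τ.symm q).swap ∈ R) := by
      rw [← hd.perm_mem, τ.apply_symm_apply]
      exact not_or.2 ⟨hq, hq'⟩
    rw [not_or] at h1
    have h2 := hmem (τ.symm q)
    rw [symplImage, if_neg h1.1, if_neg h1.2, τ.apply_symm_apply] at h2
    have h3 := f.range.smul_mem (mul_mem h2 (hmon (-c (τ.symm q)))) (permSign k τ (τ.symm q))
    rwa [mul_assoc, mon_mul_neg, mul_one, smul_smul, permSign_mul_self, one_smul] at h3
  have hz : ∀ i ∈ R, z k p R i ∈ f.range := fun i hi => mon_single (k := k) R hi ▸ hmon _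
  have hquad : ∀ i ∈ R, quad p R (fun l => algebraMap (ZMod p) k (momentum R K c τ i l)) ∈
      f.range := by
    intro i hi
    have h1 := hmem i.swap
    rw [symplImage, if_neg (hd.swap_notMem i hi), Sum.swap_swap, if_pos hi] at h1
    have h2 := mul_mem (hmon (N i)) h1
    rwa [← mul_assoc, mon_mul_neg, one_mul] at h2
  have hconj : ∀ j : Fin m, Sum.inl j ∈ R → x k p (Sum.inr j) ∈ f.range := by
    intro j hj
    -- Combining the quadratics with column `j` of `N` isolates `z_j x_{j'}` among the shifted
    -- pairs; the other terms involve only free coordinates.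
    have h1 : quad p R (fun l => ∑ i ∈ R, algebraMap (ZMod p) k (N i (Sum.inl j)) *
        algebraMap (ZMod p) k (momentum R K c τ i l)) ∈ f.range := by
      rw [quad_sum_smul]
      exact sum_mem fun i hi => f.range.smul_mem (hquad i hi) _
    have h2 : ∀ l ∈ R, ∑ i ∈ R, algebraMap (ZMod p) k (N i (Sum.inl j)) *
        algebraMap (ZMod p) k (momentum R K c τ i l) = if l = Sum.inl j then 1 else 0 := by
      intro l hl
      have h3 := congrArg (algebraMap (ZMod p) k) (hd.invPair.1 l hl _ hj)
      rw [map_sum] at h3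
      rw [show (if l = Sum.inl j then (1 : k) else 0) =
        algebraMap (ZMod p) k (if l = Sum.inl j then 1 else 0) by split_ifs <;> simp, ← h3]
      refine Finset.sum_congr rfl fun i _ => ?_
      rw [momentum, if_pos hl, ← map_mul, mul_comm]
    rw [quad, ← Finset.add_sum_erase _ _ (Finset.mem_univ j), h2 _ hj, if_pos rfl, one_smul] at h1
    have h4 : z k p R (Sum.inl j) * x k p (Sum.inr j) ∈ f.range := by
      refine (add_mem_cancel_right (sum_mem fun i hi => ?_)).1 h1
      by_cases hiR : Sum.inl i ∈ R
      · rw [h2 _ hiR, if_neg (fun h => Finset.ne_of_mem_erase hi (Sum.inl_injective h)), zero_smul]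
        exact zero_mem _
      · refine f.range.smul_mem (mul_mem ?_ ?_) _
        · rw [z_of_notMem hiR]
          exact hfree _ hiR (hd.inr_notMem i)
        · exact hfree _ (hd.inr_notMem i) hiR
    have h5 := mul_mem (hmon (-Pi.single (Sum.inl j) 1)) h4
    rwa [← mon_single (k := k) R hj, ← mul_assoc, mul_comm (mon k R _), mon_mul_neg, one_mul] at h5
  have hrange : ∀ i, x k p i ∈ f.range := by
    intro i
    by_cases hi : i ∈ R
    · rw [x_eq R i, if_pos hi]
      exact sub_mem (hz i hi) (one_mem _)
    · by_cases hi' : i.swap ∈ R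
      · rcases i with i | i
        · exact absurd hi' (hd.inr_notMem i)
        · exact hconj i hi'
      · exact hfree i hi hi'
  exact ⟨AlgEquiv.ofBijective f (bijective_of_x_mem_range f hrange), hf⟩

/-- The effect of a symplectic automorphism on the coefficients of diagonal derivations. -/
def symplCoeff (R : Finset (Fin m ⊕ Fin m)) (N c : Fin m ⊕ Fin m → Fin m ⊕ Fin m → ZMod p)
    (τ : Equiv.Perm (Fin m ⊕ Fin m)) (a : Fin m ⊕ Fin m → k) (i : Fin m ⊕ Fin m) : k :=
  if i ∈ R then wt R a (N i) else if i.swap ∈ R then -wt R a (N i.swap) else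
    a (τ i) + wt R a (c i)

theorem IsSymplData.isSkew_symplCoeff (hd : IsSymplData R N K c τ) {a : Fin m ⊕ Fin m → k}
    (ha : IsSkew a) : IsSkew (symplCoeff R N c τ a) := by
  intro i
  unfold symplCoeff
  rw [Sum.swap_swap]
  by_cases h1 : i ∈ R
  · rw [if_neg (hd.swap_notMem i h1), if_pos h1, if_pos h1]
  · by_cases h2 : i.swap ∈ R
    · rw [if_pos h2, if_neg h1, if_pos h2, neg_neg]
    · rw [if_neg h2, if_neg h1, if_neg h1, if_neg h2, hd.perm_swap, ha, hd.shift_swap, map_neg]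
      ring

theorem IsSymplData.exists_conjDer (hd : IsSymplData R N K c τ) :
    ∃ σ : A k p (Fin m ⊕ Fin m) ≃ₐ[k] A k p (Fin m ⊕ Fin m),
      (∀ D ∈ H k p m, conjDer σ D ∈ H k p m) ∧ ∀ a : Fin m ⊕ Fin m → k, IsSkew a →
        conjDer σ (diag p R a) = diag p R (symplCoeff R N c τ a) := by
  obtain ⟨σ, hσ⟩ := hd.exists_aut (k := k)
  refine ⟨σ, conjDer_mem_H fun i j => ?_, fun a ha => conjDer_diag _ fun i => ?_⟩
  · have h : ∀ i, σ (x k p i) =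
        symplImage k R N K c τ i - algebraMap k _ (if i ∈ R then 1 else 0) := by
      intro i
      rw [x_eq R i, map_sub, hσ]
      split_ifs <;> simp
    have h0 : ∀ e : k, ham (algebraMap k (A k p (Fin m ⊕ Fin m)) e) = 0 := fun e => by
      rw [Algebra.algebraMap_eq_smul_one, map_smul, ham_one, smul_zero]
    rw [h, h, map_sub, map_sub, h0, sub_zero, Derivation.map_algebraMap, sub_zero,
      hd.ham_symplImage]
  · rw [hσ]
    unfold symplImage symplCoeff
    by_cases h1 : i ∈ R
    · rw [if_pos h1, if_pos h1, diag_mon]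
    · rw [if_neg h1, if_neg h1]
      by_cases h2 : i.swap ∈ R
      · rw [if_pos h2, if_pos h2, Derivation.leibniz, diag_mon, diag_quad hd.inr_notMem ha, map_neg]
        simp [mul_comm]
      · have h3 : τ i ∉ R := fun h => not_or.2 ⟨h1, h2⟩ ((hd.perm_mem i).1 (Or.inl h))
        rw [if_neg h2, if_neg h2, Derivation.leibniz, Derivation.map_smul, diag_mon, diag_x,
          z_of_notMem h3]
        simp only [smul_eq_mul, smul_mul_assoc, mul_smul_comm]
        rw [mul_comm (mon k R (c i))]
        module

end Symplectic

end CartanType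

end

open scoped Pointwise

set_option linter.unusedSectionVars false

noncomputable section

namespace CartanType

attribute [local instance] ZMod.algebra

/-! Matching of coefficients for the Hamiltonian algebras, and the conclusion. -/

section HamiltonianOrbit

variable {k : Type*} [Field k] {p : ℕ} [hp : Fact p.Prime] [CharP k p] {m : ℕ}

/-- A permutation of pairs together with a choice of order in each pair. -/
theorem exists_swapPerm (ρ : Equiv.Perm (Fin m)) (e : Fin m → Prop) :
    ∃ τ : Equiv.Perm (Fin m ⊕ Fin m), (∀ i, τ i.swap = (τ i).swap) ∧
      ∀ j, (e j → τ (Sum.inl j) = Sum.inl (ρ j)) ∧ (¬ e j → τ (Sum.inl j) = Sum.inr (ρ j)) := by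
  classical
  let f : Fin m ⊕ Fin m → Fin m ⊕ Fin m := fun
    | Sum.inl j => if e j then Sum.inl (ρ j) else Sum.inr (ρ j)
    | Sum.inr j => if e j then Sum.inr (ρ j) else Sum.inl (ρ j)
  have h1 : ∀ j, f (Sum.inl j) = if e j then Sum.inl (ρ j) else Sum.inr (ρ j) := fun _ => rfl
  have h2 : ∀ j, f (Sum.inr j) = if e j then Sum.inr (ρ j) else Sum.inl (ρ j) := fun _ => rfl
  have hf : Function.Injective f := by
    have key : ∀ i j, ρ i = ρ j → i = j := fun i j h => ρ.injective h
    rintro (i | i) (j | j) h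
    · rw [h1, h1] at h
      split_ifs at h <;> simp_all
    · rw [h1, h2] at h
      split_ifs at h <;> simp_all
    · rw [h1, h2] at h
      split_ifs at h <;> simp_all
    · rw [h2, h2] at h
      split_ifs at h <;> simp_all
  refine ⟨Equiv.ofBijective f (Finite.injective_iff_bijective.1 hf), ?_, fun j => ⟨fun h => ?_,
    fun h => ?_⟩⟩
  · rintro (i | i)
    · change f (Sum.inr i) = (f (Sum.inl i)).swap
      rw [h1, h2]; split_ifs <;> rfl
    · change f (Sum.inl i) = (f (Sum.inr i)).swap
      rw [h1, h2]; split_ifs <;> rfl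
  · exact (h1 j).trans (if_pos h)
  · exact (h1 j).trans (if_neg h)

/-- The position of a coordinate in its pair. -/
def pairIndex : Fin m ⊕ Fin m → Fin m := Sum.elim id id

/-- `U` is stable under scalars of the prime field, where two is invertible. -/
theorem neg_ne_self_of_notMem {U : AddSubgroup k} (hp3 : 3 ≤ p)
    (hU : ∀ (c : ZMod p), ∀ u ∈ U, c • u ∈ U) {v : k} (hv : v ∉ U) :
    (QuotientAddGroup.mk (-v) : k ⧸ U) ≠ QuotientAddGroup.mk v := by
  intro h
  have h1 := QuotientAddGroup.eq.1 h
  have h2 : (2 : ZMod p) ≠ 0 := by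
    have : (2 : k) ≠ 0 := two_ne_zero_of_three_le (p := p) hp3
    intro h
    apply this
    rw [← map_ofNat (algebraMap (ZMod p) k) 2, h, map_zero]
  refine hv ?_
  have h3 := hU (2 : ZMod p)⁻¹ _ h1
  have h4 : -(-v) + v = (2 : ZMod p) • v := by
    rw [Algebra.smul_def, map_ofNat]; ring
  rwa [h4, inv_smul_smul₀ h2] at h3

/-- As `v` and `-v` are different modulo `U`, a pair with classes `±v` has exactly one member in the
class of `v`. Pairs containing a shifted coordinate have weights in `U` and do not contribute. -/
theorem card_pair_fiber {R : Finset (Fin m ⊕ Fin m)} (hR : ∀ i : Fin m, Sum.inr i ∉ R)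
    {U : AddSubgroup k} {a : Fin m ⊕ Fin m → k} (ha : IsSkew a) (haU : ∀ i ∈ R, a i ∈ U) {v : k}
    (hv : v ∉ U) (hv2 : (QuotientAddGroup.mk (-v) : k ⧸ U) ≠ QuotientAddGroup.mk v) :
    Nat.card {j : {j : Fin m // Sum.inl j ∉ R} //
      s((QuotientAddGroup.mk (a (Sum.inl j)) : k ⧸ U), QuotientAddGroup.mk (-a (Sum.inl j))) =
        s(QuotientAddGroup.mk v, QuotientAddGroup.mk (-v))} =
      Nat.card {i // i ∉ R ∧ -v + a i ∈ U} := by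
  have hmem : ∀ i, -v + a i ∈ U ↔ (QuotientAddGroup.mk v : k ⧸ U) = QuotientAddGroup.mk (a i) :=
    fun i => QuotientAddGroup.eq.symm
  have hinr : ∀ j, a (Sum.inr j) = -a (Sum.inl j) := fun j => ha (Sum.inl j)
  have hnR : ∀ i, i ∉ R → -v + a i ∈ U → Sum.inl (pairIndex i) ∉ R := by
    rintro (j | j) h1 h2
    · exact h1
    · intro h
      refine hv ?_
      have h3 := haU _ h
      rw [hinr] at h2
      have := neg_mem (add_mem h2 h3)
      change -(-v + -a (Sum.inl j) + a (Sum.inl j)) ∈ U at this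
      rwa [neg_add_cancel_right, neg_neg] at this
  have hfib : ∀ i, -v + a i ∈ U → s((QuotientAddGroup.mk (a (Sum.inl (pairIndex i))) : k ⧸ U),
      QuotientAddGroup.mk (-a (Sum.inl (pairIndex i)))) =
        s(QuotientAddGroup.mk v, QuotientAddGroup.mk (-v)) := by
    rintro (j | j) h
    · rw [hmem] at h
      change s((QuotientAddGroup.mk (a (Sum.inl j)) : k ⧸ U),
        QuotientAddGroup.mk (-a (Sum.inl j))) = _
      rw [QuotientAddGroup.mk_neg, QuotientAddGroup.mk_neg, h]
    · rw [hmem, hinr] at h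
      change s((QuotientAddGroup.mk (a (Sum.inl j)) : k ⧸ U),
        QuotientAddGroup.mk (-a (Sum.inl j))) = _
      rw [← h, QuotientAddGroup.mk_neg U v, h, QuotientAddGroup.mk_neg, neg_neg, Sym2.eq_swap]
  symm
  refine Nat.card_eq_of_bijective (fun i => ⟨⟨pairIndex i.1, hnR i.1 i.2.1 i.2.2⟩,
    hfib i.1 i.2.2⟩) ⟨?_, ?_⟩
  · have key : ∀ j, -v + a (Sum.inl j) ∈ U → -v + a (Sum.inr j) ∈ U → False := by
      intro j h1 h2
      rw [hmem] at h1 h2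
      refine hv2 ?_
      rw [h2, hinr, QuotientAddGroup.mk_neg, h1, QuotientAddGroup.mk_neg]
    rintro ⟨i | i, h1, h2⟩ ⟨j | j, h3, h4⟩ h
    · have : i = j := congrArg (fun q => q.1.1) h
      subst this; rfl
    · have : i = j := congrArg (fun q => q.1.1) h
      subst this; exact (key _ h2 h4).elim
    · have : i = j := congrArg (fun q => q.1.1) h
      subst this; exact (key _ h4 h2).elim
    · have : i = j := congrArg (fun q => q.1.1) h
      subst this; rfl
  · rintro ⟨⟨j, hj⟩, h⟩
    rcases Sym2.eq_iff.1 h with ⟨h1, -⟩ | ⟨-, h1⟩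
    · exact ⟨⟨Sum.inl j, hj, (hmem _).2 h1.symm⟩, rfl⟩
    · exact ⟨⟨Sum.inr j, hR j, (hmem _).2 (by rw [hinr]; exact h1.symm)⟩, rfl⟩

/-- Pairs are matched by the unordered pair of their classes modulo `U`; each is then oriented so
that the classes of its two members agree. -/
theorem exists_swapPerm_of_card_weight_eq (hp3 : 3 ≤ p) {R : Finset (Fin m ⊕ Fin m)}
    (hR : ∀ i : Fin m, Sum.inr i ∉ R)
    {a b : Fin m ⊕ Fin m → k} (ha : IsSkew a) (hb : IsSkew b)
    (hU : Set.range (wt (p := p) R a) = Set.range (wt (p := p) R b))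
    (h : ∀ v ∉ Set.range (wt (p := p) R a),
        Nat.card {j // j ∉ R ∧ v + a j ∈ Set.range (wt (p := p) R a)} =
          Nat.card {j // j ∉ R ∧ v + b j ∈ Set.range (wt (p := p) R a)}) :
    ∃ (τ : Equiv.Perm (Fin m ⊕ Fin m)) (c : Fin m ⊕ Fin m → Fin m ⊕ Fin m → ZMod p),
      (∀ i, τ i.swap = (τ i).swap) ∧
      (∀ i, (τ i ∈ R ∨ (τ i).swap ∈ R) ↔ (i ∈ R ∨ i.swap ∈ R)) ∧ (∀ i, c i.swap = -c i) ∧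
      ∀ i, i ∉ R → i.swap ∉ R → b i = a (τ i) + wt R a (c i) := by
  classical
  let U : AddSubgroup k := (wt (p := p) R a).toAddMonoidHom.range
  have hUa : ∀ v, v ∈ Set.range (wt (p := p) R a) ↔ v ∈ U := fun v => Iff.rfl
  have haU : ∀ i ∈ R, a i ∈ U := fun i hi => (hUa _).1 ⟨_, wt_single R a hi⟩
  have hbU : ∀ i ∈ R, b i ∈ U := fun i hi => by
    rw [← hUa, hU]; exact ⟨_, wt_single R b hi⟩
  have hsmul : ∀ (c : ZMod p), ∀ u ∈ U, c • u ∈ U := by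
    rintro c _ ⟨α, rfl⟩
    exact ⟨c • α, map_smul (wt (p := p) R a) c α⟩
  obtain ⟨ρ, hρ⟩ := exists_perm_of_card_fiber_eq
    (fun j : {j : Fin m // Sum.inl j ∉ R} => s((QuotientAddGroup.mk (a (Sum.inl j)) : k ⧸ U),
      QuotientAddGroup.mk (-a (Sum.inl j))))
    (fun j : {j : Fin m // Sum.inl j ∉ R} => s((QuotientAddGroup.mk (b (Sum.inl j)) : k ⧸ U),
      QuotientAddGroup.mk (-b (Sum.inl j)))) s(0, 0) (by
      intro q hq
      -- An unordered pair of classes not of the form `{v, -v}` has empty fibre on both sides.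
      by_cases hq' : ∃ v : k, q = s(QuotientAddGroup.mk v, QuotientAddGroup.mk (-v))
      · obtain ⟨v, rfl⟩ := hq'
        have hv : v ∉ U := by
          intro hv
          refine hq ?_
          rw [(QuotientAddGroup.eq_zero_iff v).2 hv,
            (QuotientAddGroup.eq_zero_iff (-v)).2 (neg_mem hv)]
        have hv2 := neg_ne_self_of_notMem hp3 hsmul hv
        rw [card_pair_fiber hR ha haU hv hv2, card_pair_fiber hR hb hbU hv hv2]
        exact h (-v) (by rw [hUa, neg_mem_iff]; exact hv)
      · have : ∀ a : Fin m ⊕ Fin m → k, IsEmpty {j : {j : Fin m // Sum.inl j ∉ R} //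
            s((QuotientAddGroup.mk (a (Sum.inl j)) : k ⧸ U),
              QuotientAddGroup.mk (-a (Sum.inl j))) = q} :=
          fun a => ⟨fun j => hq' ⟨_, j.2.symm⟩⟩
        have h1 := this a
        have h2 := this b
        rw [Nat.card_of_isEmpty, Nat.card_of_isEmpty])
  let ρ' : Equiv.Perm (Fin m) := Equiv.Perm.ofSubtype (p := fun j : Fin m => Sum.inl j ∉ R) ρ
  have hρ' : ∀ j (hj : Sum.inl j ∉ R), ρ' j = ρ ⟨j, hj⟩ := fun j hj =>
    Equiv.Perm.ofSubtype_apply_of_mem (p := fun j : Fin m => Sum.inl j ∉ R) ρ hj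
  have hρR : ∀ j, Sum.inl (ρ' j) ∈ R ↔ Sum.inl j ∈ R := by
    intro j
    by_cases hj : Sum.inl j ∈ R
    · rw [show ρ' j = j from Equiv.Perm.ofSubtype_apply_of_not_mem
        (p := fun j : Fin m => Sum.inl j ∉ R) _ (not_not.2 hj)]
    · rw [hρ' j hj]
      exact iff_of_false (ρ ⟨j, hj⟩).2 hj
  -- A pair keeps its order exactly when the weights of its left members already agree modulo `U`.
  obtain ⟨τ, hτ, hτe⟩ := exists_swapPerm ρ' fun j => b (Sum.inl j) - a (Sum.inl (ρ' j)) ∈ U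
  have hval : ∀ j, Sum.inl j ∉ R → b (Sum.inl j) - a (τ (Sum.inl j)) ∈ U := by
    intro j hj
    by_cases he : b (Sum.inl j) - a (Sum.inl (ρ' j)) ∈ U
    · rwa [(hτe j).1 he]
    · rw [(hτe j).2 he]
      have h1 := hρ ⟨j, hj⟩
      simp only at h1
      rw [← hρ' j hj] at h1
      have h2 : a (Sum.inr (ρ' j)) = -a (Sum.inl (ρ' j)) := ha (Sum.inl (ρ' j))
      rcases Sym2.eq_iff.1 h1 with ⟨h3, -⟩ | ⟨-, h3⟩
      · refine absurd ?_ he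
        have := QuotientAddGroup.eq.1 h3
        rwa [neg_add_eq_sub] at this
      · have := QuotientAddGroup.eq.1 h3
        rwa [neg_add_eq_sub, ← h2] at this
  have hc : ∀ j : Fin m, ∃ c : Fin m ⊕ Fin m → ZMod p, Sum.inl j ∉ R →
      b (Sum.inl j) = a (τ (Sum.inl j)) + wt R a c := by
    intro j
    by_cases hj : Sum.inl j ∈ R
    · exact ⟨0, fun h => absurd hj h⟩
    · obtain ⟨c, hc⟩ := hval j hj
      refine ⟨c, fun _ => ?_⟩
      change wt R a c = _ at hc
      rw [hc]; ring
  choose c hc using hc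
  refine ⟨τ, Sum.elim c fun j => -c j, hτ, ?_, ?_, ?_⟩
  · have key : ∀ j : Fin m, (τ (Sum.inl j) ∈ R ∨ (τ (Sum.inl j)).swap ∈ R) ↔ Sum.inl j ∈ R := by
      intro j
      rw [← hρR]
      by_cases he : b (Sum.inl j) - a (Sum.inl (ρ' j)) ∈ U
      · rw [(hτe j).1 he, Sum.swap_inl]
        simp [hR]
      · rw [(hτe j).2 he, Sum.swap_inr]
        simp [hR]
    rintro (j | j)
    · rw [key, Sum.swap_inl]
      simp [hR]
    · have h1 := hτ (Sum.inl j)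
      rw [Sum.swap_inl] at h1
      rw [h1, Sum.swap_swap, or_comm, key, Sum.swap_inr]
      simp [hR]
  · rintro (j | j) <;> simp
  · rintro (j | j) h1 h2
    · exact hc j h1
    · have h3 := hτ (Sum.inl j)
      rw [Sum.swap_inl] at h3
      have h4 : b (Sum.inr j) = -b (Sum.inl j) := hb (Sum.inl j)
      rw [h3, ha, h4, hc j h2, Sum.elim_inr, map_neg]
      ring

/-! ### The standard torus of the Hamiltonian algebra and its orbits. -/

/-- The indices of the shifted coordinates of the Hamiltonian torus. -/
def initialH (m r : ℕ) : Finset (Fin m ⊕ Fin m) := (initial m r).disjSum ∅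

theorem inl_mem_initialH {r : ℕ} {i : Fin m} : Sum.inl i ∈ initialH m r ↔ i.val < r := by
  rw [initialH, Finset.inl_mem_disjSum, mem_initial]

theorem inr_notMem_initialH {r : ℕ} (i : Fin m) : Sum.inr i ∉ initialH m r := by
  rw [initialH, Finset.inr_mem_disjSum]; exact Finset.notMem_empty i

theorem smul_euler_sub_sum_eq_diag {r : ℕ} (a : Fin m → k) :
    ∑ i, a i • (euler k p (i.val < r) (Sum.inl i) - euler k p False (Sum.inr i)) =
      diag p (initialH m r) (Sum.elim a fun i => -a i) := by
  apply der_ext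
  intro j
  rw [der_sum_apply, diag_x]
  simp only [Derivation.smul_apply, Derivation.sub_apply, euler_x]
  rcases j with j | j
  · rw [Sum.elim_inl, z]
    simp [inl_mem_initialH]
  · rw [Sum.elim_inr, z_of_notMem (inr_notMem_initialH j)]
    simp

theorem isSkew_iff_exists {a : Fin m ⊕ Fin m → k} :
    IsSkew a ↔ ∃ b : Fin m → k, a = Sum.elim b fun i => -b i := by
  constructor
  · intro h
    refine ⟨fun i => a (Sum.inl i), funext ?_⟩
    rintro (i | i)
    · rfl
    · exact h (Sum.inl i)
  · rintro ⟨b, rfl⟩ (i | i) <;> simp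

theorem mem_torusH {r : ℕ} (D : derived k p (H k p m) 2) :
    D ∈ torusH k p m r ↔ ∃ a ∈ {a : Fin m ⊕ Fin m → k | IsSkew a},
      (D : Derivation k (A k p (Fin m ⊕ Fin m)) (A k p (Fin m ⊕ Fin m))) =
        diag p (initialH m r) a := by
  have h1 : {D | ∃ i : Fin m, D = euler k p (i.val < r) (Sum.inl i) - euler k p False (Sum.inr i)} =
      Set.range fun i : Fin m =>
        euler k p (i.val < r) (Sum.inl i) - euler k p False (Sum.inr i) := by
    ext D; simp [eq_comm]
  rw [torusH, Submodule.mem_comap, h1, Submodule.mem_span_range_iff_exists_fun]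
  simp only [smul_euler_sub_sum_eq_diag]
  constructor
  · rintro ⟨a, ha⟩
    exact ⟨_, isSkew_iff_exists.2 ⟨a, rfl⟩, ha.symm⟩
  · rintro ⟨a, ha, hD⟩
    obtain ⟨b, rfl⟩ := isSkew_iff_exists.1 ha
    exact ⟨b, hD.symm⟩

variable [IsAlgClosed k]

theorem orbit_inter_indexPart_H (hp3 : 3 ≤ p) (m r : ℕ) (hm : 1 ≤ m) (h1 : m = 1 → 5 ≤ p)
    (hr : r ≤ mu p (derived k p (H k p m) 2)) (d : derived k p (H k p m) 2)
    (hd : d ∈ indexPart p (derived k p (H k p m) 2) (torusH k p m) r) :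
    MulAction.orbit (autP p (derived k p (H k p m) 2)) d ∩
        indexPart p (derived k p (H k p m) 2) (torusH k p m) r =
      {t | ∃ w : weylGroup p (derived k p (H k p m) 2) (torusH k p m r),
        t = (w • (⟨d, hd.1⟩ :
          (torusH k p m r : Set (derived k p (H k p m) 2)))).1} := by
  rcases lt_or_ge m r with hmr | hmr
  · refine absurd hd (notMem_indexPart_of_eq hr hmr ?_ d)
    ext D
    have : initialH m r = initialH m m := by
      ext i
      rcases i with i | i
      · rw [inl_mem_initialH, inl_mem_initialH]; omega
      · exact iff_of_false (inr_notMem_initialH i) (inr_notMem_initialH i)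
    rw [mem_torusH, mem_torusH, this]
  have hpair : (∀ i : Fin m ⊕ Fin m, ∃ j, j ≠ i ∧ j ≠ i.swap) ∨ 5 ≤ p := by
    by_cases h : m = 1
    · exact Or.inr (h1 h)
    · left
      have : Nontrivial (Fin m) := Fin.nontrivial_iff_two_le.2 (by omega)
      rintro (i | i) <;> obtain ⟨j, hj⟩ := exists_ne i <;>
        exact ⟨Sum.inl j, by simp [hj], by simp [hj]⟩
  have hinr : ∀ i : Fin m, Sum.inr i ∉ initialH m r := inr_notMem_initialH
  have hsgn : ∀ i ∈ initialH m r, sgn k i = 1 := by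
    rintro (i | i) hi
    · rfl
    · exact absurd hi (hinr i)
  refine orbit_inter_indexPart_of_moves hr (initialH m r) {a | IsSkew a} (isAmple_H hp3 hpair)
    (fun a ha _ => isRich_H hp3 hpair hsgn ha) mem_torusH ?_ ?_ d hd
  · intro a ha0 ha
    have hr0 : 0 < r := by
      by_contra h
      refine ha fun α _ i hi => ?_
      rcases i with i | i
      · exact absurd (inl_mem_initialH.1 hi) (by omega)
      · exact absurd hi (hinr i)
    have hi₁ : Sum.inl (⟨r - 1, by omega⟩ : Fin m) ∈ initialH m r :=
      inl_mem_initialH.2 (by simp; omega)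
    obtain ⟨N, K, hNK, h0⟩ := exists_invPair_of_not_indep _ ha hi₁
    -- To remove a shift only the shifted coordinates and their conjugates need to change, so the
    -- permutation and the shifts `c` are trivial.
    have hdata : IsSymplData (initialH m r) N K 0 1 :=
      ⟨hinr, hNK, fun _ => rfl, fun _ => Iff.rfl, fun _ => by simp⟩
    obtain ⟨σ, hσH, hσ⟩ := hdata.exists_conjDer (k := k)
    refine ⟨σ, conjDer_mem_derived hσH 2, r - 1, by omega, fun s hs => (mem_torusH s).2 ?_⟩
    rw [hσ a ha0] at hs
    refine ⟨_, hdata.isSkew_symplCoeff ha0, hs.trans (diag_congr fun i hi => ?_)⟩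
    rcases i with i | i
    · rw [inl_mem_initialH, inl_mem_initialH]
      refine ⟨fun hir => ?_, fun hir => by omega⟩
      by_contra hir'
      have : i = ⟨r - 1, by omega⟩ := Fin.ext (by simp; omega)
      rw [symplCoeff, if_pos (inl_mem_initialH.2 hir), this] at hi
      exact hi h0
    · exact iff_of_false (inr_notMem_initialH i) (inr_notMem_initialH i)
  · intro a ha0 b hb0 ha hb hU hcard
    obtain ⟨N, K, hNK, hN⟩ := exists_invPair_of_range_eq ha hb hU
    obtain ⟨τ, c, hτ1, hτ2, hc1, hc2⟩ :=
      exists_swapPerm_of_card_weight_eq hp3 hinr ha0 hb0 hU hcard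
    have hdata : IsSymplData (initialH m r) N K c τ := ⟨hinr, hNK, hτ1, hτ2, hc1⟩
    obtain ⟨σ, hσH, hσ⟩ := hdata.exists_conjDer (k := k)
    refine ⟨σ, conjDer_mem_derived hσH 2,
      fun a' ha' => ⟨_, hdata.isSkew_symplCoeff ha', hσ a' ha'⟩, ?_⟩
    rw [hσ a ha0]
    congr 1
    ext i
    unfold symplCoeff
    split_ifs with h1 h2
    · exact hN i h1
    · rw [hN _ h2, hb0, neg_neg]
    · exact (hc2 i h1 h2).symm

end HamiltonianOrbit

end CartanType

end

open CartanType in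
theorem corollary4p3 {k : Type*} [Field k] [IsAlgClosed k] (p : ℕ) [Fact p.Prime] [CharP k p]
    (hp : 3 ≤ p) :
    (∀ n r : ℕ, 1 ≤ n → (n = 1 → 5 ≤ p) → r ≤ mu p (W k p (Fin n)) →
      ∀ (d : W k p (Fin n)) (hd : d ∈ indexPart p (W k p (Fin n)) (torusW k p n) r),
        MulAction.orbit (autP p (W k p (Fin n))) d ∩
            indexPart p (W k p (Fin n)) (torusW k p n) r =
          {t | ∃ w : weylGroup p (W k p (Fin n)) (torusW k p n r),
            t = (w • (⟨d, hd.1⟩ : (torusW k p n r : Set (W k p (Fin n))))).1}) ∧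
    (∀ n r : ℕ, 3 ≤ n → r ≤ mu p (derived k p (S k p (Fin n)) 1) →
      ∀ (d : derived k p (S k p (Fin n)) 1)
        (hd : d ∈ indexPart p (derived k p (S k p (Fin n)) 1) (torusS k p n) r),
        MulAction.orbit (autP p (derived k p (S k p (Fin n)) 1)) d ∩
            indexPart p (derived k p (S k p (Fin n)) 1) (torusS k p n) r =
          {t | ∃ w : weylGroup p (derived k p (S k p (Fin n)) 1) (torusS k p n r),
            t = (w • (⟨d, hd.1⟩ :
              (torusS k p n r : Set (derived k p (S k p (Fin n)) 1)))).1}) ∧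
    (∀ m r : ℕ, 1 ≤ m → (m = 1 → 5 ≤ p) → r ≤ mu p (derived k p (H k p m) 2) →
      ∀ (d : derived k p (H k p m) 2)
        (hd : d ∈ indexPart p (derived k p (H k p m) 2) (torusH k p m) r),
        MulAction.orbit (autP p (derived k p (H k p m) 2)) d ∩
            indexPart p (derived k p (H k p m) 2) (torusH k p m) r =
          {t | ∃ w : weylGroup p (derived k p (H k p m) 2) (torusH k p m r),
            t = (w • (⟨d, hd.1⟩ :
              (torusH k p m r : Set (derived k p (H k p m) 2)))).1}) := by
  refine ⟨fun n r h1 hn hr d hd => orbit_inter_indexPart_W hp n r hn h1 hr d hd,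
    fun n r hn hr d hd => orbit_inter_indexPart_S hp n r hn hr d hd,
    fun m r h1 hm hr d hd => orbit_inter_indexPart_H hp m r h1 hm hr d hd⟩
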